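/- Let $r_1<\dots<r_K$ be positive rates, $\tau\ge 3$ an integer window size, $c>0$, $\sigma>0$. In every slot $t=1,2,\dots$ a rate $k(t)\in\{1,\dots,K\}$ is selected, based on the past, and the reward $r_{k(t)}X_{k(t)}(t)$ is received, where $X_k(t)$ is Bernoulli with mean $\theta_k(t)$ and the vectors $(X_k(t))_{k\le K}$ are independent in $t$ (for a fixed $t$ their coordinates may be dependent). Assume that $|\theta_k(t')-\theta_k(t)|\le\sigma|t'-t|$ for all $k,t,t'$. Let $k^\star(t)\in\arg\max_k r_k\theta_k(t)$ and let $$R(T)=\sum_{t=1}^T\Big(r_{k^\star(t)}\theta_{k^\star(t)}(t)-\mathbb{E}\big[r_{k(t)}\theta_{k(t)}(t)\big]\Big)$$ be the regret. Let $I(p,q)=p\log\frac pq+(1-p)\log\frac{1-p}{1-q}$, with the usual conventions ($0\log 0=0$ and $I(p,q)=+\infty$ if $p\ne q$ and $q\notin(0,1)$). Let $t_k^\tau(n)$ be the number of slots $t\in\{n-\tau,\dots,n-1\}$, $t\ge1$, with $k(t)=k$, let $\hat\mu_k^\tau(n)$ be the average reward received in these slots ($0$ if there are none), and $$q_k^\tau(n)=\max\Big\{q\in[0,r_k]:\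 t_k^\tau(n)\,I\Big(\tfrac{\hat\mu_k^\tau(n)}{r_k},\tfrac{q}{r_k}\Big)\le\log\tau+c\log\log\tau\Big\}.$$ The algorithm SW-KL-R-UCB selects $k(n)=n$ for $n=1,\dots,K$, and $k(n)\in\arg\max_k q_k^\tau(n)$ for $n>K$ (ties are broken arbitrarily). For $I_{\min}>0$ let $G(T,I_{\min},\tau,\sigma)$ be the number of pairs $(n,k)$ with $1\le n\le T$, $k\ne k^\star(n)$, such that $$r_k(\theta_k(n)+\tau\sigma)\ge r_{k^\star(n)}(\theta_{k^\star(n)}(n)-\tau\sigma)\quad\text{or}\quad I\Big(\theta_k(n)+\tau\sigma,\ \tfrac{r_{k^\star(n)}(\theta_{k^\star(n)}(n)-\tau\sigma)}{r_k}\Big)<I_{\min},$$ and let $$g_0=\frac12\min_{1\le n\le T}\ \min_{\substack{k\ne k^\star(n)\\ r_{k^\star(n)}(\theta_{k^\star(n)}(n)-\sigma\tau)<r_k}}\ \frac{r_{k^\star(n)}}{r_k}\big(\theta_{k^\star(n)}(n)-\sigma\tau\big)\Big[1-\frac{r_{k^\star(n)}}{r_k}\big(\theta_{k^\star(n)}(n)-\sigma\tau\big)\Big],$$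 where $g_0=0$ if there is no such pair $(n,k)$. Theorem. For all $c>0$, $I_{\min}>0$, $\epsilon>0$ and every value of the largest rate $r_K>0$ there is a constant $C>0$, which depends on these four numbers only (and not on $K$, $r_1,\dots,r_{K-1}$, $\theta$, $\sigma$, $\tau$, $T$ or the way ties are broken), such that, for every $T\ge\tau\ge 3$, the regret of SW-KL-R-UCB with window $\tau$ satisfies $$\frac{R(T)}{T}\le r_K\Big(\sqrt{I_{\min}/2}+2\tau\sigma\Big)\frac{G(T,I_{\min},\tau,\sigma)}{T}+K r_K(1+\epsilon)\frac{\log\tau+c\log\log\tau}{\tau I_{\min}}+\frac{C K}{(\tau\log(\tau)^c)^{g_0\epsilon^2}} .$$ -/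

import Mathlib

open MeasureTheory ProbabilityTheory Finset

noncomputable section

/-- Kullback-Leibler divergence `I(p, q)` between the Bernoulli distributions with means `p` and
`q`, with the usual conventions `0 log 0 = 0` and `I(p, q) = +∞` when `q ∈ {0, 1}` and `p ≠ q`.
It is used for `p ∈ [0, 1]`. The value is also `+∞` for `q ∉ [0, 1]`, `p ≠ q` (a mean `q > 1`
cannot be reached). -/
def bernKL (p q : ℝ) : EReal :=
  if p = q then 0
  else if 0 < q ∧ q < 1 then
    ((p * Real.log (p / q) + (1 - p) * Real.log ((1 - p) / (1 - q)) : ℝ) : EReal)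
  else ⊤

/-- The non-stationary Bernoulli model together with a non-anticipating selection rule.
`X n ω k` says whether a transmission at rate number `k` in slot `n` is (or would be) successful,
`θ n k` is its probability and `sel n ω` is the rate selected in slot `n`. The outcome vector of
slot `n` is independent of the past `ℱ (n - 1)`, and the selection in slot `n` is a function of the
past. Outcomes of the same slot at different rates may be dependent, and `ℱ` may carry additional
randomness (randomised tie-breaking). Slots are numbered `1, 2, …`. -/
structure IsBernoulliModel {Ω : Type*} [mΩ : MeasurableSpace Ω] (μ : Measure Ω) {K : ℕ}
    (ℱ : Filtration ℕ mΩ) (θ : ℕ → Fin K → ℝ) (X : ℕ → Ω → Fin K → Bool)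
    (sel : ℕ → Ω → Fin K) : Prop where
  adapted : ∀ n, 1 ≤ n → Measurable[ℱ n] (X n)
  indep : ∀ n, 1 ≤ n → Indep (MeasurableSpace.comap (X n) inferInstance) (ℱ (n - 1)) μ
  law : ∀ n, 1 ≤ n → ∀ k, μ {ω | X n ω k = true} = ENNReal.ofReal (θ n k)
  nonanticipating : ∀ n, 1 ≤ n → Measurable[ℱ (n - 1)] (sel n)

section Algorithm

variable {Ω : Type*} {K : ℕ}

/-- `t_k^τ(n)`: how often rate `k` was selected in the slots `n - τ, …, n - 1`
(only slots `≥ 1` exist). -/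
def windowCount (sel : ℕ → Ω → Fin K) (τ n : ℕ) (k : Fin K) (ω : Ω) : ℕ :=
  ∑ t ∈ Finset.Ico (max 1 (n - τ)) n, if sel t ω = k then 1 else 0

/-- `μ̂_k^τ(n)`: empirical average reward of rate `k` over the window; it is `0` if the rate was
not selected in the window. -/
def windowMean (r : Fin K → ℝ) (X : ℕ → Ω → Fin K → Bool) (sel : ℕ → Ω → Fin K)
    (τ n : ℕ) (k : Fin K) (ω : Ω) : ℝ :=
  (1 / (windowCount sel τ n k ω : ℝ)) *
    ∑ t ∈ Finset.Ico (max 1 (n - τ)) n, if sel t ω = k ∧ X t ω k = true then r k else 0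

/-- `log τ + c log log τ`. -/
def explorationLevel (c : ℝ) (τ : ℕ) : ℝ :=
  Real.log τ + c * Real.log (Real.log τ)

/-- `q_k^τ(n)`: the largest `q ∈ [0, r_k]` with
`t_k^τ(n) I(μ̂_k^τ(n) / r_k, q / r_k) ≤ log τ + c log log τ`. For `τ ≥ 3` the set is non-empty and
compact, so that the supremum is a maximum. -/
def klIndex (r : Fin K → ℝ) (c : ℝ) (τ : ℕ) (X : ℕ → Ω → Fin K → Bool)
    (sel : ℕ → Ω → Fin K) (n : ℕ) (k : Fin K) (ω : Ω) : ℝ :=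
  sSup {q : ℝ | q ∈ Set.Icc 0 (r k) ∧
    ((windowCount sel τ n k ω : ℝ) : EReal) *
        bernKL (windowMean r X sel τ n k ω / r k) (q / r k)
      ≤ ((explorationLevel c τ : ℝ) : EReal)}

/-- `sel` is a run of SW-KL-R-UCB with window size `τ` and parameter `c`: the `n`-th rate is
selected in slot `n` for `n = 1, …, K`, and afterwards a rate with the largest index is selected
(ties are broken arbitrarily). The `k`-th rate has number `k - 1` in `Fin K`. -/
def IsSWKLRUCB (r : Fin K → ℝ) (c : ℝ) (τ : ℕ) (X : ℕ → Ω → Fin K → Bool)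
    (sel : ℕ → Ω → Fin K) : Prop :=
  ∀ ω n, 1 ≤ n →
    (n ≤ K → (sel n ω : ℕ) + 1 = n) ∧
    (K < n → ∀ j, klIndex r c τ X sel n j ω ≤ klIndex r c τ X sel n (sel n ω) ω)

end Algorithm

section Environment

variable {K : ℕ}

/-- Every success probability is `σ`-Lipschitz in time. -/
def LipschitzEvolution (θ : ℕ → Fin K → ℝ) (σ : ℝ) : Prop :=
  ∀ k t t', 1 ≤ t → 1 ≤ t' → |θ t' k - θ t k| ≤ σ * |(t' : ℝ) - (t : ℝ)|

/-- `kstar n` is a rate with the largest expected reward in slot `n`. -/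
def IsBestRate (r : Fin K → ℝ) (θ : ℕ → Fin K → ℝ) (kstar : ℕ → Fin K) : Prop :=
  ∀ n, 1 ≤ n → ∀ j, r j * θ n j ≤ r (kstar n) * θ n (kstar n)

/-- The (expected) regret
`R(T) = ∑_{t = 1}^T (r_{k⋆(t)} θ_{k⋆(t)}(t) - 𝔼[r_{k(t)} θ_{k(t)}(t)])`. -/
def regret {Ω : Type*} [MeasurableSpace Ω] (μ : Measure Ω) (r : Fin K → ℝ)
    (θ : ℕ → Fin K → ℝ) (kstar : ℕ → Fin K) (sel : ℕ → Ω → Fin K) (T : ℕ) : ℝ :=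
  ∑ t ∈ Finset.Icc 1 T,
    (r (kstar t) * θ t (kstar t) - ∫ ω, r (sel t ω) * θ t (sel t ω) ∂μ)

open Classical in
/-- `G(T, I_min, τ, σ)`: the number of pairs `(n, k)` with `1 ≤ n ≤ T`, `k ≠ k⋆(n)`, such that `k`
cannot be distinguished well enough from `k⋆(n)`. -/
def confusionCount (r : Fin K → ℝ) (θ : ℕ → Fin K → ℝ) (kstar : ℕ → Fin K)
    (T : ℕ) (Imin : ℝ) (τ : ℕ) (σ : ℝ) : ℕ :=
  ∑ n ∈ Finset.Icc 1 T, ∑ k ∈ Finset.univ.filter (fun k => k ≠ kstar n),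
    if r (kstar n) * (θ n (kstar n) - τ * σ) ≤ r k * (θ n k + τ * σ) ∨
        bernKL (θ n k + τ * σ) (r (kstar n) * (θ n (kstar n) - τ * σ) / r k) < (Imin : EReal)
    then 1 else 0

/-- `g₀`: one half of the minimum of `x (1 - x)`, `x = (r_{k⋆(n)} / r_k) (θ_{k⋆(n)}(n) - σ τ)`, over
the finitely many pairs `(n, k)` with `1 ≤ n ≤ T`, `k ≠ k⋆(n)` and
`r_{k⋆(n)} (θ_{k⋆(n)}(n) - σ τ) < r_k`. If there is no such pair then `g₀ = 0`. -/
def gZero (r : Fin K → ℝ) (θ : ℕ → Fin K → ℝ) (kstar : ℕ → Fin K)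
    (T τ : ℕ) (σ : ℝ) : ℝ :=
  (1 / 2) * sInf {y : ℝ | ∃ n k, 1 ≤ n ∧ n ≤ T ∧ k ≠ kstar n ∧
    r (kstar n) * (θ n (kstar n) - σ * τ) < r k ∧
    y = (r (kstar n) / r k * (θ n (kstar n) - σ * τ)) *
      (1 - r (kstar n) / r k * (θ n (kstar n) - σ * τ))}

end Environment

end

noncomputable section

/-! Write L = log τ + c log log τ, so that e^L = τ (log τ)^c is the base of the last term, and g for
g₀. Call rate k confused in slot n if the pair is counted in G, and clear otherwise. Let p = θ_k +
τσ (`upMean`) bound the mean of k in the window, and let x (`needMean`) be the mean with which k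
would match the lower bound for the best rate. A clear pair has p < x, and divergence KL(p, x) ≥
Imin if x < 1. Selecting a confused rate costs at most rK(√(Imin/2) + 2τσ), by Pinsker's inequality.
A clear rate is selected only if the index of the best rate is too low, or the rate has fewer than l
samples in the window, or these samples overestimate it (`IsRun.sel_prob_le`). The second event
happens at most l + 1 times in τ consecutive slots. The other two are controlled by exponential
supermartingales along predictable sampling (`IsBernoulliModel.measureReal_le_exp_neg`), together
with peeling over the sample size.

If 0 < gε² ≤ 1/2, the last term is at least CK e^(-L/2) and absorbs every power of L divided by τ,
so that crude estimates suffice (`IsRun.regret_div_le_of_small`).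

If gε² > 1/2, then ε ≥ 2 because g ≤ 1/8, and all needed means x < 1 stay away from 0 and 1 by a
distance depending on ε only. It remains to reach 3L/(τ Imin) per rate for large τ, with error terms
that are small against L/τ (`IsRun.sum_clear_le_of_largeLevel`). There are two obstacles. (a) Plain
peeling bounds the failure of the best index by L² e^(-L), about L^(2-c)/τ, which is too much for c
≤ 1. With a relative margin m only sample sizes in a range of ratio 2/m³ matter, and the bound
becomes L log(1/m) e^(-L) (`IsBernoulliModel.measureReal_klIndex_le_of_margin`).
`IsRun.sum_clear_le` finds such a margin, or a compensating small gap, for all but a small part of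
the slots. (b) With about L samples, overestimation has probability far above 1/τ. It is rare,
however, relative to the selections of the rate in the windows concerned
(`IsBernoulliModel.sum_measureReal_overestimate_le`), and clear selections number only T/τ times a
power of L. A window with many confused slots but few selections of k contains many confused slots
in which k is not selected; these cause no regret through k, and their share of G pays for the error
(`sum_ite_le_sum_unselected`).

Small τ and g ≤ 0 are covered by the trivial bound rK. -/

/-! ### The Bernoulli divergence as a real function -/

/-- The formula for the divergence between Bernoulli distributions, as a real number. -/
def klR (p q : ℝ) : ℝ := p * Real.log (p / q) + (1 - p) * Real.log ((1 - p) / (1 - q))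

open InformationTheory in
theorem klFun_le_sq {a : ℝ} (ha : 0 ≤ a) : klFun a ≤ (a - 1) ^ 2 := by
  rcases ha.eq_or_lt with rfl | ha
  · simp [klFun_zero]
  · have := mul_le_mul_of_nonneg_left (Real.log_le_sub_one_of_pos ha) ha.le
    rw [klFun_apply]; nlinarith

open InformationTheory in
theorem sq_le_klFun {a : ℝ} (ha : 0 ≤ a) (ha1 : a ≤ 1) : (1 - a) ^ 2 / 2 ≤ klFun a := by
  have h : AntitoneOn (fun a => klFun a - (1 - a) ^ 2 / 2) (Set.Icc 0 1) := by
    apply antitoneOn_of_deriv_nonpos (convex_Icc 0 1)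
    · exact (continuous_klFun.sub (by fun_prop)).continuousOn
    · intro x hx
      rw [interior_Icc] at hx
      exact ((hasDerivAt_klFun hx.1.ne').differentiableAt.sub (by fun_prop)).differentiableWithinAt
    · intro x hx
      rw [interior_Icc] at hx
      have h1 : HasDerivAt (fun a : ℝ => (1 - a) ^ 2 / 2) (-(1 - x)) x := by
        have := (((hasDerivAt_const x (1 : ℝ)).sub (hasDerivAt_id x)).pow 2).div_const 2
        refine this.congr_deriv ?_
        norm_num
        try ring
      have h2 := (hasDerivAt_klFun hx.1.ne').sub h1
      have h3 : deriv (fun a => klFun a - (1 - a) ^ 2 / 2) x = _ := h2.deriv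
      rw [h3]
      linarith [Real.log_le_sub_one_of_pos hx.1]
  have := h ⟨ha, ha1⟩ ⟨zero_le_one, le_rfl⟩ ha1
  simp [klFun_one] at this
  linarith

open InformationTheory in
-- For a ≤ 1 the two quadratic bounds fit exactly. For a ≥ 1 put v = (1 + a)/2: the derivative 8 log
-- v - 2 log(2v - 1) of the difference is at least 4 log v, because 2v - 1 ≤ v².
theorem klFun_le_eight_mul_midpoint {a : ℝ} (ha : 0 ≤ a) :
    klFun a ≤ 8 * klFun ((1 + a) / 2) := by
  rcases le_total a 1 with h1 | h1
  · have := sq_le_klFun (a := (1 + a) / 2) (by linarith) (by linarith)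
    have := klFun_le_sq ha
    nlinarith
  · have h : MonotoneOn (fun v => 8 * klFun v - klFun (2 * v - 1)) (Set.Ici 1) := by
      apply monotoneOn_of_deriv_nonneg (convex_Ici 1)
      · exact ((continuous_const.mul continuous_klFun).sub
          (continuous_klFun.comp (by fun_prop))).continuousOn
      · intro x hx
        rw [interior_Ici] at hx
        have hx : 1 < x := hx
        have h0 : HasDerivAt (fun v : ℝ => 2 * v - 1) 2 x := by
          simpa using ((hasDerivAt_id x).const_mul 2).sub_const 1
        have := (hasDerivAt_klFun (show 2 * x - 1 ≠ 0 by linarith)).comp x h0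
        exact (((hasDerivAt_klFun (show x ≠ 0 by linarith)).const_mul 8).sub
          this).differentiableAt.differentiableWithinAt
      · intro x hx
        rw [interior_Ici] at hx
        have hx : 1 < x := hx
        have h0 : HasDerivAt (fun v : ℝ => 2 * v - 1) 2 x := by
          simpa using ((hasDerivAt_id x).const_mul 2).sub_const 1
        have h1 := (hasDerivAt_klFun (show 2 * x - 1 ≠ 0 by linarith)).comp x h0
        have h2 := ((hasDerivAt_klFun (show x ≠ 0 by linarith)).const_mul 8).sub h1
        have h3 : deriv (fun v => 8 * klFun v - klFun (2 * v - 1)) x = _ := h2.deriv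
        rw [h3]
        have h4 : Real.log (2 * x - 1) ≤ Real.log (x ^ 2) :=
          Real.log_le_log (by linarith) (by nlinarith [sq_nonneg (x - 1)])
        rw [Real.log_pow] at h4
        have h5 := Real.log_nonneg hx.le
        push_cast at h4
        linarith
    have h2 : (1 : ℝ) ≤ (1 + a) / 2 := by linarith
    have := h (Set.self_mem_Ici) h2 h2
    simp only [klFun_one, show 2 * ((1 + a) / 2) - 1 = a by ring] at this
    norm_num [klFun_one] at this
    linarith

open InformationTheory in
-- The form of an f-divergence: bounds for `klFun` carry over term by term.
theorem klR_eq_klFun {p q : ℝ} (hq : 0 < q) (hq1 : q < 1) :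
    klR p q = q * klFun (p / q) + (1 - q) * klFun ((1 - p) / (1 - q)) := by
  have : 0 < 1 - q := by linarith
  rw [klR, klFun_apply, klFun_apply]
  field_simp
  ring

theorem klR_nonneg {p q : ℝ} (hp : 0 ≤ p) (hp1 : p ≤ 1) (hq : 0 < q) (hq1 : q < 1) :
    0 ≤ klR p q := by
  rw [klR_eq_klFun hq hq1]
  have : 0 < 1 - q := by linarith
  have h1 := InformationTheory.klFun_nonneg (div_nonneg hp hq.le)
  have h2 := InformationTheory.klFun_nonneg (div_nonneg (sub_nonneg.2 hp1) this.le)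
  positivity

theorem klR_self (p : ℝ) : klR p p = 0 := by
  unfold klR
  rcases eq_or_ne p 0 with rfl | h0
  · simp
  rcases eq_or_ne p 1 with rfl | h1
  · simp
  rw [div_self h0, div_self (sub_ne_zero.2 (Ne.symm h1))]; simp

theorem klR_le_chiSq {p q : ℝ} (hp : 0 ≤ p) (hp1 : p ≤ 1) (hq : 0 < q) (hq1 : q < 1) :
    klR p q ≤ (p - q) ^ 2 / (q * (1 - q)) := by
  rw [klR_eq_klFun hq hq1]
  have h0 : 0 < 1 - q := by linarith
  have h1 := mul_le_mul_of_nonneg_left (klFun_le_sq (div_nonneg hp hq.le)) hq.le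
  have h2 := mul_le_mul_of_nonneg_left (klFun_le_sq (div_nonneg (sub_nonneg.2 hp1) h0.le)) h0.le
  refine (add_le_add h1 h2).trans (le_of_eq ?_)
  field_simp
  ring

theorem klR_le_eight_mul_midpoint {p q : ℝ} (hp : 0 ≤ p) (hp1 : p ≤ 1) (hq : 0 < q)
    (hq1 : q < 1) : klR p q ≤ 8 * klR ((p + q) / 2) q := by
  rw [klR_eq_klFun hq hq1, klR_eq_klFun hq hq1]
  have h0 : 0 < 1 - q := by linarith
  have h1 := mul_le_mul_of_nonneg_left (klFun_le_eight_mul_midpoint (div_nonneg hp hq.le)) hq.le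
  have h2 := mul_le_mul_of_nonneg_left
    (klFun_le_eight_mul_midpoint (div_nonneg (sub_nonneg.2 hp1) h0.le)) h0.le
  have e1 : (1 + p / q) / 2 = (p + q) / 2 / q := by field_simp; ring
  have e2 : (1 + (1 - p) / (1 - q)) / 2 = (1 - (p + q) / 2) / (1 - q) := by field_simp; ring
  rw [e1] at h1; rw [e2] at h2
  linarith

/-- The failure term is dropped. Unlike Pinsker's bound this keeps the factor 1/q, so a relative gap
between p and q gives a divergence proportional to q. -/
theorem sq_div_le_klR {p q : ℝ} (hp : 0 ≤ p) (hpq : p ≤ q) (hq : 0 < q) (hq1 : q < 1) :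
    (q - p) ^ 2 / (2 * q) ≤ klR p q := by
  rw [klR_eq_klFun hq hq1]
  have h0 : 0 < 1 - q := by linarith
  have h1 := mul_le_mul_of_nonneg_left
    (sq_le_klFun (div_nonneg hp hq.le) ((div_le_one hq).2 hpq)) hq.le
  have h2 := mul_nonneg h0.le (InformationTheory.klFun_nonneg
    (div_nonneg (show 0 ≤ 1 - p by linarith) h0.le))
  have e : q * ((1 - p / q) ^ 2 / 2) = (q - p) ^ 2 / (2 * q) := by field_simp
  linarith

/-- Pinsker's inequality for Bernoulli distributions, first mean smaller. -/
theorem pinsker_of_le {p q : ℝ} (hp : 0 ≤ p) (hpq : p ≤ q) (hq1 : q < 1) :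
    2 * (q - p) ^ 2 ≤ klR p q := by
  rcases hpq.eq_or_lt with rfl | hpq
  · simp [klR_self]
  have hp1 : p < 1 := by linarith
  have hq : 0 < q := by linarith
  set g : ℝ → ℝ := fun z => -(p * Real.log z) - (1 - p) * Real.log (1 - z) - 2 * (z - p) ^ 2
  have hg : MonotoneOn g (Set.Ico p 1) := by
    have hd : ∀ x ∈ Set.Ioo p 1, HasDerivAt g
        (-(p * x⁻¹) - (1 - p) * (-1 / (1 - x)) - 2 * (2 * (x - p))) x := by
      intro x hx
      have h1 := ((Real.hasDerivAt_log (show x ≠ 0 by linarith [hx.1])).const_mul p).neg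
      have h2 := (((hasDerivAt_id x).const_sub 1).log
        (show 1 - x ≠ 0 by linarith [hx.2])).const_mul (1 - p)
      have h3 := ((((hasDerivAt_id x).sub_const p)).pow 2).const_mul 2
      have h4 : HasDerivAt g _ x := (h1.sub h2).sub h3
      refine h4.congr_deriv ?_
      norm_num
    apply monotoneOn_of_deriv_nonneg (convex_Ico p 1)
    · have h1 : ContinuousOn (fun z : ℝ => -(p * Real.log z)) (Set.Ico p 1) := by
        rcases hp.eq_or_lt with rfl | hp
        · simp; exact continuousOn_const
        · exact (continuousOn_const.mul (Real.continuousOn_log.mono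
            fun x hx => (hp.trans_le hx.1).ne')).neg
      have h2 : ContinuousOn (fun z : ℝ => (1 - p) * Real.log (1 - z)) (Set.Ico p 1) :=
        continuousOn_const.mul (ContinuousOn.log (by fun_prop)
          fun x hx => (sub_pos.2 hx.2).ne')
      exact (h1.sub h2).sub (by fun_prop)
    · intro x hx
      rw [interior_Ico] at hx
      exact (hd x hx).differentiableAt.differentiableWithinAt
    · intro x hx
      rw [interior_Ico] at hx
      rw [(hd x hx).deriv]
      have hx0 : 0 < x := by linarith [hx.1]
      have hx1 : 0 < 1 - x := by linarith [hx.2]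
      have hxp : 0 < x - p := by linarith [hx.1]
      -- The divergence has derivative (x - p)/(x(1 - x)) in its second argument, and 1/(x(1 - x)) -
      -- 4 = (1 - 2x)²/(x(1 - x)).
      have e : -(p * x⁻¹) - (1 - p) * (-1 / (1 - x)) - 2 * (2 * (x - p))
          = (x - p) * (1 - 2 * x) ^ 2 / (x * (1 - x)) := by
        field_simp; ring
      rw [e]; positivity
  have h := hg ⟨le_rfl, hp1⟩ ⟨hpq.le, hq1⟩ hpq.le
  have e : klR p q - 2 * (q - p) ^ 2 = g q - g p := by
    have h1 : p * Real.log (p / q) = p * Real.log p - p * Real.log q := by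
      rcases hp.eq_or_lt with rfl | hp
      · simp
      · rw [Real.log_div hp.ne' hq.ne']; ring
    rw [klR, h1, Real.log_div (by linarith) (by linarith)]
    simp only [g]; ring
  linarith

theorem klR_one_sub (p q : ℝ) : klR (1 - p) (1 - q) = klR p q := by
  unfold klR; simp only [sub_sub_cancel]; ring

/-- Pinsker's inequality for Bernoulli distributions, first mean larger. -/
theorem pinsker_of_ge {p q : ℝ} (hq : 0 < q) (hpq : q ≤ p) (hp1 : p ≤ 1) :
    2 * (p - q) ^ 2 ≤ klR p q := by
  have := pinsker_of_le (p := 1 - p) (q := 1 - q) (by linarith) (by linarith) (by linarith)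
  rw [klR_one_sub] at this
  linarith

theorem klR_sub_klR {μ z v : ℝ} (hμ : 0 ≤ μ) (hμ1 : μ ≤ 1) (hz : 0 < z) (hz1 : z < 1)
    (hv : 0 < v) (hv1 : v < 1) :
    klR μ v - klR μ z = μ * Real.log (z / v) + (1 - μ) * Real.log ((1 - z) / (1 - v)) := by
  have aux : ∀ a b c : ℝ, 0 ≤ a → 0 < b → 0 < c →
      a * Real.log (a / c) - a * Real.log (a / b) = a * Real.log (b / c) := by
    intro a b c ha hb hc
    rcases ha.eq_or_lt with rfl | ha
    · simp
    · rw [Real.log_div ha.ne' hc.ne', Real.log_div ha.ne' hb.ne', Real.log_div hb.ne' hc.ne']; ring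
  have h1 := aux μ z v hμ hz hv
  have h2 := aux (1 - μ) (1 - z) (1 - v) (by linarith) (by linarith) (by linarith)
  unfold klR; linarith

/-- KL(μ, v) - KL(μ, z) is affine in μ with slope log(z/v) - log((1 - z)/(1 - v)) ≤ 0, and it equals
KL(z, v) at μ = z. This reverse triangle inequality yields the monotonicity in both arguments and
the lower bounds for log-likelihood ratios. -/
theorem klR_add_klR_le {μ z v : ℝ} (hμ : 0 ≤ μ) (hμz : μ ≤ z) (hz : 0 < z) (hzv : z ≤ v)
    (hv1 : v < 1) : klR μ z + klR z v ≤ klR μ v := by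
  have h1 := klR_sub_klR hμ (by linarith) hz (by linarith) (by linarith) hv1
  have l1 : Real.log (z / v) ≤ 0 := Real.log_nonpos (div_nonneg hz.le (hz.le.trans hzv)) ((div_le_one (by linarith)).2 hzv)
  have l2 : 0 ≤ Real.log ((1 - z) / (1 - v)) :=
    Real.log_nonneg ((one_le_div (by linarith)).2 (by linarith))
  have : klR z v = z * Real.log (z / v) + (1 - z) * Real.log ((1 - z) / (1 - v)) := rfl
  nlinarith

theorem klR_antitone_left {μ z v : ℝ} (hμ : 0 ≤ μ) (hμz : μ ≤ z) (hzv : z ≤ v)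
    (hv1 : v < 1) : klR z v ≤ klR μ v := by
  rcases (hμ.trans hμz).eq_or_lt with h | hz
  · rw [← h, show μ = 0 by linarith]
  · linarith [klR_add_klR_le hμ hμz hz hzv hv1, klR_nonneg hμ (by linarith) hz (by linarith)]

theorem klR_strictAnti_left {μ z v : ℝ} (hμ : 0 ≤ μ) (hμz : μ < z) (hzv : z ≤ v)
    (hv1 : v < 1) : klR z v < klR μ v := by
  have h1 := klR_add_klR_le hμ hμz.le (hμ.trans_lt hμz) hzv hv1
  have h2 := pinsker_of_le hμ hμz.le (by linarith)
  have : 0 < (z - μ) ^ 2 := by have := sub_pos.2 hμz; positivity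
  linarith

theorem klR_mono_right {μ z v : ℝ} (hμ : 0 ≤ μ) (hμz : μ ≤ z) (hz : 0 < z) (hzv : z ≤ v)
    (hv1 : v < 1) : klR μ z ≤ klR μ v := by
  linarith [klR_add_klR_le hμ hμz hz hzv hv1, klR_nonneg hz.le (by linarith) (by linarith) hv1]

theorem klR_zero_left_le {v : ℝ} (hv1 : v < 1) : klR 0 v ≤ v / (1 - v) := by
  have h : 0 < 1 - v := by linarith
  have := Real.log_le_sub_one_of_pos (show 0 < 1 / (1 - v) by positivity)
  have e : 1 / (1 - v) - 1 = v / (1 - v) := by field_simp; ring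
  simp only [klR, sub_zero]
  linarith

theorem continuousOn_klR :
    ContinuousOn (fun z : ℝ × ℝ => klR z.1 z.2) (Set.univ ×ˢ Set.Ioo 0 1) := by
  have hc : Continuous fun x : ℝ => x * Real.log x := Real.continuous_mul_log
  have : ContinuousOn (fun z : ℝ × ℝ => (z.1 * Real.log z.1 + (1 - z.1) * Real.log (1 - z.1))
      - z.1 * Real.log z.2 - (1 - z.1) * Real.log (1 - z.2)) (Set.univ ×ˢ Set.Ioo 0 1) := by
    refine ((Continuous.continuousOn ?_).sub ?_).sub ?_
    · exact (hc.comp continuous_fst).add (hc.comp (continuous_const.sub continuous_fst))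
    · exact continuousOn_fst.mul (ContinuousOn.log continuousOn_snd fun z hz => hz.2.1.ne')
    · exact (continuousOn_const.sub continuousOn_fst).mul
        (ContinuousOn.log (continuousOn_const.sub continuousOn_snd)
          fun z hz => (sub_pos.2 hz.2.2).ne')
  refine this.congr fun z hz => ?_
  have aux : ∀ a b : ℝ, 0 < b → a * Real.log (a / b) = a * Real.log a - a * Real.log b := by
    intro a b hb
    rcases eq_or_ne a 0 with rfl | ha
    · simp
    · rw [Real.log_div ha hb.ne']; ring
  simp only [klR]
  rw [aux _ _ hz.2.1, aux _ _ (sub_pos.2 hz.2.2)]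
  ring

theorem exists_klR_eq {v y : ℝ} (hv : 0 < v) (hv1 : v < 1) (hy : 0 < y) (hy1 : y < klR 0 v) :
    ∃ z, 0 < z ∧ z < v ∧ klR z v = y := by
  have hc : ContinuousOn (fun z => klR z v) (Set.Icc 0 v) :=
    continuousOn_klR.comp (f := fun z : ℝ => (z, v)) (by fun_prop)
      fun z _ => ⟨Set.mem_univ _, hv, hv1⟩
  have := intermediate_value_Icc' hv.le hc (show y ∈ Set.Icc (klR v v) (klR 0 v) by
    rw [klR_self]; exact ⟨hy.le, hy1.le⟩)
  obtain ⟨z, hz, hzy⟩ := this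
  refine ⟨z, lt_of_le_of_ne hz.1 ?_, lt_of_le_of_ne hz.2 ?_, hzy⟩
  · rintro rfl; exact hy1.ne hzy.symm
  · rintro rfl; simp [klR_self] at hzy; linarith

theorem bernKL_eq_klR {p q : ℝ} (hq : 0 < q) (hq1 : q < 1) : bernKL p q = (klR p q : ℝ) := by
  unfold bernKL
  split_ifs with h1 h2
  · subst h1; simp [klR_self]
  · rfl
  · exact absurd ⟨hq, hq1⟩ h2


/-! ### Counts and successes in a window -/

section Counts

variable {Ω : Type*} {K : ℕ}

/-- Number of selections of rate `k` in the slots `a, …, n - 1`. -/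
def selCount (sel : ℕ → Ω → Fin K) (k : Fin K) (a n : ℕ) (ω : Ω) : ℕ :=
  ∑ t ∈ Ico a n, if sel t ω = k then 1 else 0

/-- Number of successes at rate `k` in the slots `a, …, n - 1`. -/
def succCount (X : ℕ → Ω → Fin K → Bool) (sel : ℕ → Ω → Fin K) (k : Fin K) (a n : ℕ)
    (ω : Ω) : ℕ :=
  ∑ t ∈ Ico a n, if sel t ω = k ∧ X t ω k = true then 1 else 0

/-- First slot of the window of length `τ` before slot `n`. -/
abbrev winStart (τ n : ℕ) : ℕ := max 1 (n - τ)

theorem windowCount_eq (sel : ℕ → Ω → Fin K) (τ n : ℕ) (k : Fin K) (ω : Ω) :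
    windowCount sel τ n k ω = selCount sel k (winStart τ n) n ω := rfl

theorem windowMean_eq (r : Fin K → ℝ) (X : ℕ → Ω → Fin K → Bool) (sel : ℕ → Ω → Fin K)
    (τ n : ℕ) (k : Fin K) (ω : Ω) (hr : 0 < r k) :
    windowMean r X sel τ n k ω / r k = (succCount X sel k (winStart τ n) n ω : ℝ) /
      (selCount sel k (winStart τ n) n ω : ℝ) := by
  unfold windowMean succCount
  rw [windowCount_eq]
  have : (∑ t ∈ Ico (winStart τ n) n, if sel t ω = k ∧ X t ω k = true then r k else 0)
      = r k * ((∑ t ∈ Ico (winStart τ n) n, if sel t ω = k ∧ X t ω k = true then 1 else 0 : ℕ) : ℝ)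
      := by
    push_cast
    rw [mul_sum]
    exact sum_congr rfl fun t _ => by split_ifs <;> simp
  rw [this]
  field_simp

theorem succCount_le (X : ℕ → Ω → Fin K → Bool) (sel : ℕ → Ω → Fin K) (k : Fin K) (a n : ℕ)
    (ω : Ω) : succCount X sel k a n ω ≤ selCount sel k a n ω := by
  apply sum_le_sum
  intro t _
  split_ifs <;> simp_all

theorem selCount_le (sel : ℕ → Ω → Fin K) (k : Fin K) (a n : ℕ) (ω : Ω) :
    selCount sel k a n ω ≤ n - a := by
  unfold selCount
  calc _ ≤ ∑ t ∈ Ico a n, 1 := sum_le_sum fun t _ => by split_ifs <;> simp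
    _ = n - a := by simp

theorem windowCount_le (sel : ℕ → Ω → Fin K) (k : Fin K) (τ n : ℕ) (ω : Ω) :
    selCount sel k (winStart τ n) n ω ≤ τ :=
  (selCount_le _ _ _ _ _).trans (by simp [winStart]; omega)

theorem sum_ite_sel_eq (X : ℕ → Ω → Fin K → Bool) (sel : ℕ → Ω → Fin K) (k : Fin K) (a n : ℕ)
    (ω : Ω) (α β : ℝ) :
    (∑ t ∈ Ico a n, if sel t ω = k then (if X t ω k = true then α else β) else 0)
      = succCount X sel k a n ω * α + (selCount sel k a n ω - succCount X sel k a n ω) * β := by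
  unfold succCount selCount
  push_cast
  rw [← sum_sub_distrib, sum_mul, sum_mul, ← sum_add_distrib]
  exact sum_congr rfl fun t _ => by by_cases h1 : sel t ω = k <;> by_cases h2 : X t ω k = true <;>
    simp [h1, h2]

theorem IsBernoulliModel.measurableSet_sel [mΩ : MeasurableSpace Ω] {μ : Measure Ω}
    {ℱ : Filtration ℕ mΩ} {θ : ℕ → Fin K → ℝ} {X : ℕ → Ω → Fin K → Bool} {sel : ℕ → Ω → Fin K}
    (hM : IsBernoulliModel μ ℱ θ X sel) (k : Fin K)
    (t : ℕ) (ht : 1 ≤ t) : MeasurableSet[ℱ (t - 1)] {ω | sel t ω = k} :=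
  hM.nonanticipating t ht (measurableSet_singleton k)

end Counts

/-- The log-likelihood ratio of z against v for S successes in N trials. Through it, a large
empirical divergence becomes a large value of an exponential supermartingale. -/
theorem logLik_eq {S N : ℕ} (hSN : S ≤ N) (hN : 0 < N) {v z : ℝ} (hv : 0 < v) (hv1 : v < 1)
    (hz : 0 < z) (hz1 : z < 1) :
    (S : ℝ) * Real.log (z / v) + ((N : ℝ) - S) * Real.log ((1 - z) / (1 - v))
      = N * (klR (S / N) v - klR (S / N) z) := by
  have hN' : (0 : ℝ) < N := by exact_mod_cast hN
  have hSN' : (S : ℝ) ≤ N := by exact_mod_cast hSN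
  rw [klR_sub_klR (by positivity) ((div_le_one hN').2 hSN') hz hz1 hv hv1]
  field_simp

/-! ### Exponential supermartingales for predictable sampling -/

section Supermartingale

variable {Ω : Type*} [mΩ : MeasurableSpace Ω] {μ : Measure Ω} [IsProbabilityMeasure μ] {K : ℕ}
  {ℱ : Filtration ℕ mΩ} {θ : ℕ → Fin K → ℝ} {X : ℕ → Ω → Fin K → Bool} {sel : ℕ → Ω → Fin K}

theorem IsBernoulliModel.lintegral_comp (hM : IsBernoulliModel μ ℱ θ X sel)
    {t : ℕ} (ht : 1 ≤ t) (k : Fin K) (hθ : θ t k ∈ Set.Icc (0 : ℝ) 1) (f : Bool → ENNReal) :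
    ∫⁻ ω, f (X t ω k) ∂μ
      = ENNReal.ofReal (θ t k) * f true + ENNReal.ofReal (1 - θ t k) * f false := by
  have hm : Measurable (fun ω => X t ω k) :=
    (measurable_pi_apply k).comp ((hM.adapted t ht).mono (ℱ.le t) le_rfl)
  have hs : MeasurableSet {ω | X t ω k = true} := hm (measurableSet_singleton true)
  have e : ∀ ω, f (X t ω k) = {ω | X t ω k = true}.indicator (fun _ => f true) ω
      + {ω | X t ω k = true}ᶜ.indicator (fun _ => f false) ω := by
    intro ω
    by_cases h : X t ω k = true
    · simp [h]
    · have h' : X t ω k = false := by simpa using h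
      simp [h']
  rw [lintegral_congr e, lintegral_add_left (measurable_const.indicator hs),
    lintegral_indicator_const hs, lintegral_indicator_const hs.compl,
    prob_compl_eq_one_sub hs, hM.law t ht k, mul_comm, mul_comm (f false)]
  congr 2
  rw [← ENNReal.ofReal_one, ← ENNReal.ofReal_sub _ hθ.1]

/-- Induction on v: the new factor is 1 off `b v`, and on `b v`, which belongs to the past, it is
independent of the past with mean at most 1. The event `W` allows the process to start only on a
given selection; values in `ENNReal` avoid integrability questions. -/
theorem IsBernoulliModel.lintegral_indicator_mul_prod_le (hM : IsBernoulliModel μ ℱ θ X sel)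
    (hθ : ∀ n k, 1 ≤ n → θ n k ∈ Set.Icc (0 : ℝ) 1) (k : Fin K) {b : ℕ → Set Ω}
    (hb : ∀ t, 1 ≤ t → MeasurableSet[ℱ (t - 1)] (b t)) (f : ℕ → Bool → ENNReal) {W : Set Ω}
    {u : ℕ} (hu : 1 ≤ u) (hW : MeasurableSet[ℱ (u - 1)] W) {v : ℕ} (huv : u ≤ v)
    (hf : ∀ t ∈ Ico u v,
      ENNReal.ofReal (θ t k) * f t true + ENNReal.ofReal (1 - θ t k) * f t false ≤ 1) :
    Measurable[ℱ (v - 1)] (fun ω => W.indicator (fun _ => (1 : ENNReal)) ω *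
        ∏ t ∈ Ico u v, ((b t).indicator (fun ω => f t (X t ω k)) ω
          + (b t)ᶜ.indicator (fun _ => 1) ω)) ∧
    ∫⁻ ω, W.indicator (fun _ => (1 : ENNReal)) ω *
        ∏ t ∈ Ico u v, ((b t).indicator (fun ω => f t (X t ω k)) ω
          + (b t)ᶜ.indicator (fun _ => 1) ω) ∂μ ≤ μ W := by
  induction v, huv using Nat.le_induction with
  | base =>
    simp only [Ico_self, prod_empty, mul_one]
    refine ⟨measurable_const.indicator hW, ?_⟩
    rw [lintegral_indicator_const (ℱ.le _ _ hW), one_mul]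
  | succ v huv ih =>
    obtain ⟨ihm, ihle⟩ := ih fun t ht => hf t (by simp at ht ⊢; omega)
    have hv : 1 ≤ v := hu.trans huv
    set H : Ω → ENNReal := fun ω => W.indicator (fun _ => (1 : ENNReal)) ω *
        ∏ t ∈ Ico u v, ((b t).indicator (fun ω => f t (X t ω k)) ω
          + (b t)ᶜ.indicator (fun _ => 1) ω) with hH
    have hg : Measurable (fun x : Fin K → Bool => f v (x k)) :=
      (measurable_of_countable (f v)).comp (measurable_pi_apply k)
    have hfX : Measurable[ℱ v] (fun ω => f v (X v ω k)) := hg.comp (hM.adapted v hv)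
    have hfX' : Measurable[MeasurableSpace.comap (X v) inferInstance]
        (fun ω => f v (X v ω k)) := hg.comp (comap_measurable (X v))
    have hmono : ℱ (v - 1) ≤ ℱ v := ℱ.mono (Nat.sub_le _ _)
    have hbv := hb v hv
    have hbv' := hmono _ hbv
    have e : (fun ω => W.indicator (fun _ => (1 : ENNReal)) ω *
        ∏ t ∈ Ico u (v + 1), ((b t).indicator (fun ω => f t (X t ω k)) ω
          + (b t)ᶜ.indicator (fun _ => 1) ω)) = fun ω =>
        ((b v).indicator H ω) * f v (X v ω k) + (b v)ᶜ.indicator H ω := by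
      ext ω
      rw [prod_Ico_succ_top huv, ← mul_assoc]
      by_cases hω : ω ∈ b v
      · simp [hω, hH]
      · simp [hω, hH]
    have hHb : Measurable[ℱ (v - 1)] ((b v).indicator H) := ihm.indicator hbv
    have hHbc : Measurable[ℱ (v - 1)] ((b v)ᶜ.indicator H) := ihm.indicator hbv.compl
    rw [e]
    constructor
    · change Measurable[ℱ v] _
      exact ((hHb.mono hmono le_rfl).mul hfX).add (hHbc.mono hmono le_rfl)
    · rw [lintegral_add_right _ (hHbc.mono (ℱ.le _) le_rfl)]
      rw [lintegral_mul_eq_lintegral_mul_lintegral_of_independent_measurableSpace (ℱ.le (v - 1))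
        (((hM.adapted v hv).mono (ℱ.le v) le_rfl).comap_le) (hM.indep v hv).symm hHb hfX']
      rw [hM.lintegral_comp hv k (hθ v k hv)]
      calc _ ≤ (∫⁻ ω, (b v).indicator H ω ∂μ) * 1 + ∫⁻ ω, (b v)ᶜ.indicator H ω ∂μ := by
            gcongr
            exact hf v (by simp; omega)
        _ = ∫⁻ ω, H ω ∂μ := by
            rw [mul_one, lintegral_indicator (ℱ.le _ _ hbv),
              lintegral_indicator (ℱ.le _ _ hbv).compl, lintegral_add_compl _ (ℱ.le _ _ hbv)]
        _ ≤ μ W := ihle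

open Classical in
/-- Exponential deviation inequality for the outcomes of rate `k` at predictable times. -/
theorem IsBernoulliModel.measureReal_le_exp_neg (hM : IsBernoulliModel μ ℱ θ X sel)
    (hθ : ∀ n k, 1 ≤ n → θ n k ∈ Set.Icc (0 : ℝ) 1) (k : Fin K) {b : ℕ → Set Ω}
    (hb : ∀ t, 1 ≤ t → MeasurableSet[ℱ (t - 1)] (b t)) (α β : ℕ → ℝ) {W : Set Ω}
    {u : ℕ} (hu : 1 ≤ u) (hW : MeasurableSet[ℱ (u - 1)] W) {v : ℕ} (huv : u ≤ v)
    (hαβ : ∀ t ∈ Ico u v,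
      θ t k * Real.exp (α t) + (1 - θ t k) * Real.exp (β t) ≤ 1) {κ : ℝ} {E : Set Ω}
    (hE : ∀ ω ∈ E, ω ∈ W ∧ κ ≤ ∑ t ∈ Ico u v,
      if ω ∈ b t then (if X t ω k = true then α t else β t) else 0) :
    μ.real E ≤ Real.exp (-κ) * μ.real W := by
  set f : ℕ → Bool → ENNReal := fun t x => ENNReal.ofReal (Real.exp (if x then α t else β t))
  obtain ⟨hm, hle⟩ := hM.lintegral_indicator_mul_prod_le hθ k hb f hu hW huv (by
    intro t ht
    have h01 := hθ t k (hu.trans (mem_Ico.1 ht).1)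
    simp only [f]
    rw [← ENNReal.ofReal_mul h01.1, ← ENNReal.ofReal_mul (by linarith [h01.2]),
      ← ENNReal.ofReal_add (by have := h01.1; positivity)
        (mul_nonneg (by linarith [h01.2]) (Real.exp_nonneg _)), ← ENNReal.ofReal_one]
    exact ENNReal.ofReal_le_ofReal (by simpa using hαβ t ht))
  have h1 := mul_meas_ge_le_lintegral (μ := μ) (hm.mono (ℱ.le _) le_rfl)
    (ENNReal.ofReal (Real.exp κ))
  have h2 : ENNReal.ofReal (Real.exp κ) * μ E ≤ μ W := by
    refine le_trans ?_ (h1.trans hle)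
    gcongr
    intro ω hω
    obtain ⟨hWω, hκ⟩ := hE ω hω
    simp only [Set.mem_ofPred_eq, Set.indicator_of_mem hWω, one_mul]
    have e : ∀ t ∈ Ico u v, ((b t).indicator (fun ω => f t (X t ω k)) ω
          + (b t)ᶜ.indicator (fun _ => 1) ω) = ENNReal.ofReal (Real.exp
            (if ω ∈ b t then (if X t ω k = true then α t else β t) else 0)) := by
      intro t _
      by_cases hω : ω ∈ b t <;> simp [hω, f]
    rw [prod_congr rfl e, ← ENNReal.ofReal_prod_of_nonneg fun _ _ => Real.exp_nonneg _,
      ← Real.exp_sum]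
    exact ENNReal.ofReal_le_ofReal (Real.exp_le_exp.2 hκ)
  have h3 := ENNReal.toReal_mono (measure_ne_top μ W) h2
  rw [ENNReal.toReal_mul, ENNReal.toReal_ofReal (Real.exp_nonneg _)] at h3
  have h4 : Real.exp (-κ) * (Real.exp κ * (μ E).toReal) ≤ Real.exp (-κ) * (μ W).toReal :=
    mul_le_mul_of_nonneg_left h3 (Real.exp_nonneg _)
  rw [← mul_assoc, ← Real.exp_add, neg_add_cancel, Real.exp_zero, one_mul] at h4
  exact h4

/-- Likelihood-ratio deviation bound for the sample of rate `k` in a time interval. -/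
theorem IsBernoulliModel.measureReal_logLik_le (hM : IsBernoulliModel μ ℱ θ X sel)
    (hθ : ∀ n k, 1 ≤ n → θ n k ∈ Set.Icc (0 : ℝ) 1) (k : Fin K) {a n : ℕ} (ha : 1 ≤ a)
    {v z : ℝ} (hv : 0 < v) (hv1 : v < 1) (hz : 0 < z) (hz1 : z < 1)
    (hmean : ∀ t ∈ Ico a n, (θ t k - v) * (z - v) ≤ 0) {κ : ℝ} {E : Set Ω}
    (hE : ∀ ω ∈ E, κ ≤ succCount X sel k a n ω * Real.log (z / v) +
      (selCount sel k a n ω - succCount X sel k a n ω) * Real.log ((1 - z) / (1 - v))) :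
    μ.real E ≤ Real.exp (-κ) := by
  have hv1' : 0 < 1 - v := by linarith
  have hz1' : 0 < 1 - z := by linarith
  rcases le_or_gt a n with han | han
  · have := hM.measureReal_le_exp_neg hθ k (b := fun t => {ω | sel t ω = k})
      (fun t ht => hM.measurableSet_sel k t ht) (fun _ => Real.log (z / v))
      (fun _ => Real.log ((1 - z) / (1 - v))) ha MeasurableSet.univ han (κ := κ) (E := E) (by
        intro t ht
        rw [Real.exp_log (by positivity), Real.exp_log (by positivity)]
        -- The sign condition puts z and the varying true means on opposite sides of v, so the
        -- likelihood ratio has mean at most 1 in every slot.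
        have e : θ t k * (z / v) + (1 - θ t k) * ((1 - z) / (1 - v))
          = 1 + (θ t k - v) * (z - v) / (v * (1 - v)) := by field_simp; ring
        rw [e]
        have := div_nonpos_of_nonpos_of_nonneg (hmean t ht) (mul_pos hv hv1').le
        linarith) (by
        intro ω hω
        refine ⟨trivial, (hE ω hω).trans (le_of_eq ?_)⟩
        rw [← sum_ite_sel_eq]
        exact sum_congr rfl fun t _ => by simp [Set.mem_ofPred_eq])
    simpa using this
  · rcases le_or_gt κ 0 with h | h
    · exact (measureReal_le_one).trans (Real.one_le_exp (by linarith))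
    · have : E = ∅ := by
        by_contra hne
        obtain ⟨ω, hω⟩ := Set.nonempty_iff_ne_empty.2 hne
        have := hE ω hω
        simp [succCount, selCount, Ico_eq_empty_of_le han.le] at this
        linarith
      rw [this]; simp; positivity

end Supermartingale


/-! ### The index -/

section Index

variable {Ω : Type*} {K : ℕ} {r : Fin K → ℝ} {c : ℝ} {τ : ℕ} {X : ℕ → Ω → Fin K → Bool}
  {sel : ℕ → Ω → Fin K} {n : ℕ} {k : Fin K} {ω : Ω}

theorem klIndex_le (hr : 0 < r k) : klIndex r c τ X sel n k ω ≤ r k := by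
  apply Real.sSup_le
  · rintro q ⟨hq, -⟩; exact hq.2
  · exact hr.le

theorem le_klIndex {q : ℝ} (hq : q ∈ Set.Icc 0 (r k))
    (h : ((windowCount sel τ n k ω : ℝ) : EReal) *
        bernKL (windowMean r X sel τ n k ω / r k) (q / r k)
      ≤ ((explorationLevel c τ : ℝ) : EReal)) : q ≤ klIndex r c τ X sel n k ω :=
  le_csSup ⟨r k, by rintro q ⟨hq, -⟩; exact hq.2⟩ ⟨hq, h⟩

/-- Some admissible q/r_k exceeds x, and the divergence from a mean below x increases there. The
endpoint q = r_k is not admissible: the empirical mean is below 1, so its divergence is infinite. -/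
theorem kl_le_of_lt_klIndex (hr : 0 < r k) {x : ℝ} (hx : 0 < x)
    (hidx : r k * x < klIndex r c τ X sel n k ω)
    (hN : 0 < selCount sel k (winStart τ n) n ω)
    (hS : (succCount X sel k (winStart τ n) n ω : ℝ) / selCount sel k (winStart τ n) n ω < x) :
    (selCount sel k (winStart τ n) n ω : ℝ) * klR ((succCount X sel k (winStart τ n) n ω : ℝ) /
      selCount sel k (winStart τ n) n ω) x ≤ explorationLevel c τ := by
  have hne : {q : ℝ | q ∈ Set.Icc 0 (r k) ∧
    ((windowCount sel τ n k ω : ℝ) : EReal) *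
        bernKL (windowMean r X sel τ n k ω / r k) (q / r k)
      ≤ ((explorationLevel c τ : ℝ) : EReal)}.Nonempty := by
    by_contra hne
    rw [Set.not_nonempty_iff_eq_empty] at hne
    rw [klIndex, hne, Real.sSup_empty] at hidx
    exact absurd hidx (not_lt.2 (by positivity))
  obtain ⟨q, ⟨hq, hqL⟩, hlt⟩ := exists_lt_of_lt_csSup hne hidx
  rw [windowMean_eq r X sel τ n k ω hr, windowCount_eq] at hqL
  set N := selCount sel k (winStart τ n) n ω
  set S := succCount X sel k (winStart τ n) n ω
  have hN' : (0 : ℝ) < N := by exact_mod_cast hN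
  have hxz : x < q / r k := by rw [lt_div_iff₀ hr]; linarith
  have hz1 : q / r k ≤ 1 := (div_le_one hr).2 hq.2
  rcases hz1.eq_or_lt with h1 | h1
  · rw [h1, bernKL, if_neg (by linarith), if_neg (by simp), EReal.coe_mul_top_of_pos hN'] at hqL
    simp at hqL
  · rw [bernKL_eq_klR (by linarith) h1, ← EReal.coe_mul, EReal.coe_le_coe_iff] at hqL
    refine le_trans ?_ hqL
    gcongr
    exact klR_mono_right (by positivity) hS.le hx hxz.le h1

/-- Every u above v is inadmissible, so its divergence exceeds the level; let u decrease to v. The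
empirical mean is itself admissible, whence it is at most v. -/
theorem le_kl_of_klIndex_le (hr : 0 < r k) (hL : 0 ≤ explorationLevel c τ) {v : ℝ} (hv : 0 < v)
    (hv1 : v < 1) (hidx : klIndex r c τ X sel n k ω ≤ r k * v) :
    0 < selCount sel k (winStart τ n) n ω ∧
    (succCount X sel k (winStart τ n) n ω : ℝ) ≤ selCount sel k (winStart τ n) n ω * v ∧
    explorationLevel c τ ≤ (selCount sel k (winStart τ n) n ω : ℝ) *
      klR ((succCount X sel k (winStart τ n) n ω : ℝ) / selCount sel k (winStart τ n) n ω) v := by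
  have key : ∀ q ∈ Set.Icc 0 (r k),
      ((selCount sel k (winStart τ n) n ω : ℝ) : EReal) *
        bernKL ((succCount X sel k (winStart τ n) n ω : ℝ) / selCount sel k (winStart τ n) n ω)
        (q / r k) ≤ ((explorationLevel c τ : ℝ) : EReal) → q ≤ r k * v := by
    intro q hq h
    refine (le_klIndex hq ?_).trans hidx
    rwa [windowMean_eq r X sel τ n k ω hr, windowCount_eq]
  have hSN := succCount_le X sel k (winStart τ n) n ω
  set N := selCount sel k (winStart τ n) n ω
  set S := succCount X sel k (winStart τ n) n ω
  have hSN' : (S : ℝ) ≤ N := by exact_mod_cast hSN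
  have hL' : (0 : EReal) ≤ ((explorationLevel c τ : ℝ) : EReal) := by exact_mod_cast hL
  have hN : 0 < N := by
    by_contra h0
    have h0 : N = 0 := by omega
    -- Without samples, `0 * ⊤ = 0` in `EReal` makes q = r_k admissible, which v < 1 forbids.
    have := key (r k) ⟨hr.le, le_rfl⟩ (by rw [h0]; simpa using hL')
    nlinarith
  have hN' : (0 : ℝ) < N := by exact_mod_cast hN
  have hμ1 : (S : ℝ) / N ≤ 1 := (div_le_one hN').2 hSN'
  have hμv : (S : ℝ) / N ≤ v := by
    have := key (r k * ((S : ℝ) / N)) ⟨by positivity, by nlinarith⟩ (by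
      rw [mul_div_cancel_left₀ _ hr.ne', bernKL, if_pos rfl, mul_zero]; exact hL')
    exact le_of_mul_le_mul_left this hr
  refine ⟨hN, ?_, ?_⟩
  · rw [div_le_iff₀ hN'] at hμv; linarith
  · have hc : ContinuousAt (fun u => (N : ℝ) * klR ((S : ℝ) / N) u) v := by
      have h1 : ContinuousAt (fun z : ℝ × ℝ => klR z.1 z.2) ((S : ℝ) / N, v) :=
        continuousOn_klR.continuousAt (prod_mem_nhds Filter.univ_mem (Ioo_mem_nhds hv hv1))
      exact continuousAt_const.mul
        (ContinuousAt.comp (f := fun u : ℝ => ((S : ℝ) / N, u)) h1 (by fun_prop))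
    refine ge_of_tendsto (hc.tendsto.mono_left (nhdsWithin_le_nhds (s := Set.Ioi v))) ?_
    filter_upwards [Ioo_mem_nhdsGT hv1] with u hu
    by_contra hlt
    push Not at hlt
    have := key (r k * u) ⟨by have := hv.trans hu.1; positivity, by nlinarith [hu.2]⟩ (by
      rw [mul_div_cancel_left₀ _ hr.ne', bernKL_eq_klR (hv.trans hu.1) hu.2, ← EReal.coe_mul,
        EReal.coe_le_coe_iff]
      exact hlt.le)
    have := le_of_mul_le_mul_left this hr
    linarith [hu.1]

end Index

/-! ### Deviations of the index below its target -/

section Underestimation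

variable {Ω : Type*} [mΩ : MeasurableSpace Ω] {μ : Measure Ω} [IsProbabilityMeasure μ] {K : ℕ}
  {ℱ : Filtration ℕ mΩ} {θ : ℕ → Fin K → ℝ} {X : ℕ → Ω → Fin K → Bool} {sel : ℕ → Ω → Fin K}

/-- One likelihood ratio serves a whole slice of sample sizes. Let hi be the largest size and KL(z,
v) = (L - 1)/hi. The event forces the empirical mean below z, so the log-likelihood ratio of z
against v is at least t₀ KL(z, v) = L(L - 1)/(L + 1) ≥ L - 2. -/
theorem IsBernoulliModel.measureReal_peel_le (hM : IsBernoulliModel μ ℱ θ X sel)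
    (hθ : ∀ n k, 1 ≤ n → θ n k ∈ Set.Icc (0 : ℝ) 1) (k : Fin K) {a n : ℕ} (ha : 1 ≤ a)
    {v : ℝ} (hv : 0 < v) (hv1 : v < 1) (hmean : ∀ t ∈ Ico a n, v ≤ θ t k)
    {L t₀ : ℝ} (hL : 1 < L) (ht₀ : 0 < t₀) :
    μ.real {ω | t₀ ≤ selCount sel k a n ω ∧ (selCount sel k a n ω : ℝ) ≤ t₀ * (1 + 1 / L) ∧
      (succCount X sel k a n ω : ℝ) ≤ selCount sel k a n ω * v ∧
      L ≤ selCount sel k a n ω * klR (succCount X sel k a n ω / selCount sel k a n ω) v}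
      ≤ Real.exp (2 - L) := by
  have hL0 : 0 < L := by linarith
  set hi := t₀ * (1 + 1 / L) with hhi
  have hhi0 : 0 < hi := by positivity
  by_cases hcase : L / hi ≤ klR 0 v
  -- Taking L - 1 instead of L stays strictly below KL(0, v), so that z > 0. When L/hi > KL(0, v)
  -- the event is empty.
  · obtain ⟨z, hz, hzv, hzy⟩ := exists_klR_eq hv hv1 (y := (L - 1) / hi)
      (div_pos (by linarith) hhi0) (lt_of_lt_of_le (by gcongr; linarith) hcase)
    have hz1 : z < 1 := hzv.trans hv1
    have := hM.measureReal_logLik_le hθ k ha hv hv1 hz hz1 (n := n)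
      (fun t ht => mul_nonpos_of_nonneg_of_nonpos (sub_nonneg.2 (hmean t ht)) (by linarith))
      (κ := L - 2) (E := {ω | t₀ ≤ selCount sel k a n ω ∧ (selCount sel k a n ω : ℝ) ≤ hi ∧
      (succCount X sel k a n ω : ℝ) ≤ selCount sel k a n ω * v ∧
      L ≤ selCount sel k a n ω * klR (succCount X sel k a n ω / selCount sel k a n ω) v}) (by
      rintro ω ⟨h1, h2, h3, h4⟩
      have hSN := succCount_le X sel k a n ω
      set N := selCount sel k a n ω
      set S := succCount X sel k a n ω
      have hN' : (0 : ℝ) < N := by linarith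
      have hN : 0 < N := by exact_mod_cast hN'
      rw [logLik_eq hSN hN hv hv1 hz hz1]
      have hμ0 : (0 : ℝ) ≤ S / N := by positivity
      have hμv : (S : ℝ) / N ≤ v := by rw [div_le_iff₀ hN']; linarith
      have hμz : (S : ℝ) / N ≤ z := by
        by_contra hlt
        push Not at hlt
        have h5 := klR_antitone_left hz.le hlt.le hμv hv1
        rw [hzy] at h5
        have h6 : N * klR (S / N) v ≤ hi * ((L - 1) / hi) := by
          have : 0 ≤ (L - 1) / hi := div_nonneg (by linarith) hhi0.le
          exact (mul_le_mul_of_nonneg_left h5 hN'.le).trans (mul_le_mul_of_nonneg_right h2 this)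
        rw [mul_div_cancel₀ _ hhi0.ne'] at h6
        linarith
      have h5 := klR_add_klR_le hμ0 hμz hz hzv.le hv1
      have h6 : t₀ * ((L - 1) / hi) ≤ N * (klR (S / N) v - klR (S / N) z) := by
        have : 0 ≤ (L - 1) / hi := div_nonneg (by linarith) hhi0.le
        exact (mul_le_mul_of_nonneg_right h1 this).trans
          (mul_le_mul_of_nonneg_left (by linarith) hN'.le)
      have h7 : t₀ * ((L - 1) / hi) = (L - 1) * L / (L + 1) := by
        rw [hhi]; field_simp
      have h8 : L - 2 ≤ (L - 1) * L / (L + 1) := by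
        rw [le_div_iff₀ (by linarith)]; nlinarith
      linarith)
    rwa [show -(L - 2) = 2 - L by ring] at this
  · have hempty : {ω | t₀ ≤ selCount sel k a n ω ∧ (selCount sel k a n ω : ℝ) ≤ hi ∧
      (succCount X sel k a n ω : ℝ) ≤ selCount sel k a n ω * v ∧
      L ≤ selCount sel k a n ω * klR (succCount X sel k a n ω / selCount sel k a n ω) v} = ∅ := by
      rw [Set.eq_empty_iff_forall_notMem]
      rintro ω ⟨h1, h2, h3, h4⟩
      set N := selCount sel k a n ω
      set S := succCount X sel k a n ω
      have hN' : (0 : ℝ) < N := by linarith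
      push Not at hcase
      have hμv : (S : ℝ) / N ≤ v := by rw [div_le_iff₀ hN']; linarith
      have h5 := klR_antitone_left le_rfl (show (0 : ℝ) ≤ S / N by positivity) hμv hv1
      have h6 : N * klR (S / N) v < N * (L / hi) := by gcongr; linarith
      have h7 : (N : ℝ) * (L / hi) ≤ hi * (L / hi) := by gcongr
      rw [mul_div_cancel₀ _ hhi0.ne'] at h7
      linarith
    rw [hempty]; simp; positivity

/-- Slices of ratio 1 + 1/L: as log(1 + 1/L) ≥ 1/(L + 1), at most (L + 1) log R + 1 of them are
needed. -/
theorem IsBernoulliModel.measureReal_peel_range_le (hM : IsBernoulliModel μ ℱ θ X sel)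
    (hθ : ∀ n k, 1 ≤ n → θ n k ∈ Set.Icc (0 : ℝ) 1) (k : Fin K) {a n : ℕ} (ha : 1 ≤ a)
    {v : ℝ} (hv : 0 < v) (hv1 : v < 1) (hmean : ∀ t ∈ Ico a n, v ≤ θ t k)
    {L t₀ R : ℝ} (hL : 1 < L) (ht₀ : 0 < t₀) (hR : 1 ≤ R) :
    μ.real {ω | t₀ ≤ selCount sel k a n ω ∧ (selCount sel k a n ω : ℝ) ≤ t₀ * R ∧
      (succCount X sel k a n ω : ℝ) ≤ selCount sel k a n ω * v ∧
      L ≤ selCount sel k a n ω * klR (succCount X sel k a n ω / selCount sel k a n ω) v}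
      ≤ Real.exp (2 - L) * ((L + 1) * Real.log R + 1) := by
  have hL0 : 0 < L := by linarith
  set ρ := 1 + 1 / L with hρ
  have hρ1 : 1 < ρ := by rw [hρ]; linarith [show 0 < 1 / L by positivity]
  have hlogρ : 1 / (L + 1) ≤ Real.log ρ := by
    have := Real.one_sub_inv_le_log_of_pos (show 0 < ρ by linarith)
    refine le_trans (le_of_eq ?_) this
    rw [hρ]; field_simp; ring
  have hlogρ0 : 0 < Real.log ρ := Real.log_pos hρ1
  set D := ⌊(L + 1) * Real.log R⌋₊
  have hlogR := Real.log_nonneg hR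
  have hsub : {ω | t₀ ≤ selCount sel k a n ω ∧ (selCount sel k a n ω : ℝ) ≤ t₀ * R ∧
      (succCount X sel k a n ω : ℝ) ≤ selCount sel k a n ω * v ∧
      L ≤ selCount sel k a n ω * klR (succCount X sel k a n ω / selCount sel k a n ω) v} ⊆
      ⋃ i ∈ range (D + 1), {ω | t₀ * ρ ^ i ≤ selCount sel k a n ω ∧
        (selCount sel k a n ω : ℝ) ≤ t₀ * ρ ^ i * (1 + 1 / L) ∧
      (succCount X sel k a n ω : ℝ) ≤ selCount sel k a n ω * v ∧
      L ≤ selCount sel k a n ω * klR (succCount X sel k a n ω / selCount sel k a n ω) v} := by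
    rintro ω ⟨h1, h2, h3⟩
    set N := selCount sel k a n ω
    have hN' : (0 : ℝ) < N := by linarith
    have hNt : 1 ≤ (N : ℝ) / t₀ := (one_le_div ht₀).2 h1
    have hlogN := Real.log_nonneg hNt
    set i := ⌊Real.log (N / t₀) / Real.log ρ⌋₊
    have hi1 : (i : ℝ) ≤ Real.log (N / t₀) / Real.log ρ := Nat.floor_le (by positivity)
    have hi2 : Real.log (N / t₀) / Real.log ρ < i + 1 := Nat.lt_floor_add_one _
    rw [le_div_iff₀ hlogρ0] at hi1
    rw [div_lt_iff₀ hlogρ0] at hi2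
    have e1 : ρ ^ i ≤ N / t₀ := by
      rw [← Real.log_le_log_iff (by positivity) (by positivity), Real.log_pow]; exact hi1
    have e2 : N / t₀ ≤ ρ ^ (i + 1) := by
      rw [← Real.log_le_log_iff (by positivity) (by positivity), Real.log_pow]
      push_cast; exact hi2.le
    rw [le_div_iff₀ ht₀] at e1
    rw [div_le_iff₀ ht₀] at e2
    have hiD : i < D + 1 := by
      rw [Nat.lt_succ_iff]
      apply Nat.le_floor
      have e3 : Real.log (N / t₀) ≤ Real.log R :=
        Real.log_le_log (by positivity) (by rw [div_le_iff₀ ht₀]; linarith)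
      have e4 : (i : ℝ) * (1 / (L + 1)) ≤ Real.log R :=
        ((mul_le_mul_of_nonneg_left hlogρ (Nat.cast_nonneg i)).trans hi1).trans e3
      rw [mul_one_div, div_le_iff₀ (by linarith)] at e4
      linarith
    simp only [Set.mem_iUnion, mem_range]
    exact ⟨i, hiD, by linarith, by
      rw [← hρ, show t₀ * ρ ^ i * ρ = ρ ^ (i + 1) * t₀ by ring]; exact e2, h3⟩
  calc _ ≤ _ := measureReal_mono hsub (measure_ne_top _ _)
    _ ≤ ∑ i ∈ range (D + 1), _ := measureReal_biUnion_finset_le _ _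
    _ ≤ ∑ i ∈ range (D + 1), Real.exp (2 - L) := sum_le_sum fun i _ =>
        hM.measureReal_peel_le hθ k ha hv hv1 hmean hL (by positivity)
    _ = Real.exp (2 - L) * (D + 1) := by simp [mul_comm]
    _ ≤ _ := by
        gcongr
        exact Nat.floor_le (by positivity)

variable {r : Fin K → ℝ} {c : ℝ} {τ : ℕ}

/-- An index rarely drops to a value which all means in the window exceed. -/
theorem IsBernoulliModel.measureReal_klIndex_le (hM : IsBernoulliModel μ ℱ θ X sel)
    (hθ : ∀ n k, 1 ≤ n → θ n k ∈ Set.Icc (0 : ℝ) 1) {j : Fin K} (hr : 0 < r j) {n : ℕ}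
    {v : ℝ} (hv : 0 < v) (hv1 : v < 1) (hmean : ∀ t ∈ Ico (winStart τ n) n, v ≤ θ t j)
    (hτ : 1 ≤ τ) (hL : 1 < explorationLevel c τ) :
    μ.real {ω | klIndex r c τ X sel n j ω ≤ r j * v}
      ≤ Real.exp (2 - explorationLevel c τ) *
        ((explorationLevel c τ + 1) * Real.log τ + 2) := by
  have hτ' : (1 : ℝ) ≤ τ := by exact_mod_cast hτ
  have := hM.measureReal_peel_range_le hθ j (le_max_left 1 (n - τ)) hv hv1 hmean hL one_pos hτ'
  refine (measureReal_mono ?_).trans (this.trans ?_)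
  · intro ω hω
    obtain ⟨h1, h2, h3⟩ := le_kl_of_klIndex_le hr (by linarith) hv hv1 hω
    refine ⟨by exact_mod_cast h1, ?_, h2, h3⟩
    rw [one_mul]
    exact_mod_cast windowCount_le sel j τ n ω
  · gcongr; norm_num

/-- An index is very rarely smaller than a value which all means in the window exceed by a
fixed factor. -/
theorem IsBernoulliModel.measureReal_klIndex_le_of_margin (hM : IsBernoulliModel μ ℱ θ X sel)
    (hθ : ∀ n k, 1 ≤ n → θ n k ∈ Set.Icc (0 : ℝ) 1) {j : Fin K} (hr : 0 < r j) {n : ℕ}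
    {v w m : ℝ} (hv : 0 < v) (hw : 0 < w) (hm : 0 < m) (hwv : w ≤ (1 - m) * v) (hv1 : v < 1)
    (hmean : ∀ t ∈ Ico (winStart τ n) n, v ≤ θ t j) (hL : 1 < explorationLevel c τ) :
    μ.real {ω | klIndex r c τ X sel n j ω ≤ r j * w}
      ≤ Real.exp (2 - explorationLevel c τ) *
        ((explorationLevel c τ + 1) * Real.log (2 / m ^ 3) + 2) := by
  set L := explorationLevel c τ with hLdef
  have hL0 : 0 < L := by linarith
  have hm1 : m < 1 := by
    by_contra h
    push Not at h
    nlinarith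
  have hwv' : w < v := by nlinarith
  have hw1 : w < 1 := by linarith
  have hmw : m ≤ 1 - w := by nlinarith
  have hk0 : 0 < klR 0 w := by
    have := pinsker_of_le le_rfl hw.le hw1
    have : 0 < (w - 0) ^ 2 := by rw [sub_zero]; positivity
    linarith
  have hk0' : klR 0 w ≤ v / m :=
    (klR_zero_left_le hw1).trans (div_le_div₀ hv.le hwv'.le hm hmw)
  have hk1 : m ^ 2 * v / 2 ≤ klR w v := by
    refine le_trans ?_ (sq_div_le_klR hw.le hwv'.le hv hv1)
    rw [le_div_iff₀ (by positivity)]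
    have : (m * v) ^ 2 ≤ (v - w) ^ 2 := by
      apply pow_le_pow_left₀ (by positivity); linarith
    nlinarith
  have hk1' : 0 < klR w v := lt_of_lt_of_le (by positivity) hk1
  -- With fewer than t₀ samples the index cannot fall to w: no empirical mean has a larger
  -- divergence to w than 0 has.
  set t₀ := L / klR 0 w with ht₀def
  have ht₀ : 0 < t₀ := by positivity
  -- KL(0, w) ≤ v/m and KL(w, v) ≥ m²v/2 have ratio at most 2/m³. Beyond t₀R samples the single
  -- likelihood ratio of w against v already gives e^(-L), so only sizes between t₀ and t₀R are
  -- peeled.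
  set R := 2 / m ^ 3 with hRdef
  have hR : 1 ≤ R := by
    rw [hRdef, one_le_div (by positivity)]
    have : m ^ 3 ≤ 1 := pow_le_one₀ hm.le hm1.le
    linarith
  have hbig : L ≤ t₀ * R * klR w v := by
    have : (1 : ℝ) ≤ R * klR w v / klR 0 w := by
      rw [one_le_div hk0]
      refine hk0'.trans ?_
      calc v / m = R * (m ^ 2 * v / 2) := by rw [hRdef]; field_simp
        _ ≤ _ := by gcongr
    calc L = L * 1 := (mul_one L).symm
      _ ≤ L * (R * klR w v / klR 0 w) := by gcongr
      _ = _ := by rw [ht₀def]; ring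
  have ha : 1 ≤ winStart τ n := le_max_left 1 (n - τ)
  have h1 := hM.measureReal_peel_range_le hθ j ha hv hv1 hmean hL ht₀ hR
  have h2 := hM.measureReal_logLik_le hθ j ha hv hv1 hw hw1 (n := n)
      (fun t ht => mul_nonpos_of_nonneg_of_nonpos (sub_nonneg.2 (hmean t ht)) (by linarith))
      (κ := L) (E := {ω | t₀ * R < selCount sel j (winStart τ n) n ω ∧
        (succCount X sel j (winStart τ n) n ω : ℝ) ≤ selCount sel j (winStart τ n) n ω * w}) (by
      rintro ω ⟨h1, h2⟩
      have hSN := succCount_le X sel j (winStart τ n) n ω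
      set N := selCount sel j (winStart τ n) n ω
      set S := succCount X sel j (winStart τ n) n ω
      have hN' : (0 : ℝ) < N := lt_trans (by positivity) h1
      have hN : 0 < N := by exact_mod_cast hN'
      rw [logLik_eq hSN hN hv hv1 hw hw1]
      have hμw : (S : ℝ) / N ≤ w := by rw [div_le_iff₀ hN']; linarith
      have h5 := klR_add_klR_le (by positivity) hμw hw hwv'.le hv1
      have h6 : t₀ * R * klR w v ≤ N * klR w v := by gcongr
      nlinarith)
  have hsub : {ω | klIndex r c τ X sel n j ω ≤ r j * w} ⊆
      {ω | t₀ ≤ selCount sel j (winStart τ n) n ω ∧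
      (selCount sel j (winStart τ n) n ω : ℝ) ≤ t₀ * R ∧
      (succCount X sel j (winStart τ n) n ω : ℝ) ≤ selCount sel j (winStart τ n) n ω * v ∧
      L ≤ selCount sel j (winStart τ n) n ω * klR (succCount X sel j (winStart τ n) n ω /
        selCount sel j (winStart τ n) n ω) v} ∪
      {ω | t₀ * R < selCount sel j (winStart τ n) n ω ∧
        (succCount X sel j (winStart τ n) n ω : ℝ) ≤ selCount sel j (winStart τ n) n ω * w} := by
    intro ω hω
    obtain ⟨h1, h2, h3⟩ := le_kl_of_klIndex_le hr hL0.le hw hw1 hω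
    set N := selCount sel j (winStart τ n) n ω
    set S := succCount X sel j (winStart τ n) n ω
    have hN' : (0 : ℝ) < N := by exact_mod_cast h1
    by_cases hbig : t₀ * R < N
    · exact Or.inr ⟨hbig, h2⟩
    · left
      have hμw : (S : ℝ) / N ≤ w := by rw [div_le_iff₀ hN']; linarith
      have hμ0 : (0 : ℝ) ≤ S / N := by positivity
      refine ⟨?_, not_lt.1 hbig, h2.trans (by gcongr), h3.trans ?_⟩
      · rw [ht₀def, div_le_iff₀ hk0]
        refine h3.trans ?_
        gcongr
        exact klR_antitone_left le_rfl hμ0 hμw hw1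
      · gcongr
        exact klR_mono_right hμ0 hμw hw hwv'.le hv1
  calc _ ≤ _ := measureReal_mono hsub
    _ ≤ _ := measureReal_union_le _ _
    _ ≤ Real.exp (2 - L) * ((L + 1) * Real.log R + 1) + Real.exp (2 - L) := by
        refine add_le_add h1 (h2.trans ?_)
        exact Real.exp_le_exp.2 (by linarith)
    _ = _ := by ring

end Underestimation


/-! ### Counting in windows -/

section Counting

theorem sum_Icc_le_of_block_le {f : ℕ → ℝ} (hf : ∀ n, 0 ≤ f n) {τ : ℕ} (hτ : 1 ≤ τ) {M : ℝ}
    (hM : 0 ≤ M) (hblock : ∀ i : ℕ, ∑ n ∈ Ico (1 + i * τ) (1 + i * τ + τ), f n ≤ M) (T : ℕ) :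
    ∑ n ∈ Icc 1 T, f n ≤ ((T : ℝ) / τ + 1) * M := by
  have hmaps : ∀ n ∈ Icc 1 T, (n - 1) / τ ∈ range (T / τ + 1) := by
    intro n hn
    rw [mem_Icc] at hn
    rw [mem_range, Nat.lt_succ_iff]
    exact Nat.div_le_div_right (by omega)
  rw [← sum_fiberwise_of_maps_to hmaps]
  calc _ ≤ ∑ i ∈ range (T / τ + 1), M := by
        refine sum_le_sum fun i _ => (sum_le_sum_of_subset_of_nonneg ?_ fun n _ _ => hf n).trans
          (hblock i)
        intro n hn
        rw [mem_filter, mem_Icc] at hn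
        obtain ⟨⟨h1, _⟩, h2⟩ := hn
        have h3 := Nat.div_mul_le_self (n - 1) τ
        have h4 := Nat.lt_div_mul_add (a := n - 1) (b := τ) (by omega)
        rw [h2] at h3 h4
        rw [mem_Ico]; omega
    _ = ((T / τ : ℕ) + 1 : ℝ) * M := by simp
    _ ≤ _ := by gcongr; exact Nat.cast_div_le

variable {Ω : Type*} {K : ℕ}

open Classical in
-- All counted slots before the last one lie in the window of the last one, so there are fewer than
-- l of them.
theorem sum_ite_selCount_lt_le (sel : ℕ → Ω → Fin K) (k : Fin K) (ω : Ω) {τ a : ℕ} (ha : 1 ≤ a)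
    {l : ℝ} (hl : 0 ≤ l) :
    ∑ n ∈ Ico a (a + τ), (if sel n ω = k ∧ (selCount sel k (winStart τ n) n ω : ℝ) < l
      then (1 : ℝ) else 0) ≤ l + 1 := by
  rw [← sum_filter, sum_const, nsmul_eq_mul, mul_one]
  set F := (Ico a (a + τ)).filter
    fun n => sel n ω = k ∧ (selCount sel k (winStart τ n) n ω : ℝ) < l with hF
  rcases F.eq_empty_or_nonempty with h | h
  · rw [h]; simp; linarith
  · set n := F.max' h
    have hn : n ∈ F := F.max'_mem h
    have hn' := hn
    rw [hF, mem_filter, mem_Ico] at hn'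
    have hsub : F.erase n ⊆ (Ico (winStart τ n) n).filter fun t => sel t ω = k := by
      intro t ht
      rw [mem_erase] at ht
      have hlt : t < n := lt_of_le_of_ne (F.le_max' t ht.2) ht.1
      have ht2 := ht.2
      rw [hF, mem_filter, mem_Ico] at ht2
      rw [mem_filter, mem_Ico]
      refine ⟨⟨?_, hlt⟩, ht2.2.1⟩
      simp only [winStart]; omega
    have hcard := card_le_card hsub
    rw [card_erase_of_mem hn] at hcard
    have e : selCount sel k (winStart τ n) n ω
        = #((Ico (winStart τ n) n).filter fun t => sel t ω = k) := by
      rw [selCount, ← sum_filter]; simp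
    have h1 := hn'.2.2
    rw [e] at h1
    have h2 : ((#F : ℕ) : ℝ) ≤ #((Ico (winStart τ n) n).filter fun t => sel t ω = k) + 1 := by
      exact_mod_cast (by omega)
    linarith

theorem selCount_mono_right (sel : ℕ → Ω → Fin K) (k : Fin K) (ω : Ω) {a m n : ℕ} (h : m ≤ n) :
    selCount sel k a m ω ≤ selCount sel k a n ω :=
  sum_le_sum_of_subset (Ico_subset_Ico_right h)

theorem selCount_succ (sel : ℕ → Ω → Fin K) (k : Fin K) (ω : Ω) {a n : ℕ} (h : a ≤ n)
    (hn : sel n ω = k) : selCount sel k a (n + 1) ω = selCount sel k a n ω + 1 := by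
  rw [selCount, sum_Ico_succ_top h, if_pos hn, selCount]

theorem selCount_lt_of_lt (sel : ℕ → Ω → Fin K) (k : Fin K) (ω : Ω) {a m n : ℕ} (ham : a ≤ m)
    (h : m < n) (hm : sel m ω = k) : selCount sel k a m ω < selCount sel k a n ω := by
  have := selCount_mono_right sel k ω (a := a) (show m + 1 ≤ n from h)
  rw [selCount_succ sel k ω ham hm] at this
  omega

/-- The first selection of rate `k` in a window which contains one. -/
theorem exists_first_sel (sel : ℕ → Ω → Fin K) (k : Fin K) (ω : Ω) {a n : ℕ}
    (h : 0 < selCount sel k a n ω) :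
    ∃ u ∈ Ico a n, sel u ω = k ∧ selCount sel k u n ω = selCount sel k a n ω ∧
      ∀ t ∈ Ico a u, sel t ω ≠ k := by
  classical
  have hex : ∃ u, u ∈ Ico a n ∧ sel u ω = k := by
    by_contra hne
    push Not at hne
    have : selCount sel k a n ω = 0 := sum_eq_zero fun t ht => if_neg (hne t ht)
    omega
  refine ⟨Nat.find hex, (Nat.find_spec hex).1, (Nat.find_spec hex).2, ?_, ?_⟩
  · have hu := mem_Ico.1 (Nat.find_spec hex).1
    rw [selCount, selCount, ← sum_Ico_consecutive _ hu.1 hu.2.le]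
    rw [sum_eq_zero (s := Ico a (Nat.find hex)), zero_add]
    intro t ht
    rw [mem_Ico] at ht
    exact if_neg fun hs => Nat.find_min hex ht.2 ⟨mem_Ico.2 ⟨ht.1, by omega⟩, hs⟩
  · intro t ht hs
    rw [mem_Ico] at ht
    have hu := mem_Ico.1 (Nat.find_spec hex).1
    exact Nat.find_min hex ht.2 ⟨mem_Ico.2 ⟨ht.1, by omega⟩, hs⟩

open Classical in
/-- If the windows of many slots contain many slots of `G`, few of them with rate `k`, then many
slots of `G` have another rate. -/
theorem sum_ite_le_sum_unselected (sel : ℕ → Ω → Fin K) (k : Fin K) (ω : Ω) {τ T : ℕ}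
    {A G : Finset ℕ} (hG : G ⊆ Icc 1 T) {m₀ m₁ : ℝ} (hm₀ : 0 ≤ m₀)
    (hmem : ∀ n ∈ A, m₁ ≤ #((Ico (winStart τ n) n).filter (· ∈ G))) :
    (m₁ - m₀) * ∑ n ∈ A, (if sel n ω = k ∧ (selCount sel k (winStart τ n) n ω : ℝ) < m₀
      then (1 : ℝ) else 0) ≤ (m₀ + 1) * ∑ t ∈ G, if sel t ω = k then (0 : ℝ) else 1 := by
  set P : ℕ → Prop := fun n => sel n ω = k ∧ (selCount sel k (winStart τ n) n ω : ℝ) < m₀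
  have h1 : ∀ n ∈ A, (m₁ - m₀) * (if P n then (1 : ℝ) else 0) ≤
      ∑ t ∈ G, (if sel t ω = k then (0 : ℝ) else 1) *
        (if t ∈ Ico (winStart τ n) n ∧ P n then 1 else 0) := by
    intro n hn
    by_cases hP : P n
    · simp only [hP, if_true, mul_one, and_true]
      set B := (Ico (winStart τ n) n).filter (· ∈ G)
      have e1 : ∑ t ∈ G, (if sel t ω = k then (0 : ℝ) else 1) *
          (if t ∈ Ico (winStart τ n) n then 1 else 0)
          = ∑ t ∈ B, if sel t ω = k then (0 : ℝ) else 1 := by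
        rw [show B = G.filter (· ∈ Ico (winStart τ n) n) by ext t; simp [B, and_comm], sum_filter]
        exact sum_congr rfl fun t _ => by split_ifs <;> simp
      have e2 : (∑ t ∈ B, if sel t ω = k then (0 : ℝ) else 1)
          = #B - ∑ t ∈ B, if sel t ω = k then (1 : ℝ) else 0 := by
        rw [eq_sub_iff_add_eq, ← sum_add_distrib, card_eq_sum_ones, Nat.cast_sum]
        exact sum_congr rfl fun t _ => by split_ifs <;> simp
      have e3 : (∑ t ∈ B, if sel t ω = k then (1 : ℝ) else 0)
          ≤ selCount sel k (winStart τ n) n ω := by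
        rw [selCount]; push_cast
        exact sum_le_sum_of_subset_of_nonneg (filter_subset _ _)
          fun t _ _ => by split_ifs <;> simp
      rw [e1, e2]
      linarith [hmem n hn, hP.2]
    · simp [hP]
  rw [mul_sum]
  refine (sum_le_sum h1).trans ?_
  -- Double counting: an unselected slot t is charged only by slots n with t < n ≤ t + τ, and at
  -- most m₀ + 1 of these are counted.
  rw [sum_comm, mul_sum]
  refine sum_le_sum fun t ht => ?_
  rw [← mul_sum, mul_comm (m₀ + 1)]
  refine mul_le_mul_of_nonneg_left ?_ (by split_ifs <;> simp)
  have ht1 := (mem_Icc.1 (hG ht)).1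
  refine le_trans ?_ (sum_ite_selCount_lt_le sel k ω (τ := τ) (a := t + 1) (by omega) hm₀)
  rw [← sum_filter, ← sum_filter]
  refine sum_le_sum_of_subset_of_nonneg ?_ fun _ _ _ => zero_le_one
  intro n hn
  simp only [mem_filter, mem_Ico, winStart] at hn ⊢
  exact ⟨by omega, hn.2.2⟩

end Counting

/-! ### Measurability of the counts, and counting inequalities in expectation -/

section Measurability

variable {Ω : Type*} [mΩ : MeasurableSpace Ω] {μ : Measure Ω}

variable {K : ℕ}
  {ℱ : Filtration ℕ mΩ} {θ : ℕ → Fin K → ℝ} {X : ℕ → Ω → Fin K → Bool} {sel : ℕ → Ω → Fin K}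

theorem IsBernoulliModel.measurable_selCount (hM : IsBernoulliModel μ ℱ θ X sel) (k : Fin K)
    {a n : ℕ} (ha : 1 ≤ a) : Measurable[ℱ (n - 1)] (selCount sel k a n) := by
  unfold selCount
  refine Finset.measurable_fun_sum _ fun t ht => ?_
  rw [mem_Ico] at ht
  exact Measurable.ite (ℱ.mono (by omega) _ (hM.measurableSet_sel k t (by omega)))
    measurable_const measurable_const

theorem IsBernoulliModel.measurable_succCount (hM : IsBernoulliModel μ ℱ θ X sel) (k : Fin K)
    {a n : ℕ} (ha : 1 ≤ a) : Measurable[ℱ (n - 1)] (succCount X sel k a n) := by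
  unfold succCount
  refine Finset.measurable_fun_sum _ fun t ht => ?_
  rw [mem_Ico] at ht
  have h1 : MeasurableSet[ℱ t] {ω | X t ω k = true} :=
    ((measurable_pi_apply k).comp (hM.adapted t (by omega))) (measurableSet_singleton true)
  exact Measurable.ite ((ℱ.mono (by omega) _ (hM.measurableSet_sel k t (by omega))).inter
    (ℱ.mono (by omega) _ h1)) measurable_const measurable_const

theorem IsBernoulliModel.measurableSet_sel' (hM : IsBernoulliModel μ ℱ θ X sel) (k : Fin K)
    {t : ℕ} (ht : 1 ≤ t) : MeasurableSet {ω | sel t ω = k} :=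
  ℱ.le _ _ (hM.measurableSet_sel k t ht)

theorem IsBernoulliModel.measurableSet_sel_selCount (hM : IsBernoulliModel μ ℱ θ X sel)
    (k : Fin K) {n τ : ℕ} (hn : 1 ≤ n) (l : ℝ) :
    MeasurableSet {ω | sel n ω = k ∧ (selCount sel k (winStart τ n) n ω : ℝ) < l} := by
  have h := (hM.measurable_selCount k (n := n) (le_max_left 1 (n - τ))).mono (ℱ.le _) le_rfl
  have h' : Measurable fun ω => (selCount sel k (winStart τ n) n ω : ℝ) :=
    measurable_from_nat.comp h
  exact (hM.measurableSet_sel' k hn).inter (measurableSet_lt h' measurable_const)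

end Measurability

section Expectation

variable {Ω : Type*} [mΩ : MeasurableSpace Ω] {μ : Measure Ω} [IsProbabilityMeasure μ]

/-- A pointwise inequality between sums of indicators, integrated. -/
theorem sum_measureReal_le {ι κ : Type} {s : Finset ι} {E : ι → Set Ω}
    (hE : ∀ i ∈ s, MeasurableSet (E i)) {t : Finset κ} {F : κ → Set Ω}
    (hF : ∀ j ∈ t, MeasurableSet (F j)) {a b M : ℝ}
    (h : ∀ ω, a * ∑ i ∈ s, (E i).indicator (1 : Ω → ℝ) ω
      ≤ b * ∑ j ∈ t, (F j).indicator (1 : Ω → ℝ) ω + M) :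
    a * ∑ i ∈ s, μ.real (E i) ≤ b * ∑ j ∈ t, μ.real (F j) + M := by
  have hint : ∀ A : Set Ω, MeasurableSet A → Integrable (A.indicator (1 : Ω → ℝ)) μ :=
    fun A hA => (integrable_const (1 : ℝ)).indicator hA
  have key : ∀ {η : Type} (s : Finset η) (E : η → Set Ω), (∀ i ∈ s, MeasurableSet (E i)) →
      Integrable (fun ω => ∑ i ∈ s, (E i).indicator (1 : Ω → ℝ) ω) μ ∧
      ∫ ω, ∑ i ∈ s, (E i).indicator (1 : Ω → ℝ) ω ∂μ = ∑ i ∈ s, μ.real (E i) := by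
    intro η s E hE
    refine ⟨integrable_finsetSum _ fun i hi => hint _ (hE i hi), ?_⟩
    rw [integral_finsetSum _ fun i hi => hint _ (hE i hi)]
    exact sum_congr rfl fun i hi => integral_indicator_one (hE i hi)
  obtain ⟨i1, e1⟩ := key s E hE
  obtain ⟨i2, e2⟩ := key t F hF
  have := integral_mono (μ := μ) (i1.const_mul a) ((i2.const_mul b).add (integrable_const M)) h
  simp only [Pi.add_apply] at this
  rw [integral_const_mul, e1, integral_add (i2.const_mul b) (integrable_const M),
    integral_const_mul, e2] at this
  simpa using this

variable {K : ℕ}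
  {ℱ : Filtration ℕ mΩ} {θ : ℕ → Fin K → ℝ} {X : ℕ → Ω → Fin K → Bool} {sel : ℕ → Ω → Fin K}

theorem IsBernoulliModel.sum_measureReal_selCount_lt_le (hM : IsBernoulliModel μ ℱ θ X sel)
    (k : Fin K) {τ T : ℕ} (hτ : 1 ≤ τ) {l : ℝ} (hl : 0 ≤ l) :
    ∑ n ∈ Icc 1 T, μ.real {ω | sel n ω = k ∧ (selCount sel k (winStart τ n) n ω : ℝ) < l}
      ≤ ((T : ℝ) / τ + 1) * (l + 1) := by
  classical
  have := sum_measureReal_le (μ := μ) (s := Icc 1 T) (a := 1) (b := 0) (t := (∅ : Finset ℕ))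
    (F := fun _ => ∅) (M := ((T : ℝ) / τ + 1) * (l + 1))
    (fun n hn => hM.measurableSet_sel_selCount k (τ := τ) (mem_Icc.1 hn).1 l) (by simp) (by
      intro ω
      simp only [one_mul, sum_empty, mul_zero, zero_add]
      refine sum_Icc_le_of_block_le (fun n => Set.indicator_nonneg (by simp) _) hτ (by linarith)
        (fun i => ?_) T
      refine le_trans (le_of_eq ?_)
        (sum_ite_selCount_lt_le sel k ω (τ := τ) (a := 1 + i * τ) (by omega) hl)
      exact sum_congr rfl fun n _ => by simp [Set.indicator_apply])
  simpa using this

theorem IsBernoulliModel.sum_measureReal_le_unselected (hM : IsBernoulliModel μ ℱ θ X sel)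
    (k : Fin K) {τ T : ℕ} {A G : Finset ℕ} (hA : A ⊆ Icc 1 T) (hG : G ⊆ Icc 1 T) {m₀ m₁ : ℝ}
    (hm₀ : 0 ≤ m₀) (hmem : ∀ n ∈ A, m₁ ≤ #((Ico (winStart τ n) n).filter (· ∈ G))) :
    (m₁ - m₀) * ∑ n ∈ A,
      μ.real {ω | sel n ω = k ∧ (selCount sel k (winStart τ n) n ω : ℝ) < m₀}
      ≤ (m₀ + 1) * ∑ t ∈ G, (1 - μ.real {ω | sel t ω = k}) := by
  classical
  have := sum_measureReal_le (μ := μ) (s := A) (a := m₁ - m₀) (b := m₀ + 1) (t := G)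
    (F := fun t => {ω | sel t ω = k}ᶜ) (M := 0)
    (fun n hn => hM.measurableSet_sel_selCount k (τ := τ) (mem_Icc.1 (hA hn)).1 m₀)
    (fun t ht => (hM.measurableSet_sel' k (mem_Icc.1 (hG ht)).1).compl) (by
      intro ω
      have := sum_ite_le_sum_unselected sel k ω hG hm₀ hmem
      rw [add_zero]
      refine le_trans (le_of_eq ?_) (this.trans (le_of_eq ?_))
      · congr 1; exact sum_congr rfl fun n _ => by simp [Set.indicator_apply]
      · congr 1; exact sum_congr rfl fun n _ => by simp [Set.indicator_apply])
  rw [add_zero] at this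
  refine this.trans (le_of_eq ?_)
  congr 1
  exact sum_congr rfl fun t ht => probReal_compl_eq_one_sub
    (hM.measurableSet_sel' k (mem_Icc.1 (hG ht)).1)

end Expectation


/-! ### Overestimation of a rate -/

section Overestimation

theorem sub_sq_le_one_sub_exp_neg {ζ : ℝ} (hζ : 0 ≤ ζ) : ζ - ζ ^ 2 / 2 ≤ 1 - Real.exp (-ζ) := by
  have h1 := Real.quadratic_le_exp_of_nonneg hζ
  have h2 : Real.exp (-ζ) ≤ 1 / (1 + ζ + ζ ^ 2 / 2) := by
    rw [Real.exp_neg, ← one_div]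
    exact one_div_le_one_div_of_le (by positivity) h1
  have h3 : 1 / (1 + ζ + ζ ^ 2 / 2) ≤ 1 - ζ + ζ ^ 2 / 2 := by
    rw [div_le_iff₀ (by positivity)]
    nlinarith [sq_nonneg (ζ ^ 2)]
  linarith

/-- With A = (1 - e^(-ζ))(1 - x) the left side is e^A (1 - A). Each failure is penalised by ζ and A
is the compensator. -/
theorem tilt_mean_le_one (x ζ : ℝ) :
    x * Real.exp ((1 - Real.exp (-ζ)) * (1 - x)) +
      (1 - x) * Real.exp ((1 - Real.exp (-ζ)) * (1 - x) - ζ) ≤ 1 := by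
  set A := (1 - Real.exp (-ζ)) * (1 - x) with hA
  have h1 : Real.exp (A - ζ) = Real.exp A * Real.exp (-ζ) := by rw [← Real.exp_add]; ring_nf
  have h2 : 1 - A ≤ Real.exp (-A) := by linarith [Real.add_one_le_exp (-A)]
  have h3 : Real.exp A * (1 - A) ≤ 1 := by
    calc Real.exp A * (1 - A) ≤ Real.exp A * Real.exp (-A) := by gcongr
      _ = 1 := by rw [← Real.exp_add]; simp
  rw [h1]
  have : x * Real.exp A + (1 - x) * (Real.exp A * Real.exp (-ζ)) = Real.exp A * (1 - A) := by
    rw [hA]; ring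
  linarith

variable {Ω : Type*} {K : ℕ}

/-- At most N(1 - ζ)(1 - p) failures leave N(1 - p)((ζ - ζ²/2) - ζ(1 - ζ)) = N(1 - p)ζ²/2. The
increments contain the true means and not p, so one process serves all windows although p varies
with the slot. -/
theorem mul_le_sum_tilt (θ : ℕ → Fin K → ℝ) (X : ℕ → Ω → Fin K → Bool) (sel : ℕ → Ω → Fin K)
    (k : Fin K) (ω : Ω) {a n : ℕ} {ζ p W : ℝ} (hζ : 0 ≤ ζ) (hp : p ≤ 1 - W) (hW : 0 ≤ W)
    (hθ : ∀ t ∈ Ico a n, θ t k ≤ p)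
    (hS : (selCount sel k a n ω : ℝ) * (p + ζ * (1 - p)) ≤ succCount X sel k a n ω) :
    (selCount sel k a n ω : ℝ) * (W * ζ ^ 2 / 2) ≤ ∑ t ∈ Ico a n, if sel t ω = k then
      (if X t ω k = true then (1 - Real.exp (-ζ)) * (1 - θ t k)
        else (1 - Real.exp (-ζ)) * (1 - θ t k) - ζ) else 0 := by
  have he : 0 ≤ 1 - Real.exp (-ζ) := by
    have : Real.exp (-ζ) ≤ 1 := Real.exp_le_one_iff.2 (by linarith)
    linarith
  set A := (1 - Real.exp (-ζ)) * (1 - p)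
  have h1 := sum_ite_sel_eq X sel k a n ω A (A - ζ)
  have h2 : (∑ t ∈ Ico a n, if sel t ω = k then (if X t ω k = true then A else A - ζ) else 0) ≤
      ∑ t ∈ Ico a n, if sel t ω = k then
      (if X t ω k = true then (1 - Real.exp (-ζ)) * (1 - θ t k)
        else (1 - Real.exp (-ζ)) * (1 - θ t k) - ζ) else 0 := by
    refine sum_le_sum fun t ht => ?_
    have : A ≤ (1 - Real.exp (-ζ)) * (1 - θ t k) :=
      mul_le_mul_of_nonneg_left (by linarith [hθ t ht]) he
    split_ifs <;> linarith
  refine le_trans ?_ h2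
  rw [h1]
  set N := (selCount sel k a n ω : ℝ)
  set S := (succCount X sel k a n ω : ℝ)
  have hN : 0 ≤ N := Nat.cast_nonneg _
  have h3 : (ζ - ζ ^ 2 / 2) * (1 - p) ≤ A :=
    mul_le_mul_of_nonneg_right (sub_sq_le_one_sub_exp_neg hζ) (by linarith)
  have h4 : N * ((ζ - ζ ^ 2 / 2) * (1 - p)) ≤ N * A := mul_le_mul_of_nonneg_left h3 hN
  have h5 : ζ * (N * (p + ζ * (1 - p))) ≤ ζ * S := mul_le_mul_of_nonneg_left hS hζ
  have h6 : N * (W * ζ ^ 2 / 2) ≤ N * ((1 - p) * ζ ^ 2 / 2) := by gcongr; linarith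
  nlinarith

variable [mΩ : MeasurableSpace Ω] {μ : Measure Ω} [IsProbabilityMeasure μ]
  {ℱ : Filtration ℕ mΩ} {θ : ℕ → Fin K → ℝ} {X : ℕ → Ω → Fin K → Bool} {sel : ℕ → Ω → Fin K}

theorem IsBernoulliModel.measureReal_overestimate_le (hM : IsBernoulliModel μ ℱ θ X sel)
    (hθ : ∀ n k, 1 ≤ n → θ n k ∈ Set.Icc (0 : ℝ) 1) (k : Fin K) {a n : ℕ} (ha : 1 ≤ a)
    {ζ p W m : ℝ} (hζ : 0 ≤ ζ) (hp : p ≤ 1 - W) (hW : 0 ≤ W) (hm : 0 ≤ m)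
    (hmean : ∀ t ∈ Ico a n, θ t k ≤ p) :
    μ.real {ω | m ≤ selCount sel k a n ω ∧
      (selCount sel k a n ω : ℝ) * (p + ζ * (1 - p)) ≤ succCount X sel k a n ω}
      ≤ Real.exp (-(m * (W * ζ ^ 2 / 2))) := by
  rcases le_or_gt a n with han | han
  · have := hM.measureReal_le_exp_neg hθ k (b := fun t => {ω | sel t ω = k})
      (fun t ht => hM.measurableSet_sel k t ht) (fun t => (1 - Real.exp (-ζ)) * (1 - θ t k))
      (fun t => (1 - Real.exp (-ζ)) * (1 - θ t k) - ζ) ha MeasurableSet.univ han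
      (κ := m * (W * ζ ^ 2 / 2)) (E := {ω | m ≤ selCount sel k a n ω ∧
        (selCount sel k a n ω : ℝ) * (p + ζ * (1 - p)) ≤ succCount X sel k a n ω})
      (fun t _ => tilt_mean_le_one _ _) (by
        rintro ω ⟨h1, h2⟩
        refine ⟨trivial, le_trans ?_ ((mul_le_sum_tilt θ X sel k ω hζ hp hW hmean h2).trans
          (le_of_eq ?_))⟩
        · gcongr
        · exact sum_congr rfl fun t _ => by simp [Set.mem_ofPred_eq])
    simpa using this
  · have e : ∀ ω, selCount sel k a n ω = 0 := fun ω => by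
      rw [selCount, Ico_eq_empty_of_le han.le, sum_empty]
    rcases hm.eq_or_lt with h | h
    · rw [← h]; simp
    · have : {ω | m ≤ selCount sel k a n ω ∧
        (selCount sel k a n ω : ℝ) * (p + ζ * (1 - p)) ≤ succCount X sel k a n ω} = ∅ := by
        rw [Set.eq_empty_iff_forall_notMem]
        rintro ω ⟨h1, -⟩
        rw [e] at h1; simp at h1; linarith
      rw [this]; simp; positivity

open Classical in
/-- Slots at which a rate is selected after a sample of moderate size in the window has
overestimated it are rare, compared with all selections of the rate. -/
theorem IsBernoulliModel.sum_measureReal_overestimate_le (hM : IsBernoulliModel μ ℱ θ X sel)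
    (hθ : ∀ n k, 1 ≤ n → θ n k ∈ Set.Icc (0 : ℝ) 1) (k : Fin K) {τ T : ℕ} {A U : Finset ℕ}
    (hA : A ⊆ Icc 1 T) (hU : U ⊆ Icc 1 T) (hAU : ∀ n ∈ A, Ico (winStart τ n) n ⊆ U)
    {ζ W l m : ℝ} {p : ℕ → ℝ} (hζ : 0 ≤ ζ) (hp : ∀ n ∈ A, p n ≤ 1 - W) (hW : 0 ≤ W)
    (hl : 0 < l) (hm : 0 ≤ m) (hmean : ∀ n ∈ A, ∀ t ∈ Ico (winStart τ n) n, θ t k ≤ p n) :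
    ∑ n ∈ A, μ.real {ω | sel n ω = k ∧ l ≤ selCount sel k (winStart τ n) n ω ∧
      (selCount sel k (winStart τ n) n ω : ℝ) < m ∧
      (selCount sel k (winStart τ n) n ω : ℝ) * (p n + ζ * (1 - p n))
        ≤ succCount X sel k (winStart τ n) n ω}
      ≤ (m + 1) * Real.exp (-(l * (W * ζ ^ 2 / 2))) * ∑ u ∈ U, μ.real {ω | sel u ω = k} := by
  set α : ℕ → ℝ := fun t => (1 - Real.exp (-ζ)) * (1 - θ t k) with hα
  set κ₀ := W * ζ ^ 2 / 2 with hκ₀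
  have hκ₀0 : 0 ≤ κ₀ := by positivity
  set Sz : Finset ℕ := (range ⌈m⌉₊).filter fun s => l ≤ (s : ℝ) with hSz
  -- Sampling from slot u on until s samples are collected. This depends on (u, s) only, not on the
  -- slot n whose window is examined.
  set b : ℕ → ℕ → ℕ → Set Ω := fun u s t => {ω | sel t ω = k ∧ selCount sel k u t ω < s} with hb
  set F : ℕ × ℕ → Set Ω := fun x => {ω | sel x.1 ω = k ∧ (x.2 : ℝ) * κ₀ ≤
    ∑ t ∈ Ico x.1 (x.1 + τ), if ω ∈ b x.1 x.2 t then
      (if X t ω k = true then α t else α t - ζ) else 0} with hF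
  set E : ℕ → Set Ω := fun n => {ω | sel n ω = k ∧ l ≤ selCount sel k (winStart τ n) n ω ∧
      (selCount sel k (winStart τ n) n ω : ℝ) < m ∧
      (selCount sel k (winStart τ n) n ω : ℝ) * (p n + ζ * (1 - p n))
        ≤ succCount X sel k (winStart τ n) n ω} with hE
  have hbm : ∀ u s t, 1 ≤ u → 1 ≤ t → MeasurableSet[ℱ (t - 1)] (b u s t) := by
    intro u s t hu ht
    exact (hM.measurableSet_sel k t ht).inter
      ((hM.measurable_selCount k hu (n := t)) (measurableSet_Iio (a := s)))
  have hEm : ∀ n ∈ A, MeasurableSet (E n) := by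
    intro n hn
    have hn1 := (mem_Icc.1 (hA hn)).1
    have h1 : Measurable fun ω => (selCount sel k (winStart τ n) n ω : ℝ) :=
      measurable_from_nat.comp
        ((hM.measurable_selCount k (n := n) (le_max_left 1 (n - τ))).mono (ℱ.le _) le_rfl)
    have h2 : Measurable fun ω => (succCount X sel k (winStart τ n) n ω : ℝ) :=
      measurable_from_nat.comp
        ((hM.measurable_succCount k (n := n) (le_max_left 1 (n - τ))).mono (ℱ.le _) le_rfl)
    exact (hM.measurableSet_sel' k hn1).inter ((measurableSet_le measurable_const h1).inter
      ((measurableSet_lt h1 measurable_const).inter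
        (measurableSet_le (h1.mul measurable_const) h2)))
  have hFm : ∀ x ∈ U ×ˢ Sz, MeasurableSet (F x) := by
    rintro ⟨u, s⟩ hx
    have hu := (mem_Icc.1 (hU (mem_product.1 hx).1)).1
    suffices hs : Measurable fun ω => ∑ t ∈ Ico u (u + τ), if ω ∈ b u s t then
        (if X t ω k = true then α t else α t - ζ) else 0 from
      (hM.measurableSet_sel' k hu).inter (measurableSet_le measurable_const hs)
    refine Finset.measurable_fun_sum _ fun t ht => ?_
    have ht1 : 1 ≤ t := hu.trans (mem_Ico.1 ht).1
    have hX : MeasurableSet {ω | X t ω k = true} :=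
      ℱ.le t _ (((measurable_pi_apply k).comp (hM.adapted t ht1)) (measurableSet_singleton true))
    exact Measurable.ite (ℱ.le _ _ (hbm u s t hu ht1))
      (Measurable.ite hX measurable_const measurable_const) measurable_const
  have hpt : ∀ ω, (1 : ℝ) * ∑ n ∈ A, (E n).indicator (1 : Ω → ℝ) ω
      ≤ 1 * ∑ x ∈ U ×ˢ Sz, (F x).indicator (1 : Ω → ℝ) ω + 0 := by
    intro ω
    simp only [one_mul, add_zero, Set.indicator_apply, Pi.one_apply]
    rw [Finset.sum_boole, Finset.sum_boole, Nat.cast_le]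
    have hfirst : ∀ n ∈ A.filter (fun n => ω ∈ E n), ∃ u ∈ Ico (winStart τ n) n, sel u ω = k ∧
        selCount sel k u n ω = selCount sel k (winStart τ n) n ω ∧
        ∀ t ∈ Ico (winStart τ n) u, sel t ω ≠ k := by
      intro n hn
      apply exists_first_sel
      have := (mem_filter.1 hn).2.2.1
      exact_mod_cast hl.trans_le this
    choose! u hu using hfirst
    -- The first selection in the window and the window count determine n: since n is itself a
    -- selection, a later slot with the same first selection has a larger count.
    refine card_le_card_of_injOn (fun n => (u n, selCount sel k (winStart τ n) n ω)) ?_ ?_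
    · intro n hn
      have hn := mem_coe.1 hn
      obtain ⟨hun, huk, huc, hunot⟩ := hu n hn
      obtain ⟨hnA, hnk, hnl, hnm, hnS⟩ := mem_filter.1 hn
      rw [mem_Ico] at hun
      rw [mem_coe, mem_filter, mem_product]
      refine ⟨⟨hAU n hnA (mem_Ico.2 hun), ?_⟩, huk, ?_⟩
      · rw [hSz, mem_filter, mem_range]
        exact ⟨Nat.lt_ceil.2 hnm, hnl⟩
      · refine (mul_le_sum_tilt θ X sel k ω hζ (hp n hnA) hW (hmean n hnA) hnS).trans
          (le_of_eq ?_)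
        have hnu : n ≤ u n + τ := by have := hun.1; simp only [winStart] at this; omega
        dsimp only
        rw [← sum_Ico_consecutive _ hun.1 hun.2.le, ← sum_Ico_consecutive _ hun.2.le hnu]
        rw [sum_eq_zero (s := Ico (winStart τ n) (u n)) fun t ht => if_neg (hunot t ht), zero_add]
        rw [sum_eq_zero (s := Ico n (u n + τ)), add_zero]
        · refine sum_congr rfl fun t ht => ?_
          rw [mem_Ico] at ht
          by_cases hs : sel t ω = k
          · have hlt := selCount_lt_of_lt sel k ω ht.1 ht.2 hs
            rw [huc] at hlt
            rw [if_pos hs, if_pos (show ω ∈ b _ _ t from ⟨hs, hlt⟩)]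
          · rw [if_neg hs, if_neg fun h => hs h.1]
        · intro t ht
          rw [mem_Ico] at ht
          refine if_neg fun h => ?_
          have h2 := h.2
          have h3 := selCount_mono_right sel k ω (a := u n) ht.1
          omega
    · intro n hn n' hn' heq
      obtain ⟨h1, h2⟩ := Prod.mk.inj heq
      obtain ⟨hun, -, huc, -⟩ := hu n (mem_coe.1 hn)
      obtain ⟨hun', -, huc', -⟩ := hu n' (mem_coe.1 hn')
      have hk := (mem_filter.1 (mem_coe.1 hn)).2.1
      have hk' := (mem_filter.1 (mem_coe.1 hn')).2.1
      rw [mem_Ico] at hun hun'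
      rcases lt_trichotomy n n' with h | h | h
      · have := selCount_lt_of_lt sel k ω (show u n' ≤ n by omega) h hk
        rw [← h1] at this huc'
        omega
      · exact h
      · have := selCount_lt_of_lt sel k ω (show u n ≤ n' by omega) h hk'
        rw [← h1] at huc'
        omega
  have h := sum_measureReal_le (μ := μ) hEm hFm hpt
  rw [one_mul, one_mul, add_zero] at h
  refine h.trans ?_
  rw [sum_product, mul_sum]
  refine sum_le_sum fun u hu => ?_
  have hu1 := (mem_Icc.1 (hU hu)).1
  -- Starting the supermartingale on the event of a selection in slot u produces the factor μ(sel u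
  -- = k). At most m + 1 sample sizes s occur, all at least l.
  calc _ ≤ ∑ s ∈ Sz, Real.exp (-(l * κ₀)) * μ.real {ω | sel u ω = k} := by
        refine sum_le_sum fun s hs => ?_
        have hls := (mem_filter.1 hs).2
        refine (hM.measureReal_le_exp_neg hθ k (b := b u s) (fun t ht => hbm u s t hu1 ht) α
          (fun t => α t - ζ) hu1 (hM.measurableSet_sel k u hu1) (Nat.le_add_right u τ)
          (κ := s * κ₀) (E := F (u, s)) (fun t _ => tilt_mean_le_one _ _) (by
            rintro ω ⟨h1, h2⟩; exact ⟨h1, by convert h2⟩)).trans ?_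
        gcongr
    _ = #Sz * (Real.exp (-(l * κ₀)) * μ.real {ω | sel u ω = k}) := by
        rw [sum_const, nsmul_eq_mul]
    _ ≤ (m + 1) * (Real.exp (-(l * κ₀)) * μ.real {ω | sel u ω = k}) := by
        have h1 : (#Sz : ℝ) ≤ ⌈m⌉₊ := by
          exact_mod_cast (card_filter_le _ _).trans (card_range _).le
        have h2 := (Nat.ceil_lt_add_one hm).le
        have : 0 ≤ Real.exp (-(l * κ₀)) * μ.real {ω | sel u ω = k} := by positivity
        exact mul_le_mul_of_nonneg_right (h1.trans h2) this
    _ = _ := by ring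

end Overestimation


/-! ### Decomposition of the regret -/

/-- A run of SW-KL-R-UCB in a slowly varying environment. -/
structure IsRun {Ω : Type*} [mΩ : MeasurableSpace Ω] (μ : Measure Ω) {K : ℕ} (rK c σ : ℝ) (τ : ℕ)
    (r : Fin K → ℝ) (θ : ℕ → Fin K → ℝ) (kstar : ℕ → Fin K) (ℱ : Filtration ℕ mΩ)
    (X : ℕ → Ω → Fin K → Bool) (sel : ℕ → Ω → Fin K) : Prop where
  r_pos : ∀ k, 0 < r k
  r_le : ∀ k, r k ≤ rK
  mem : ∀ n k, 1 ≤ n → θ n k ∈ Set.Icc (0 : ℝ) 1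
  σ_pos : 0 < σ
  lip : LipschitzEvolution θ σ
  best : IsBestRate r θ kstar
  three_le : 3 ≤ τ
  c_pos : 0 < c
  model : IsBernoulliModel μ ℱ θ X sel
  alg : IsSWKLRUCB r c τ X sel

section Pairs

variable {K : ℕ} (r : Fin K → ℝ) (θ : ℕ → Fin K → ℝ) (kstar : ℕ → Fin K) (τ : ℕ) (σ Imin : ℝ)

/-- Expected loss in slot `n` when rate `k` is selected. -/
def gap (n : ℕ) (k : Fin K) : ℝ := r (kstar n) * θ n (kstar n) - r k * θ n k

/-- Upper bound for the mean of rate `k` in the window before slot `n`. -/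
def upMean (n : ℕ) (k : Fin K) : ℝ := θ n k + τ * σ

/-- Mean which would make rate `k` as good as the lower bound for the best rate in the window. -/
def needMean (n : ℕ) (k : Fin K) : ℝ := r (kstar n) * (θ n (kstar n) - τ * σ) / r k

/-- Rate `k` cannot be distinguished well enough from the best rate in slot `n`. -/
def Confused (n : ℕ) (k : Fin K) : Prop :=
  r (kstar n) * (θ n (kstar n) - τ * σ) ≤ r k * (θ n k + τ * σ) ∨
    bernKL (θ n k + τ * σ) (r (kstar n) * (θ n (kstar n) - τ * σ) / r k) < (Imin : EReal)

open Classical in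
/-- The slots in which rate `k` is confused with the best rate. -/
def confSlots (T : ℕ) (k : Fin K) : Finset ℕ :=
  (Icc 1 T).filter fun n => k ≠ kstar n ∧ Confused r θ kstar τ σ Imin n k

open Classical in
/-- The slots after initialisation in which rate `k` is clearly worse than the best rate. -/
def clearSlots (T : ℕ) (k : Fin K) : Finset ℕ :=
  (Icc 1 T).filter fun n => K < n ∧ k ≠ kstar n ∧ ¬ Confused r θ kstar τ σ Imin n k

theorem confusionCount_eq (T : ℕ) :
    confusionCount r θ kstar T Imin τ σ = ∑ k, #(confSlots r θ kstar τ σ Imin T k) := by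
  classical
  unfold confusionCount confSlots Confused
  simp_rw [card_filter, sum_filter]
  rw [sum_comm]
  refine sum_congr rfl fun k _ => sum_congr rfl fun n _ => ?_
  by_cases h1 : k ≠ kstar n
  · simp [h1]
  · simp [h1]

end Pairs

section Regret

variable {Ω : Type*} [mΩ : MeasurableSpace Ω] {μ : Measure Ω} {K : ℕ}
  {ℱ : Filtration ℕ mΩ} {θ : ℕ → Fin K → ℝ} {X : ℕ → Ω → Fin K → Bool} {sel : ℕ → Ω → Fin K}
  {rK c σ Imin : ℝ} {τ T : ℕ} {r : Fin K → ℝ} {kstar : ℕ → Fin K}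

theorem IsBernoulliModel.sum_measureReal_sel [IsProbabilityMeasure μ] (hM : IsBernoulliModel μ ℱ θ X sel)
    {n : ℕ} (hn : 1 ≤ n) : ∑ k, μ.real {ω | sel n ω = k} = 1 := by
  have hm : Measurable (sel n) := (hM.nonanticipating n hn).mono (ℱ.le _) le_rfl
  have := sum_measureReal_preimage_singleton (μ := μ) (f := sel n) univ
    (fun k _ => hm (measurableSet_singleton k))
  have h2 : ∀ k, μ.real {ω | sel n ω = k} = μ.real (sel n ⁻¹' {k}) := fun k => rfl
  simp_rw [h2]
  rw [this]; simp

theorem IsBernoulliModel.integral_comp_sel [IsProbabilityMeasure μ] (hM : IsBernoulliModel μ ℱ θ X sel)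
    {n : ℕ} (hn : 1 ≤ n) (f : Fin K → ℝ) :
    ∫ ω, f (sel n ω) ∂μ = ∑ k, f k * μ.real {ω | sel n ω = k} := by
  have e : ∀ ω, f (sel n ω) = ∑ k, f k * {ω | sel n ω = k}.indicator (1 : Ω → ℝ) ω := by
    intro ω
    rw [sum_eq_single (sel n ω)]
    · simp
    · intro k _ hk
      have : ω ∉ {ω | sel n ω = k} := fun h => hk (Eq.symm h)
      rw [Set.indicator_of_notMem this, mul_zero]
    · simp
  simp_rw [e]
  rw [integral_finsetSum]
  · refine sum_congr rfl fun k _ => ?_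
    rw [integral_const_mul, integral_indicator_one (hM.measurableSet_sel' k hn)]
  · intro k _
    exact ((integrable_const (1 : ℝ)).indicator (hM.measurableSet_sel' k hn)).const_mul _

theorem IsRun.regret_eq [IsProbabilityMeasure μ] (h : IsRun μ rK c σ τ r θ kstar ℱ X sel) :
    regret μ r θ kstar sel T
      = ∑ n ∈ Icc 1 T, ∑ k, gap r θ kstar n k * μ.real {ω | sel n ω = k} := by
  unfold regret
  refine sum_congr rfl fun n hn => ?_
  have hn1 := (mem_Icc.1 hn).1
  rw [h.model.integral_comp_sel hn1 (fun k => r k * θ n k)]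
  simp only [gap, sub_mul, sum_sub_distrib]
  rw [← mul_sum, h.model.sum_measureReal_sel hn1, mul_one]

theorem IsRun.gap_nonneg (h : IsRun μ rK c σ τ r θ kstar ℱ X sel) {n : ℕ} (hn : 1 ≤ n)
    (k : Fin K) : 0 ≤ gap r θ kstar n k := sub_nonneg.2 (h.best n hn k)

theorem IsRun.gap_le (h : IsRun μ rK c σ τ r θ kstar ℱ X sel) {n : ℕ} (hn : 1 ≤ n)
    (k : Fin K) : gap r θ kstar n k ≤ rK := by
  have h1 := h.mem n k hn
  have h2 := h.mem n (kstar n) hn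
  have h3 := h.r_pos k
  have h4 := h.r_pos (kstar n)
  have h5 := h.r_le (kstar n)
  unfold gap
  have h6 := mul_nonneg h3.le h1.1
  have h7 := mul_le_mul_of_nonneg_left h2.2 h4.le
  linarith

theorem IsRun.rK_nonneg (h : IsRun μ rK c σ τ r θ kstar ℱ X sel) : 0 ≤ rK :=
  (h.gap_nonneg le_rfl (kstar 1)).trans (h.gap_le le_rfl (kstar 1))

theorem IsRun.τσ_pos (h : IsRun μ rK c σ τ r θ kstar ℱ X sel) : 0 < (τ : ℝ) * σ := by
  have : (3 : ℝ) ≤ τ := by exact_mod_cast h.three_le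
  have := h.σ_pos
  positivity

theorem IsRun.regret_le_trivial [IsProbabilityMeasure μ] (h : IsRun μ rK c σ τ r θ kstar ℱ X sel) :
    regret μ r θ kstar sel T ≤ rK * T := by
  rw [h.regret_eq]
  calc _ ≤ ∑ n ∈ Icc 1 T, rK := by
        refine sum_le_sum fun n hn => ?_
        have hn1 := (mem_Icc.1 hn).1
        calc _ ≤ ∑ k, rK * μ.real {ω | sel n ω = k} := sum_le_sum fun k _ =>
              mul_le_mul_of_nonneg_right (h.gap_le hn1 k) measureReal_nonneg
          _ = rK := by rw [← mul_sum, h.model.sum_measureReal_sel hn1, mul_one]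
    _ = _ := by simp [mul_comm]

/-- The gap is r_k(x - p) plus at most 2 rK τσ, and Pinsker's inequality turns a divergence below
Imin into x - p ≤ √(Imin/2). -/
theorem IsRun.confused_gap_le (h : IsRun μ rK c σ τ r θ kstar ℱ X sel)
    {n : ℕ} (hn : 1 ≤ n) {k : Fin K} (hc : Confused r θ kstar τ σ Imin n k) :
    gap r θ kstar n k ≤ rK * (√(Imin / 2) + 2 * τ * σ) := by
  have h1 := h.mem n k hn
  have hrk := h.r_pos k
  have hrs := h.r_pos (kstar n)
  have hrk' := h.r_le k
  have hrs' := h.r_le (kstar n)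
  have hτσ := h.τσ_pos
  have hsq := Real.sqrt_nonneg (Imin / 2)
  have hrK := h.rK_nonneg
  have e1 : r k * (τ * σ) ≤ rK * (τ * σ) := by gcongr
  have e2 : r (kstar n) * (τ * σ) ≤ rK * (τ * σ) := by gcongr
  have e3 : 0 ≤ rK * √(Imin / 2) := by positivity
  have case1 : r (kstar n) * (θ n (kstar n) - τ * σ) ≤ r k * (θ n k + τ * σ) →
      gap r θ kstar n k ≤ rK * (√(Imin / 2) + 2 * τ * σ) := by
    intro h2
    unfold gap
    nlinarith
  rcases hc with h2 | h2
  · exact case1 h2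
  by_cases h3 : r (kstar n) * (θ n (kstar n) - τ * σ) ≤ r k * (θ n k + τ * σ)
  · exact case1 h3
  push Not at h3
  set x := r (kstar n) * (θ n (kstar n) - τ * σ) / r k
  set p := θ n k + τ * σ
  have hpx : p < x := by rw [lt_div_iff₀ hrk]; linarith
  have hp0 : 0 < p := by have := h1.1; positivity
  have hx1 : x < 1 := by
    by_contra hx
    rw [bernKL, if_neg hpx.ne, if_neg fun hh => hx hh.2] at h2
    exact absurd h2 (by simp)
  rw [bernKL_eq_klR (hp0.trans hpx) hx1, EReal.coe_lt_coe_iff] at h2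
  have h4 := pinsker_of_le hp0.le hpx.le hx1
  have h5 : x - p ≤ √(Imin / 2) := Real.le_sqrt_of_sq_le (by linarith)
  have h6 : r k * x = r (kstar n) * (θ n (kstar n) - τ * σ) := mul_div_cancel₀ _ hrk.ne'
  have h7 : r k * (x - p) ≤ rK * √(Imin / 2) :=
    mul_le_mul hrk' h5 (by linarith) hrK
  have h8 : r k * (x - p) = r (kstar n) * (θ n (kstar n) - τ * σ) - r k * (θ n k + τ * σ) := by
    rw [mul_sub, h6]
  unfold gap
  nlinarith

/-- The regret in confused slots, in the first slots and in clear slots. -/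
theorem IsRun.regret_le [IsProbabilityMeasure μ] (h : IsRun μ rK c σ τ r θ kstar ℱ X sel) :
    regret μ r θ kstar sel T ≤
      rK * (√(Imin / 2) + 2 * τ * σ) *
        ∑ k, ∑ n ∈ confSlots r θ kstar τ σ Imin T k, μ.real {ω | sel n ω = k}
      + K * rK
      + ∑ k, ∑ n ∈ clearSlots r θ kstar τ σ Imin T k,
        gap r θ kstar n k * μ.real {ω | sel n ω = k} := by
  classical
  rw [h.regret_eq, sum_comm, mul_sum]
  have hrK := h.rK_nonneg
  have hτσ := h.τσ_pos
  have hcoef : 0 ≤ rK * (√(Imin / 2) + 2 * τ * σ) := by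
    have := h.σ_pos
    positivity
  set D := rK * (√(Imin / 2) + 2 * τ * σ)
  have h1 : ∀ k : Fin K, ∑ n ∈ Icc 1 T, gap r θ kstar n k * μ.real {ω | sel n ω = k} ≤
      (D * ∑ n ∈ confSlots r θ kstar τ σ Imin T k, μ.real {ω | sel n ω = k})
      + (∑ n ∈ Icc 1 K, rK * μ.real {ω | sel n ω = k})
      + ∑ n ∈ clearSlots r θ kstar τ σ Imin T k,
        gap r θ kstar n k * μ.real {ω | sel n ω = k} := by
    intro k
    have e2 : ∑ n ∈ Icc 1 T, (if n ≤ K then rK * μ.real {ω | sel n ω = k} else 0) ≤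
        ∑ n ∈ Icc 1 K, rK * μ.real {ω | sel n ω = k} := by
      rw [← sum_filter]
      refine sum_le_sum_of_subset_of_nonneg ?_ fun _ _ _ => by positivity
      intro n hn
      rw [mem_filter, mem_Icc] at hn
      rw [mem_Icc]; omega
    refine le_trans ?_ (add_le_add_left (add_le_add_right e2 _) _)
    rw [confSlots, clearSlots, sum_filter, sum_filter, mul_sum, ← sum_add_distrib,
      ← sum_add_distrib]
    refine sum_le_sum fun n hn => ?_
    have hn1 := (mem_Icc.1 hn).1
    set q := μ.real {ω | sel n ω = k}
    have hq : 0 ≤ q := measureReal_nonneg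
    have hg := mul_le_mul_of_nonneg_right (h.gap_le hn1 k) hq
    have hg0 := mul_nonneg (h.gap_nonneg hn1 k) hq
    have hDq : 0 ≤ D * q := mul_nonneg hcoef hq
    have hRq : 0 ≤ rK * q := mul_nonneg hrK hq
    by_cases hk : k = kstar n
    · have : gap r θ kstar n k = 0 := by rw [hk]; simp [gap]
      rw [this]
      simp only [hk, ne_eq, not_true, false_and, and_false, if_false, mul_zero, zero_mul, add_zero,
        zero_add]
      split_ifs <;> simp [hRq]
    by_cases hc : Confused r θ kstar τ σ Imin n k
    · have := mul_le_mul_of_nonneg_right (h.confused_gap_le hn1 hc) hq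
      simp only [ne_eq, hk, not_false_eq_true, hc, and_self, if_true, not_true, and_false, if_false,
        add_zero]
      split_ifs
      · exact this.trans (le_add_of_nonneg_right hRq)
      · rw [add_zero]; exact this
    by_cases hnK : n ≤ K
    · simp [hk, hc, hnK, not_lt.2 hnK]; exact hg
    · simp [hk, hc, hnK, not_le.1 hnK]
  refine (sum_le_sum fun k _ => h1 k).trans ?_
  rw [sum_add_distrib, sum_add_distrib]
  have h2 : ∑ k : Fin K, ∑ n ∈ Icc 1 K, rK * μ.real {ω | sel n ω = k} ≤ K * rK := by
    rw [sum_comm]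
    calc _ = ∑ n ∈ Icc 1 K, rK := by
          refine sum_congr rfl fun n hn => ?_
          rw [← mul_sum, h.model.sum_measureReal_sel (mem_Icc.1 hn).1, mul_one]
      _ = K * rK := by simp
      _ ≤ _ := le_rfl
  linarith

theorem IsRun.abs_θ_sub_le (h : IsRun μ rK c σ τ r θ kstar ℱ X sel) {n t : ℕ}
    (ht : t ∈ Ico (winStart τ n) n) (k : Fin K) : |θ t k - θ n k| ≤ τ * σ := by
  rw [mem_Ico] at ht
  simp only [winStart, max_le_iff] at ht
  have h1 := h.lip k n t (by omega) ht.1.1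
  refine h1.trans ?_
  rw [mul_comm]
  refine mul_le_mul_of_nonneg_right ?_ h.σ_pos.le
  have h2 : (t : ℝ) ≤ n := by exact_mod_cast ht.2.le
  have h3 : (n : ℝ) ≤ t + τ := by exact_mod_cast (by omega)
  rw [abs_le]; constructor <;> linarith

theorem IsRun.θ_le_upMean (h : IsRun μ rK c σ τ r θ kstar ℱ X sel) {n t : ℕ}
    (ht : t ∈ Ico (winStart τ n) n) (k : Fin K) : θ t k ≤ upMean θ τ σ n k := by
  have := (abs_le.1 (h.abs_θ_sub_le ht k)).2
  unfold upMean; linarith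

theorem IsRun.le_θ (h : IsRun μ rK c σ τ r θ kstar ℱ X sel) {n t : ℕ}
    (ht : t ∈ Ico (winStart τ n) n) (k : Fin K) : θ n k - τ * σ ≤ θ t k := by
  have := (abs_le.1 (h.abs_θ_sub_le ht k)).1
  linarith

theorem IsRun.upMean_pos (h : IsRun μ rK c σ τ r θ kstar ℱ X sel) {n : ℕ} (hn : 1 ≤ n)
    (k : Fin K) : 0 < upMean θ τ σ n k := by
  have := (h.mem n k hn).1
  have := h.τσ_pos
  unfold upMean; linarith

theorem IsRun.mul_needMean (h : IsRun μ rK c σ τ r θ kstar ℱ X sel) (n : ℕ) (k : Fin K) :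
    r k * needMean r θ kstar τ σ n k = r (kstar n) * (θ n (kstar n) - τ * σ) :=
  mul_div_cancel₀ _ (h.r_pos k).ne'

theorem IsRun.gap_eq (h : IsRun μ rK c σ τ r θ kstar ℱ X sel) (n : ℕ) (k : Fin K) :
    gap r θ kstar n k = r k * (needMean r θ kstar τ σ n k - upMean θ τ σ n k)
      + (r (kstar n) + r k) * (τ * σ) := by
  rw [mul_sub, h.mul_needMean]
  unfold gap upMean; ring

theorem IsRun.gap_le_of_le (h : IsRun μ rK c σ τ r θ kstar ℱ X sel) (n : ℕ) (k : Fin K) {d s : ℝ}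
    (hd : needMean r θ kstar τ σ n k - upMean θ τ σ n k ≤ d) (hd0 : 0 ≤ d) (hs : τ * σ ≤ s) :
    gap r θ kstar n k ≤ rK * (d + 2 * s) := by
  rw [h.gap_eq]
  have h1 := h.r_le k
  have h2 := h.r_le (kstar n)
  have h3 := h.τσ_pos
  have h4 := h.rK_nonneg
  calc _ ≤ r k * d + (r (kstar n) + r k) * (τ * σ) := by
        have := mul_le_mul_of_nonneg_left hd (h.r_pos k).le
        linarith
    _ ≤ rK * d + (rK + rK) * s := by
        have := mul_le_mul_of_nonneg_right h1 hd0
        have : (r (kstar n) + r k) * (τ * σ) ≤ (rK + rK) * s := by gcongr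
        linarith
    _ = _ := by ring

theorem IsRun.not_confused (h : IsRun μ rK c σ τ r θ kstar ℱ X sel) {n : ℕ} (hn : 1 ≤ n)
    {k : Fin K} (hc : ¬ Confused r θ kstar τ σ Imin n k) :
    upMean θ τ σ n k < needMean r θ kstar τ σ n k ∧
    (needMean r θ kstar τ σ n k < 1 →
      Imin ≤ klR (upMean θ τ σ n k) (needMean r θ kstar τ σ n k)) := by
  unfold Confused at hc
  push Not at hc
  have h1 : upMean θ τ σ n k < needMean r θ kstar τ σ n k := by
    unfold needMean upMean
    rw [lt_div_iff₀ (h.r_pos k)]; linarith [hc.1]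
  refine ⟨h1, fun hx => ?_⟩
  have h2 : (Imin : EReal) ≤ bernKL (upMean θ τ σ n k) (needMean r θ kstar τ σ n k) := hc.2
  rwa [bernKL_eq_klR ((h.upMean_pos hn k).trans h1) hx, EReal.coe_le_coe_iff] at h2

/-- The drift bounds separate k from the rate best in slot n throughout the window. Hence each slot
of the window of a clear slot is itself initial, confused or clear for k. -/
theorem IsRun.ne_kstar_of_not_confused (h : IsRun μ rK c σ τ r θ kstar ℱ X sel) {n t : ℕ}
    (hn : 1 ≤ n) {k : Fin K} (hc : ¬ Confused r θ kstar τ σ Imin n k)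
    (ht : t ∈ Ico (winStart τ n) n) : k ≠ kstar t := by
  intro hk
  have ht1 : 1 ≤ t := by
    rw [mem_Ico] at ht; exact (le_max_left _ _).trans ht.1
  have h1 := (h.not_confused hn hc).1
  have h2 := mul_lt_mul_of_pos_left h1 (h.r_pos k)
  rw [h.mul_needMean] at h2
  have h3 := h.best t ht1 (kstar n)
  rw [← hk] at h3
  have h4 := mul_le_mul_of_nonneg_left (h.le_θ ht (kstar n)) (h.r_pos (kstar n)).le
  have h5 := mul_le_mul_of_nonneg_left (h.θ_le_upMean ht k) (h.r_pos k).le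
  linarith

theorem IsRun.klIndex_kstar_le (h : IsRun μ rK c σ τ r θ kstar ℱ X sel) {n : ℕ}
    (hn : K < n) {k : Fin K} {ω : Ω} (hω : sel n ω = k) :
    klIndex r c τ X sel n (kstar n) ω ≤ klIndex r c τ X sel n k ω := by
  have := (h.alg ω n (by omega)).2 hn (kstar n)
  rwa [hω] at this

/-- If the best index exceeds r_k x, so does the index of k. With at least l samples and an
empirical mean below p, the count times the divergence to x would exceed l KL(p, x), hence the
exploration level. The numbers p and x are left free in order to create margins later. -/
theorem IsRun.sel_prob_le [IsProbabilityMeasure μ] (h : IsRun μ rK c σ τ r θ kstar ℱ X sel) {n : ℕ}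
    (hn : K < n) {k : Fin K} {x p l : ℝ} (hp : 0 < p) (hpx : p < x) (hx : x < 1) (hl : 0 < l)
    (hkl : explorationLevel c τ ≤ l * klR p x) :
    μ.real {ω | sel n ω = k} ≤ μ.real {ω | klIndex r c τ X sel n (kstar n) ω ≤ r k * x}
      + μ.real {ω | sel n ω = k ∧ (selCount sel k (winStart τ n) n ω : ℝ) < l}
      + μ.real {ω | sel n ω = k ∧ l ≤ selCount sel k (winStart τ n) n ω ∧
        (selCount sel k (winStart τ n) n ω : ℝ) * p ≤ succCount X sel k (winStart τ n) n ω} := by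
  refine (measureReal_mono ?_).trans
    ((measureReal_union_le _ _).trans (add_le_add_left (measureReal_union_le _ _) _))
  intro ω hω
  have hω : sel n ω = k := hω
  by_cases h1 : klIndex r c τ X sel n (kstar n) ω ≤ r k * x
  · exact Or.inl (Or.inl h1)
  by_cases h2 : (selCount sel k (winStart τ n) n ω : ℝ) < l
  · exact Or.inl (Or.inr ⟨hω, h2⟩)
  refine Or.inr ⟨hω, not_lt.1 h2, ?_⟩
  push Not at h1 h2
  have h3 := h1.trans_le (h.klIndex_kstar_le hn hω)
  have hN' : (0 : ℝ) < selCount sel k (winStart τ n) n ω := hl.trans_le h2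
  have hN : 0 < selCount sel k (winStart τ n) n ω := by exact_mod_cast hN'
  have h4 := kl_le_of_lt_klIndex (h.r_pos k) (hp.trans hpx) h3 hN
  set N := selCount sel k (winStart τ n) n ω
  set S := succCount X sel k (winStart τ n) n ω
  rw [mul_comm, ← le_div_iff₀ hN']
  by_contra hlt
  push Not at hlt
  have h5 := h4 (hlt.trans hpx)
  have hμ0 : (0 : ℝ) ≤ S / N := by positivity
  have h6 := klR_strictAnti_left hμ0 hlt hpx.le hx
  have h7 := klR_nonneg hp.le (by linarith) (hp.trans hpx) hx
  have h8 : l * klR p x ≤ N * klR p x := by gcongr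
  have h9 := mul_lt_mul_of_pos_left h6 hN'
  linarith

end Regret


/-! ### Elementary facts on the exploration level -/

theorem exists_rpow_le_mul_exp_half (s : ℝ) :
    ∃ C : ℝ, 0 < C ∧ ∀ L : ℝ, 1 ≤ L → L ^ s ≤ C * Real.exp (L / 2) := by
  set N := ⌈s⌉₊
  refine ⟨2 ^ N * N.factorial, by positivity, fun L hL => ?_⟩
  have h1 : L ^ s ≤ L ^ N := by
    rw [← Real.rpow_natCast]
    exact Real.rpow_le_rpow_of_exponent_le hL (Nat.le_ceil s)
  have h2 := Real.pow_div_factorial_le_exp (L / 2) (by linarith) N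
  rw [div_le_iff₀ (by positivity), div_pow, div_le_iff₀ (by positivity)] at h2
  linarith

theorem one_lt_log_of_three_le {τ : ℕ} (hτ : 3 ≤ τ) : 1 < Real.log τ := by
  have h3 : (3 : ℝ) ≤ τ := by exact_mod_cast hτ
  rw [Real.lt_log_iff_exp_lt (by linarith)]
  exact Real.exp_one_lt_three.trans_le h3

theorem log_le_explorationLevel {c : ℝ} (hc : 0 < c) {τ : ℕ} (hτ : 3 ≤ τ) :
    Real.log τ ≤ explorationLevel c τ := by
  have := Real.log_pos (one_lt_log_of_three_le hτ)
  unfold explorationLevel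
  nlinarith

theorem one_lt_explorationLevel {c : ℝ} (hc : 0 < c) {τ : ℕ} (hτ : 3 ≤ τ) :
    1 < explorationLevel c τ :=
  (one_lt_log_of_three_le hτ).trans_le (log_le_explorationLevel hc hτ)

theorem exp_explorationLevel {c : ℝ} {τ : ℕ} (hτ : 3 ≤ τ) :
    Real.exp (explorationLevel c τ) = τ * Real.log τ ^ c := by
  have h1 := one_lt_log_of_three_le hτ
  have h3 : (3 : ℝ) ≤ τ := by exact_mod_cast hτ
  rw [explorationLevel, Real.exp_add, Real.exp_log (by linarith),
    Real.rpow_def_of_pos (by linarith), mul_comm c]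

/-- Exchanges 1/τ for e^(-L) at the price of a power of L, which e^(L/2) absorbs. -/
theorem one_div_le_rpow_mul_exp_neg {c : ℝ} (hc : 0 < c) {τ : ℕ} (hτ : 3 ≤ τ) :
    1 / (τ : ℝ) ≤ explorationLevel c τ ^ c * Real.exp (-explorationLevel c τ) := by
  have h1 := one_lt_log_of_three_le hτ
  have h3 : (3 : ℝ) ≤ τ := by exact_mod_cast hτ
  have h4 : Real.log τ ^ c ≤ explorationLevel c τ ^ c :=
    Real.rpow_le_rpow (by linarith) (log_le_explorationLevel hc hτ) hc.le
  have h5 : 0 < Real.log τ ^ c := Real.rpow_pos_of_pos (by linarith) c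
  rw [Real.exp_neg, exp_explorationLevel hτ, ← div_eq_mul_inv, div_le_div_iff₀ (by linarith)
    (by positivity)]
  nlinarith

/-! ### Selection probabilities in clear slots, and the case g₀ε² ≤ 1/2 -/

section Run

variable {Ω : Type*} [mΩ : MeasurableSpace Ω] {μ : Measure Ω} {K : ℕ}
  {ℱ : Filtration ℕ mΩ} {θ : ℕ → Fin K → ℝ} {X : ℕ → Ω → Fin K → Bool} {sel : ℕ → Ω → Fin K}
  {rK c σ Imin : ℝ} {τ T : ℕ} {r : Fin K → ℝ} {kstar : ℕ → Fin K}

/-- Bound for the probability that the index of the best rate is too small. -/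
def underProb (c : ℝ) (τ : ℕ) : ℝ :=
  Real.exp (2 - explorationLevel c τ) * ((explorationLevel c τ + 1) * explorationLevel c τ + 2)

theorem IsRun.klIndex_kstar_prob_le [IsProbabilityMeasure μ]
    (h : IsRun μ rK c σ τ r θ kstar ℱ X sel) {n : ℕ} (hn : 1 ≤ n) {y : ℝ} (hy : 0 < y)
    (hyv : y ≤ r (kstar n) * (θ n (kstar n) - τ * σ)) :
    μ.real {ω | klIndex r c τ X sel n (kstar n) ω ≤ y} ≤ underProb c τ := by
  have hr := h.r_pos (kstar n)
  have hv : 0 < y / r (kstar n) := by positivity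
  have hvle : y / r (kstar n) ≤ θ n (kstar n) - τ * σ := by
    rw [div_le_iff₀ hr]; linarith
  have hv1 : y / r (kstar n) < 1 := by
    linarith [(h.mem n (kstar n) hn).2, h.τσ_pos]
  have hL := one_lt_explorationLevel h.c_pos h.three_le
  have := h.model.measureReal_klIndex_le h.mem hr hv hv1
    (fun t ht => hvle.trans (h.le_θ ht (kstar n))) (by have := h.three_le; omega) hL
  rw [mul_div_cancel₀ _ hr.ne'] at this
  refine this.trans ?_
  unfold underProb
  gcongr
  exact log_le_explorationLevel h.c_pos h.three_le

/-- A rate whose reward is certainly below the best one is only selected when the index of the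
best rate is too small. -/
theorem IsRun.sel_subset_of_one_le (h : IsRun μ rK c σ τ r θ kstar ℱ X sel) {n : ℕ}
    (hn : K < n) (k : Fin K) :
    {ω | sel n ω = k} ⊆ {ω | klIndex r c τ X sel n (kstar n) ω ≤ r k} := by
  intro ω hω
  exact (h.klIndex_kstar_le hn hω).trans (klIndex_le (h.r_pos k))

theorem IsRun.r_le_of_one_le (h : IsRun μ rK c σ τ r θ kstar ℱ X sel) {n : ℕ} {k : Fin K}
    (hx : 1 ≤ needMean r θ kstar τ σ n k) :
    r k ≤ r (kstar n) * (θ n (kstar n) - τ * σ) := by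
  rw [← h.mul_needMean]
  nlinarith [h.r_pos k]

theorem IsRun.sel_prob_le_of_one_le [IsProbabilityMeasure μ]
    (h : IsRun μ rK c σ τ r θ kstar ℱ X sel) {n : ℕ}
    (hn : K < n) {k : Fin K} (hx : 1 ≤ needMean r θ kstar τ σ n k) :
    μ.real {ω | sel n ω = k} ≤ underProb c τ :=
  (measureReal_mono (h.sel_subset_of_one_le hn k)).trans
    (h.klIndex_kstar_prob_le (by omega) (h.r_pos k) (h.r_le_of_one_le hx))

theorem underProb_nonneg (hc : 0 < c) (hτ : 3 ≤ τ) : 0 ≤ underProb c τ := by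
  have := one_lt_explorationLevel hc hτ
  unfold underProb
  positivity

theorem mem_clearSlots {n : ℕ} {k : Fin K} :
    n ∈ clearSlots r θ kstar τ σ Imin T k ↔
      (1 ≤ n ∧ n ≤ T) ∧ K < n ∧ k ≠ kstar n ∧ ¬ Confused r θ kstar τ σ Imin n k := by
  classical
  simp [clearSlots]

theorem mem_confSlots {n : ℕ} {k : Fin K} :
    n ∈ confSlots r θ kstar τ σ Imin T k ↔
      (1 ≤ n ∧ n ≤ T) ∧ k ≠ kstar n ∧ Confused r θ kstar τ σ Imin n k := by
  classical
  simp [confSlots]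

theorem clearSlots_subset (k : Fin K) : clearSlots r θ kstar τ σ Imin T k ⊆ Icc 1 T :=
  fun _ hn => mem_Icc.2 (mem_clearSlots.1 hn).1

theorem confSlots_subset (k : Fin K) : confSlots r θ kstar τ σ Imin T k ⊆ Icc 1 T :=
  fun _ hn => mem_Icc.2 (mem_confSlots.1 hn).1

theorem IsRun.overestimate_prob_le [IsProbabilityMeasure μ]
    (h : IsRun μ rK c σ τ r θ kstar ℱ X sel) {n : ℕ} (hn : 1 ≤ n) {k : Fin K} {z l : ℝ}
    (hl : 0 < l) (hz : upMean θ τ σ n k < z) (hz1 : z < 1) :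
    μ.real {ω | sel n ω = k ∧ l ≤ selCount sel k (winStart τ n) n ω ∧
        (selCount sel k (winStart τ n) n ω : ℝ) * z ≤ succCount X sel k (winStart τ n) n ω}
      ≤ Real.exp (-(l * klR z (upMean θ τ σ n k))) := by
  have hp := h.upMean_pos (σ := σ) (τ := τ) hn k
  set p := upMean θ τ σ n k
  have hp1 : p < 1 := hz.trans hz1
  have hz0 : 0 < z := hp.trans hz
  refine h.model.measureReal_logLik_le h.mem k (le_max_left 1 (n - τ)) hp hp1 hz0 hz1
    (n := n) (fun t ht => mul_nonpos_of_nonpos_of_nonneg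
      (sub_nonpos.2 (h.θ_le_upMean ht k)) (by linarith)) ?_
  rintro ω ⟨-, h1, h2⟩
  have hSN := succCount_le X sel k (winStart τ n) n ω
  have hN' : (0 : ℝ) < selCount sel k (winStart τ n) n ω := hl.trans_le h1
  have hN : 0 < selCount sel k (winStart τ n) n ω := by exact_mod_cast hN'
  set N := selCount sel k (winStart τ n) n ω
  set S := succCount X sel k (winStart τ n) n ω
  have hSN' : (S : ℝ) ≤ N := by exact_mod_cast hSN
  rw [logLik_eq hSN hN hp hp1 hz0 hz1]
  have hμ1 : (S : ℝ) / N ≤ 1 := (div_le_one hN').2 hSN'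
  have hμz : z ≤ (S : ℝ) / N := by rw [le_div_iff₀ hN']; linarith
  have h3 := klR_add_klR_le (μ := 1 - (S : ℝ) / N) (z := 1 - z) (v := 1 - p) (by linarith)
    (by linarith) (by linarith) (by linarith) (by linarith)
  rw [klR_one_sub, klR_one_sub, klR_one_sub] at h3
  have h4 := klR_nonneg hz0.le hz1.le hp hp1
  calc l * klR z p ≤ N * klR z p := by gcongr
    _ ≤ _ := by gcongr; linarith

/-- The mean is split at the midpoint z of p and x. KL(p, x) ≤ 8 KL(z, x) explains the 8 in the
number of samples. By Pinsker and the χ² bound, KL(z, p) ≥ (x - p)²/2 ≥ KL(p, x) x(1 - x)/2 ≥ Imin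
g, and the summand ε² then yields the exponent of the last term. -/
theorem IsRun.clear_sel_prob_le [IsProbabilityMeasure μ]
    (h : IsRun μ rK c σ τ r θ kstar ℱ X sel) (hI : 0 < Imin) {ε g : ℝ} (hε : 0 < ε)
    (hg0 : 0 < g)
    (hg : ∀ n k, 1 ≤ n → n ≤ T → k ≠ kstar n → needMean r θ kstar τ σ n k < 1 →
      2 * g ≤ needMean r θ kstar τ σ n k * (1 - needMean r θ kstar τ σ n k))
    {n : ℕ} {k : Fin K} (hn : n ∈ clearSlots r θ kstar τ σ Imin T k) :
    μ.real {ω | sel n ω = k} ≤ underProb c τ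
      + μ.real {ω | sel n ω = k ∧ (selCount sel k (winStart τ n) n ω : ℝ) <
          (8 + ε ^ 2) * explorationLevel c τ / Imin}
      + Real.exp (-(explorationLevel c τ * (g * ε ^ 2))) := by
  obtain ⟨⟨hn1, hnT⟩, hnK, hkn, hc⟩ := mem_clearSlots.1 hn
  obtain ⟨hpx, hkl⟩ := h.not_confused hn1 hc
  have hL := one_lt_explorationLevel h.c_pos h.three_le
  have hp := h.upMean_pos (σ := σ) (τ := τ) hn1 k
  by_cases hx : 1 ≤ needMean r θ kstar τ σ n k
  · have := h.sel_prob_le_of_one_le hnK hx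
    have h1 : 0 ≤ μ.real {ω | sel n ω = k ∧ (selCount sel k (winStart τ n) n ω : ℝ) <
          (8 + ε ^ 2) * explorationLevel c τ / Imin} := measureReal_nonneg
    have h2 := Real.exp_pos (-(explorationLevel c τ * (g * ε ^ 2)))
    linarith
  push Not at hx
  have hkl := hkl hx
  have hgx := hg n k hn1 hnT hkn hx
  have hy := h.mul_needMean (σ := σ) (τ := τ) (kstar := kstar) n k
  set x := needMean r θ kstar τ σ n k
  set p := upMean θ τ σ n k
  set L := explorationLevel c τ
  have hx0 : 0 < x := hp.trans hpx
  set l := (8 + ε ^ 2) * L / Imin with hl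
  have hl0 : 0 < l := by positivity
  have hlI : l * Imin = (8 + ε ^ 2) * L := by rw [hl]; field_simp
  set z := (p + x) / 2 with hz
  have h8 := klR_le_eight_mul_midpoint hp.le (by linarith) hx0 hx
  have h1 := h.sel_prob_le (k := k) (l := l) (x := x) (p := z) hnK (by linarith) (by linarith) hx hl0 (by
    have h2 : l * Imin ≤ l * klR p x := by gcongr
    have h3 : l * klR p x ≤ l * (8 * klR z x) := by gcongr
    nlinarith [sq_nonneg ε])
  have h2 := h.klIndex_kstar_prob_le hn1 (y := r k * x) (by have := h.r_pos k; positivity) hy.le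
  have h3 := h.overestimate_prob_le hn1 hl0 (show p < z by linarith) (show z < 1 by linarith)
  refine h1.trans (add_le_add (add_le_add_left h2 _) (h3.trans ?_))
  rw [Real.exp_le_exp, neg_le_neg_iff]
  have h4 := pinsker_of_ge hp (show p ≤ z by linarith) (by linarith)
  have h5 := klR_le_chiSq hp.le (by linarith) hx0 hx
  rw [le_div_iff₀ (mul_pos hx0 (by linarith))] at h5
  have h6 : 2 * (z - p) ^ 2 = (p - x) ^ 2 / 2 := by rw [hz]; ring
  have h7 : Imin * g ≤ klR z p := by
    have e1 : Imin * (2 * g) ≤ klR p x * (x * (1 - x)) :=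
      mul_le_mul hkl hgx (by positivity) (hI.le.trans hkl)
    linarith
  calc L * (g * ε ^ 2) ≤ (8 + ε ^ 2) * L * g := by nlinarith [mul_pos (show 0 < L by linarith) hg0]
    _ = l * (Imin * g) := by rw [← hlI]; ring
    _ ≤ l * klR z p := by gcongr

/-- Regret bound when the last term of the theorem dominates the second one. -/
theorem IsRun.regret_div_le_of_small [IsProbabilityMeasure μ]
    (h : IsRun μ rK c σ τ r θ kstar ℱ X sel) (hI : 0 < Imin) {ε g : ℝ} (hε : 0 < ε)
    (hg0 : 0 < g) (hgε : g * ε ^ 2 ≤ 1 / 2) (hτT : τ ≤ T)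
    (hg : ∀ n k, 1 ≤ n → n ≤ T → k ≠ kstar n → needMean r θ kstar τ σ n k < 1 →
      2 * g ≤ needMean r θ kstar τ σ n k * (1 - needMean r θ kstar τ σ n k))
    {C₁ C₂ : ℝ} (hC₁ : 0 ≤ C₁) (hC₂ : 0 ≤ C₂)
    (hpow : ∀ L : ℝ, 1 ≤ L → L ^ (2 : ℝ) ≤ C₁ * Real.exp (L / 2))
    (hpow' : ∀ L : ℝ, 1 ≤ L → L ^ (1 + c) ≤ C₂ * Real.exp (L / 2)) :
    regret μ r θ kstar sel T / T ≤
      rK * (√(Imin / 2) + 2 * τ * σ) * (confusionCount r θ kstar T Imin τ σ : ℝ) / T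
      + rK * (4 * Real.exp 2 * C₁ + (2 * (8 + ε ^ 2) / Imin + 3) * C₂ + 1) * K /
        Real.exp (explorationLevel c τ * (g * ε ^ 2)) := by
  have hL := one_lt_explorationLevel h.c_pos h.three_le
  have hτ3 : (3 : ℝ) ≤ τ := by exact_mod_cast h.three_le
  have hT : (τ : ℝ) ≤ T := by exact_mod_cast hτT
  have hrK := h.rK_nonneg
  have hinvτ := one_div_le_rpow_mul_exp_neg h.c_pos h.three_le
  have hP0 := underProb_nonneg h.c_pos h.three_le
  have h0 := h.regret_le (Imin := Imin) (T := T)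
  set L := explorationLevel c τ with hLdef
  set l := (8 + ε ^ 2) * L / Imin with hl
  set e := Real.exp (-(L * (g * ε ^ 2))) with he
  have he0 : 0 < e := Real.exp_pos _
  have hcoef : 0 ≤ rK * (√(Imin / 2) + 2 * τ * σ) := by
    have := h.σ_pos
    positivity
  have hcl : ∀ k, ∑ n ∈ clearSlots r θ kstar τ σ Imin T k,
      gap r θ kstar n k * μ.real {ω | sel n ω = k}
      ≤ rK * (T * underProb c τ + ((T : ℝ) / τ + 1) * (l + 1) + T * e) := by
    intro k
    have h1 : ∑ n ∈ clearSlots r θ kstar τ σ Imin T k,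
      gap r θ kstar n k * μ.real {ω | sel n ω = k} ≤
      ∑ n ∈ clearSlots r θ kstar τ σ Imin T k, rK * (underProb c τ
      + μ.real {ω | sel n ω = k ∧ (selCount sel k (winStart τ n) n ω : ℝ) < l} + e) := by
      refine sum_le_sum fun n hn => ?_
      have hn1 := (mem_clearSlots.1 hn).1.1
      exact mul_le_mul (h.gap_le hn1 k) (h.clear_sel_prob_le hI hε hg0 hg hn)
        measureReal_nonneg hrK
    refine h1.trans ?_
    have h2 : ∑ n ∈ clearSlots r θ kstar τ σ Imin T k, rK * (underProb c τ
      + μ.real {ω | sel n ω = k ∧ (selCount sel k (winStart τ n) n ω : ℝ) < l} + e) ≤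
      ∑ n ∈ Icc 1 T, rK * (underProb c τ
      + μ.real {ω | sel n ω = k ∧ (selCount sel k (winStart τ n) n ω : ℝ) < l} + e) :=
      sum_le_sum_of_subset_of_nonneg (clearSlots_subset k) fun n _ _ => by positivity
    refine h2.trans ?_
    rw [← mul_sum, sum_add_distrib, sum_add_distrib]
    have h3 := h.model.sum_measureReal_selCount_lt_le k (T := T) (τ := τ) (by
      have := h.three_le; omega) (l := l) (by positivity)
    simp only [sum_const, Nat.card_Icc, Nat.add_sub_cancel, nsmul_eq_mul]
    gcongr
  have hconf : ∑ k, ∑ n ∈ confSlots r θ kstar τ σ Imin T k, μ.real {ω | sel n ω = k}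
      ≤ (confusionCount r θ kstar T Imin τ σ : ℝ) := by
    rw [confusionCount_eq]
    push_cast
    refine sum_le_sum fun k _ => ?_
    calc _ ≤ ∑ n ∈ confSlots r θ kstar τ σ Imin T k, (1 : ℝ) :=
          sum_le_sum fun n _ => measureReal_le_one
      _ = _ := by simp
  have h1 : regret μ r θ kstar sel T ≤
      rK * (√(Imin / 2) + 2 * τ * σ) * (confusionCount r θ kstar T Imin τ σ : ℝ)
      + K * rK + K * (rK * (T * underProb c τ + ((T : ℝ) / τ + 1) * (l + 1) + T * e)) := by
    refine h0.trans ?_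
    have h2 := sum_le_sum fun k (_ : k ∈ (univ : Finset (Fin K))) => hcl k
    rw [sum_const, card_univ, Fintype.card_fin, nsmul_eq_mul] at h2
    have h3 := mul_le_mul_of_nonneg_left hconf hcoef
    linarith
  -- Here gε² ≤ 1/2 enters: a power of L times e^(-L) is at most a constant times e^(-L/2), hence
  -- absorbed by e.
  have hhalf : Real.exp (-(L / 2)) ≤ e := by
    rw [he, Real.exp_le_exp, neg_le_neg_iff]; nlinarith
  have hexp : Real.exp (L / 2) * Real.exp (-L) = Real.exp (-(L / 2)) := by
    rw [← Real.exp_add]; ring_nf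
  have hunder : underProb c τ ≤ 4 * Real.exp 2 * C₁ * e := by
    have h2 : (L + 1) * L + 2 ≤ 4 * L ^ (2 : ℝ) := by
      rw [Real.rpow_two]; nlinarith
    calc underProb c τ = Real.exp 2 * Real.exp (-L) * ((L + 1) * L + 2) := by
          rw [underProb, ← Real.exp_add]; rfl
      _ ≤ Real.exp 2 * Real.exp (-L) * (4 * (C₁ * Real.exp (L / 2))) := by
          gcongr; exact h2.trans (by linarith [hpow L hL.le])
      _ = 4 * Real.exp 2 * C₁ * (Real.exp (L / 2) * Real.exp (-L)) := by ring
      _ ≤ _ := by rw [hexp]; gcongr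
  have hinv : (2 * (l + 1) + 1) * (1 / τ) ≤ (2 * (8 + ε ^ 2) / Imin + 3) * C₂ * e := by
    have h2 : 2 * (l + 1) + 1 ≤ (2 * (8 + ε ^ 2) / Imin + 3) * L := by
      rw [hl]
      have : 2 * ((8 + ε ^ 2) * L / Imin + 1) + 1 = 2 * (8 + ε ^ 2) / Imin * L + 3 := by ring
      rw [this]; nlinarith
    have h3 : L * L ^ c = L ^ (1 + c) := by
      rw [Real.rpow_add (by linarith), Real.rpow_one]
    calc _ ≤ (2 * (8 + ε ^ 2) / Imin + 3) * L * (L ^ c * Real.exp (-L)) := by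
          gcongr
      _ = (2 * (8 + ε ^ 2) / Imin + 3) * L ^ (1 + c) * Real.exp (-L) := by rw [← h3]; ring
      _ ≤ (2 * (8 + ε ^ 2) / Imin + 3) * (C₂ * Real.exp (L / 2)) * Real.exp (-L) := by
          gcongr; exact hpow' L hL.le
      _ = (2 * (8 + ε ^ 2) / Imin + 3) * C₂ * (Real.exp (L / 2) * Real.exp (-L)) := by ring
      _ ≤ _ := by rw [hexp]; gcongr
  have hTpos : (0 : ℝ) < T := by linarith
  have hτpos : (0 : ℝ) < τ := by linarith
  rw [div_le_iff₀ hTpos, add_mul, div_mul_cancel₀ _ hTpos.ne']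
  refine h1.trans ?_
  rw [add_assoc]
  gcongr
  have e1 : rK * (4 * Real.exp 2 * C₁ + (2 * (8 + ε ^ 2) / Imin + 3) * C₂ + 1) * K /
        Real.exp (L * (g * ε ^ 2)) * T
      = K * rK * T * (4 * Real.exp 2 * C₁ * e + (2 * (8 + ε ^ 2) / Imin + 3) * C₂ * e + e) := by
    rw [he, Real.exp_neg]; field_simp
  rw [e1]
  have e2 : (1 : ℝ) + (T * underProb c τ + ((T : ℝ) / τ + 1) * (l + 1) + T * e)
      ≤ T * (4 * Real.exp 2 * C₁ * e + (2 * (8 + ε ^ 2) / Imin + 3) * C₂ * e + e) := by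
    have h2 : (1 : ℝ) ≤ T / τ := (one_le_div hτpos).2 hT
    have h3 : (1 : ℝ) + ((T : ℝ) / τ + 1) * (l + 1) ≤ T * ((2 * (l + 1) + 1) * (1 / τ)) := by
      have : T * ((2 * (l + 1) + 1) * (1 / τ)) = T / τ * (2 * (l + 1) + 1) := by ring
      rw [this]
      have hl0 : 0 ≤ l := by positivity
      nlinarith
    have h4 := mul_le_mul_of_nonneg_left hinv hTpos.le
    have h5 := mul_le_mul_of_nonneg_left hunder hTpos.le
    linarith
  have e3 := mul_le_mul_of_nonneg_left e2 (show 0 ≤ K * rK by positivity)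
  calc _ = K * rK * (1 + (T * underProb c τ + ((T : ℝ) / τ + 1) * (l + 1) + T * e)) := by ring
    _ ≤ _ := e3
    _ = _ := by ring

end Run


/-! ### Rates which can be tested reliably -/

/-- If every window contains few elements of `G`, then so does the union of the windows. -/
theorem card_biUnion_window_inter_le {τ T : ℕ} (hτ : 1 ≤ τ) {A G : Finset ℕ} (hA : A ⊆ Icc 1 T)
    {m : ℝ} (hm : 0 ≤ m) (hcard : ∀ n ∈ A, (#((Ico (winStart τ n) n).filter (· ∈ G)) : ℝ) ≤ m) :
    (#((A.biUnion fun n => Ico (winStart τ n) n).filter (· ∈ G)) : ℝ)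
      ≤ ((T : ℝ) / τ + 1) * (2 * m) := by
  classical
  set U := A.biUnion fun n => Ico (winStart τ n) n with hU
  have hUT : U.filter (· ∈ G) ⊆ Icc 1 T := by
    intro u hu
    rw [mem_filter, hU, mem_biUnion] at hu
    obtain ⟨⟨n, hn, hun⟩, -⟩ := hu
    rw [mem_Ico] at hun
    have h1 := mem_Icc.1 (hA hn)
    rw [mem_Icc]
    exact ⟨(le_max_left _ _).trans hun.1, by omega⟩
  have h := sum_Icc_le_of_block_le (f := fun u => if u ∈ U.filter (· ∈ G) then (1 : ℝ) else 0)
    (fun u => by positivity) hτ (M := 2 * m) (by positivity) (fun i => ?_) T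
  · refine le_trans (le_of_eq ?_) h
    rw [← sum_filter, sum_const, nsmul_eq_mul, mul_one]
    congr 2
    ext u
    simp only [mem_filter (s := Icc 1 T)]
    exact ⟨fun hu => ⟨hUT hu, hu⟩, fun hu => hu.2⟩
  · set b := 1 + i * τ
    set B := (Ico b (b + τ)).filter (· ∈ U.filter (· ∈ G)) with hB
    rw [← sum_filter, sum_const, nsmul_eq_mul, mul_one]
    -- Windows of slots n < b + τ meet the block inside the window of the largest such n, the others
    -- inside the window of the smallest remaining n; hence the bound 2m per block.
    set B₁ := B.filter fun u => ∃ n ∈ A, u ∈ Ico (winStart τ n) n ∧ n < b + τ with hB₁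
    set B₂ := B.filter fun u => ∃ n ∈ A, u ∈ Ico (winStart τ n) n ∧ b + τ ≤ n with hB₂
    have hsub : B ⊆ B₁ ∪ B₂ := by
      intro u hu
      have hu' := (mem_filter.1 (mem_filter.1 hu).2).1
      rw [hU, mem_biUnion] at hu'
      obtain ⟨n, hn, hun⟩ := hu'
      rcases lt_or_ge n (b + τ) with hnb | hnb
      · exact mem_union_left _ (mem_filter.2 ⟨hu, n, hn, hun, hnb⟩)
      · exact mem_union_right _ (mem_filter.2 ⟨hu, n, hn, hun, hnb⟩)
    have h1 : (#B₁ : ℝ) ≤ m := by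
      by_cases hne : (A.filter fun n => n < b + τ).Nonempty
      · obtain ⟨N, hN, hmax⟩ := exists_max_image _ id hne
        rw [mem_filter] at hN
        refine le_trans ?_ (hcard N hN.1)
        refine Nat.cast_le.2 (card_le_card ?_)
        intro u hu
        obtain ⟨huB, n, hn, hun, hnb⟩ := mem_filter.1 hu
        obtain ⟨hub, huG⟩ := mem_filter.1 huB
        refine mem_filter.2 ⟨?_, (mem_filter.1 huG).2⟩
        have h3 : n ≤ N := hmax n (mem_filter.2 ⟨hn, hnb⟩)
        simp only [mem_Ico, winStart, max_le_iff] at hun hub ⊢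
        omega
      · have : B₁ = ∅ := by
          rw [eq_empty_iff_forall_notMem]
          intro u hu
          obtain ⟨-, n, hn, -, hnb⟩ := mem_filter.1 hu
          exact hne ⟨n, mem_filter.2 ⟨hn, hnb⟩⟩
        rw [this]; simpa using hm
    have h2 : (#B₂ : ℝ) ≤ m := by
      by_cases hne : (A.filter fun n => b + τ ≤ n).Nonempty
      · obtain ⟨N, hN, hmin⟩ := exists_min_image _ id hne
        rw [mem_filter] at hN
        refine le_trans ?_ (hcard N hN.1)
        refine Nat.cast_le.2 (card_le_card ?_)
        intro u hu
        obtain ⟨huB, n, hn, hun, hnb⟩ := mem_filter.1 hu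
        obtain ⟨hub, huG⟩ := mem_filter.1 huB
        refine mem_filter.2 ⟨?_, (mem_filter.1 huG).2⟩
        have h3 : N ≤ n := hmin n (mem_filter.2 ⟨hn, hnb⟩)
        simp only [mem_Ico, winStart, max_le_iff] at hun hub ⊢
        omega
      · have : B₂ = ∅ := by
          rw [eq_empty_iff_forall_notMem]
          intro u hu
          obtain ⟨-, n, hn, -, hnb⟩ := mem_filter.1 hu
          exact hne ⟨n, mem_filter.2 ⟨hn, hnb⟩⟩
        rw [this]; simpa using hm
    calc (#B : ℝ) ≤ #B₁ + #B₂ := by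
          exact_mod_cast (card_le_card hsub).trans (card_union_le _ _)
      _ ≤ 2 * m := by linarith

section Run

variable {Ω : Type*} [mΩ : MeasurableSpace Ω] {μ : Measure Ω} {K : ℕ}
  {ℱ : Filtration ℕ mΩ} {θ : ℕ → Fin K → ℝ} {X : ℕ → Ω → Fin K → Bool} {sel : ℕ → Ω → Fin K}
  {rK c σ Imin : ℝ} {τ T : ℕ} {r : Fin K → ℝ} {kstar : ℕ → Fin K}

/-- In slot `n` the index of a clearly worse rate `k` exceeds `r k * x` only if `k` was selected
rarely or its mean was overestimated. -/
structure Testable (r : Fin K → ℝ) (θ : ℕ → Fin K → ℝ) (kstar : ℕ → Fin K) (c : ℝ) (τ : ℕ)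
    (σ ζ W l : ℝ) (n : ℕ) (k : Fin K) (x : ℝ) : Prop where
  le_one_sub : upMean θ τ σ n k ≤ 1 - W
  lt : upMean θ τ σ n k + ζ * (1 - upMean θ τ σ n k) < x
  lt_one : x < 1
  le_need : x ≤ needMean r θ kstar τ σ n k
  level_le : explorationLevel c τ ≤
    l * klR (upMean θ τ σ n k + ζ * (1 - upMean θ τ σ n k)) x

theorem Testable.lt_upMean {ζ W l x : ℝ} {n : ℕ} {k : Fin K}
    (ht : Testable r θ kstar c τ σ ζ W l n k x) (hζ : 0 < ζ) (hW : 0 < W) :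
    upMean θ τ σ n k < upMean θ τ σ n k + ζ * (1 - upMean θ τ σ n k) := by
  have := ht.le_one_sub
  have : 0 < ζ * (1 - upMean θ τ σ n k) := mul_pos hζ (by linarith)
  linarith

/-- Selections of a testable rate. -/
theorem IsRun.sel_prob_le_of_testable [IsProbabilityMeasure μ]
    (h : IsRun μ rK c σ τ r θ kstar ℱ X sel) {n : ℕ} (hnK : K < n) {k : Fin K} {ζ W l m₀ x : ℝ}
    (hζ : 0 < ζ) (hW : 0 < W) (hl : 0 < l) (hm₀ : 0 ≤ m₀)
    (ht : Testable r θ kstar c τ σ ζ W l n k x) :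
    μ.real {ω | sel n ω = k} ≤ μ.real {ω | klIndex r c τ X sel n (kstar n) ω ≤ r k * x}
      + μ.real {ω | sel n ω = k ∧ (selCount sel k (winStart τ n) n ω : ℝ) < l}
      + μ.real {ω | sel n ω = k ∧ l ≤ selCount sel k (winStart τ n) n ω ∧
        (selCount sel k (winStart τ n) n ω : ℝ) < m₀ ∧
        (selCount sel k (winStart τ n) n ω : ℝ)
          * (upMean θ τ σ n k + ζ * (1 - upMean θ τ σ n k))
          ≤ succCount X sel k (winStart τ n) n ω}
      + Real.exp (-(m₀ * (W * ζ ^ 2 / 2))) := by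
  have hp := h.upMean_pos (σ := σ) (τ := τ) (show 1 ≤ n by omega) k
  have hpp := ht.lt_upMean hζ hW
  have h1 := h.sel_prob_le (k := k) hnK (hp.trans hpp) ht.lt ht.lt_one hl ht.level_le
  have h2 := h.model.measureReal_overestimate_le h.mem k (le_max_left 1 (n - τ)) hζ.le
    ht.le_one_sub hW.le hm₀ (n := n) (fun t ht => h.θ_le_upMean ht k)
  set p' := upMean θ τ σ n k + ζ * (1 - upMean θ τ σ n k)
  refine h1.trans ?_
  rw [add_assoc _ (μ.real _) (Real.exp _)]
  refine add_le_add_right ?_ _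
  refine le_trans ?_ (add_le_add_right h2 _)
  refine (measureReal_mono ?_).trans (measureReal_union_le _ _)
  rintro ω ⟨h3, h4, h5⟩
  by_cases h6 : m₀ ≤ (selCount sel k (winStart τ n) n ω : ℝ)
  · exact Or.inr ⟨h6, h5⟩
  · exact Or.inl ⟨h3, h4, not_le.1 h6, h5⟩

theorem IsRun.klIndex_prob_le_of_testable [IsProbabilityMeasure μ]
    (h : IsRun μ rK c σ τ r θ kstar ℱ X sel) {n : ℕ} (hn1 : 1 ≤ n) {k : Fin K} {ζ W l x : ℝ}
    (hζ : 0 < ζ) (hW : 0 < W) (ht : Testable r θ kstar c τ σ ζ W l n k x) :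
    μ.real {ω | klIndex r c τ X sel n (kstar n) ω ≤ r k * x} ≤ underProb c τ := by
  have hp := h.upMean_pos (σ := σ) (τ := τ) hn1 k
  have hx : 0 < x := hp.trans ((ht.lt_upMean hζ hW).trans ht.lt)
  refine h.klIndex_kstar_prob_le hn1 (mul_pos (h.r_pos k) hx) ?_
  rw [← h.mul_needMean]
  exact mul_le_mul_of_nonneg_left ht.le_need (h.r_pos k).le

/-- Crude bound for the number of selections of a clearly worse rate. -/
theorem IsRun.sum_clear_sel_le [IsProbabilityMeasure μ]
    (h : IsRun μ rK c σ τ r θ kstar ℱ X sel) {k : Fin K} {ζ W l m₀ : ℝ} {x : ℕ → ℝ}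
    (hζ : 0 < ζ) (hW : 0 < W) (hl : 0 < l) (hlm : l ≤ m₀)
    (ht : ∀ n ∈ clearSlots r θ kstar τ σ Imin T k, 1 ≤ needMean r θ kstar τ σ n k ∨
      Testable r θ kstar c τ σ ζ W l n k (x n)) :
    ∑ n ∈ clearSlots r θ kstar τ σ Imin T k, μ.real {ω | sel n ω = k} ≤
      T * underProb c τ + ((T : ℝ) / τ + 1) * (m₀ + 1)
        + T * Real.exp (-(m₀ * (W * ζ ^ 2 / 2))) := by
  have hP0 := underProb_nonneg h.c_pos h.three_le
  set e := Real.exp (-(m₀ * (W * ζ ^ 2 / 2)))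
  have he : 0 < e := Real.exp_pos _
  have hm₀ : 0 ≤ m₀ := hl.le.trans hlm
  have h1 : ∀ n ∈ clearSlots r θ kstar τ σ Imin T k, μ.real {ω | sel n ω = k} ≤ underProb c τ
      + μ.real {ω | sel n ω = k ∧ (selCount sel k (winStart τ n) n ω : ℝ) < m₀} + e := by
    intro n hn
    obtain ⟨⟨hn1, hnT⟩, hnK, hkn, hc⟩ := mem_clearSlots.1 hn
    rcases ht n hn with hx | hx
    · have := h.sel_prob_le_of_one_le hnK hx
      have h1 : 0 ≤ μ.real {ω | sel n ω = k ∧ (selCount sel k (winStart τ n) n ω : ℝ) < m₀} :=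
        measureReal_nonneg
      linarith
    · have h2 := h.model.measureReal_overestimate_le h.mem k (le_max_left 1 (n - τ)) hζ.le
        hx.le_one_sub hW.le hm₀ (n := n) (fun t ht => h.θ_le_upMean ht k)
      have h3 := h.klIndex_prob_le_of_testable hn1 hζ hW hx
      have hp := h.upMean_pos (σ := σ) (τ := τ) hn1 k
      have h4 := h.sel_prob_le (k := k) (l := m₀) hnK (hp.trans (hx.lt_upMean hζ hW)) hx.lt
        hx.lt_one (hl.trans_le hlm) (hx.level_le.trans (mul_le_mul_of_nonneg_right hlm
          (klR_nonneg (hp.trans (hx.lt_upMean hζ hW)).le (hx.lt.trans hx.lt_one).le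
            (hp.trans ((hx.lt_upMean hζ hW).trans hx.lt)) hx.lt_one)))
      refine h4.trans (add_le_add (add_le_add_left h3 _) (le_trans (measureReal_mono ?_) h2))
      rintro ω ⟨-, h5⟩
      exact h5
  refine (sum_le_sum h1).trans ?_
  refine (sum_le_sum_of_subset_of_nonneg (clearSlots_subset k) fun n _ _ => by positivity).trans ?_
  rw [sum_add_distrib, sum_add_distrib]
  have h3 := h.model.sum_measureReal_selCount_lt_le k (T := T) (τ := τ) (by
    have := h.three_le; omega) (l := m₀) hm₀
  simp only [sum_const, Nat.card_Icc, Nat.add_sub_cancel, nsmul_eq_mul]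
  gcongr

theorem IsRun.sum_init_sel_le [IsProbabilityMeasure μ]
    (h : IsRun μ rK c σ τ r θ kstar ℱ X sel) (k : Fin K) :
    ∑ n ∈ Icc 1 K, μ.real {ω | sel n ω = k} ≤ 1 := by
  calc _ ≤ ∑ n ∈ Icc 1 K, if n = (k : ℕ) + 1 then (1 : ℝ) else 0 := by
        refine sum_le_sum fun n hn => ?_
        rw [mem_Icc] at hn
        split_ifs with hnk
        · exact measureReal_le_one
        · have : {ω | sel n ω = k} = ∅ := by
            rw [Set.eq_empty_iff_forall_notMem]
            intro ω hω
            have hω : sel n ω = k := hω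
            have := (h.alg ω n hn.1).1 hn.2
            rw [hω] at this
            exact hnk this.symm
          rw [this, measureReal_empty]
    _ ≤ 1 := by
        rw [sum_ite_eq']
        split_ifs <;> norm_num

/-- Regret in the slots in which rate `k` can be tested reliably. -/
theorem IsRun.sum_testable_le [IsProbabilityMeasure μ]
    (h : IsRun μ rK c σ τ r θ kstar ℱ X sel) {k : Fin K} {ζ W l m₀ m₁ e : ℝ} {x : ℕ → ℝ}
    {A : Finset ℕ} (hA : A ⊆ clearSlots r θ kstar τ σ Imin T k)
    (hζ : 0 < ζ) (hW : 0 < W) (hl : 0 < l) (hm₀ : 0 ≤ m₀) (hm₁ : m₀ < m₁)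
    (ht : ∀ n ∈ A, Testable r θ kstar c τ σ ζ W l n k (x n))
    (he : ∀ n ∈ A, gap r θ kstar n k *
      μ.real {ω | klIndex r c τ X sel n (kstar n) ω ≤ r k * x n} ≤ rK * e) (he0 : 0 ≤ e) :
    ∑ n ∈ A, gap r θ kstar n k * μ.real {ω | sel n ω = k} ≤
      rK * (T * e + ((T : ℝ) / τ + 1) * (l + 1) + T * Real.exp (-(m₀ * (W * ζ ^ 2 / 2)))
        + (m₀ + 1) / (m₁ - m₀) *
          ∑ n ∈ confSlots r θ kstar τ σ Imin T k, (1 - μ.real {ω | sel n ω = k})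
        + (m₀ + 1) * Real.exp (-(l * (W * ζ ^ 2 / 2))) *
          (((T : ℝ) / τ + 1) * (2 * m₁) + 1 +
            ∑ n ∈ clearSlots r θ kstar τ σ Imin T k, μ.real {ω | sel n ω = k})) := by
  classical
  have hrK := h.rK_nonneg
  have hAT : A ⊆ Icc 1 T := hA.trans (clearSlots_subset k)
  have hτ1 : 1 ≤ τ := by have := h.three_le; omega
  set e₂ := Real.exp (-(m₀ * (W * ζ ^ 2 / 2)))
  have he₂ : 0 < e₂ := Real.exp_pos _
  set G := confSlots r θ kstar τ σ Imin T k with hG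
  set D : ℕ → ℝ := fun n => μ.real {ω | sel n ω = k ∧ l ≤ selCount sel k (winStart τ n) n ω ∧
        (selCount sel k (winStart τ n) n ω : ℝ) < m₀ ∧
        (selCount sel k (winStart τ n) n ω : ℝ)
          * (upMean θ τ σ n k + ζ * (1 - upMean θ τ σ n k))
          ≤ succCount X sel k (winStart τ n) n ω} with hD
  -- In `A₁` the window has at least m₁ confused slots while the event `D` allows fewer than m₀
  -- selections, so unselected confused slots pay. In `A₂` the windows contain few confused slots,
  -- and the selections there are essentially the clear ones.
  set A₁ := A.filter fun n => m₁ ≤ #((Ico (winStart τ n) n).filter (· ∈ G)) with hA₁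
  set A₂ := A.filter fun n => ¬ m₁ ≤ #((Ico (winStart τ n) n).filter (· ∈ G)) with hA₂
  have hpt : ∀ n ∈ A, gap r θ kstar n k * μ.real {ω | sel n ω = k} ≤ rK * (e
      + μ.real {ω | sel n ω = k ∧ (selCount sel k (winStart τ n) n ω : ℝ) < l} + D n + e₂) := by
    intro n hn
    obtain ⟨⟨hn1, hnT⟩, hnK, hkn, hc⟩ := mem_clearSlots.1 (hA hn)
    have h1 := h.sel_prob_le_of_testable hnK hζ hW hl hm₀ (ht n hn)
    have h2 := mul_le_mul_of_nonneg_left h1 (h.gap_nonneg hn1 k)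
    refine h2.trans ?_
    rw [mul_add, mul_add, mul_add, mul_add, mul_add, mul_add]
    have hg := h.gap_le hn1 k
    refine add_le_add (add_le_add (add_le_add (he n hn) ?_) ?_) ?_ <;> gcongr
  have hfirst : ∑ n ∈ A, μ.real {ω | sel n ω = k ∧ (selCount sel k (winStart τ n) n ω : ℝ) < l}
      ≤ ((T : ℝ) / τ + 1) * (l + 1) :=
    (sum_le_sum_of_subset_of_nonneg hAT fun _ _ _ => measureReal_nonneg).trans
      (h.model.sum_measureReal_selCount_lt_le k hτ1 hl.le)
  have hD₁ : ∑ n ∈ A₁, D n ≤ (m₀ + 1) / (m₁ - m₀) * ∑ n ∈ G, (1 - μ.real {ω | sel n ω = k}) := by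
    have h1 := h.model.sum_measureReal_le_unselected k (τ := τ) ((filter_subset _ _).trans hAT)
      (confSlots_subset k) hm₀ (A := A₁) (G := G) (m₁ := m₁) (fun n hn => (mem_filter.1 hn).2)
    rw [div_mul_eq_mul_div, le_div_iff₀ (sub_pos.2 hm₁), mul_comm]
    refine le_trans (mul_le_mul_of_nonneg_left (sum_le_sum fun n _ => ?_) (by linarith)) h1
    refine measureReal_mono ?_
    rintro ω ⟨h2, -, h3, -⟩
    exact ⟨h2, h3⟩
  set U := A₂.biUnion fun n => Ico (winStart τ n) n with hU
  have hA₂A : A₂ ⊆ A := filter_subset _ _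
  have hUT : U ⊆ Icc 1 T := by
    intro u hu
    rw [hU, mem_biUnion] at hu
    obtain ⟨n, hn, hun⟩ := hu
    rw [mem_Ico] at hun
    have h1 := mem_Icc.1 (hAT (hA₂A hn))
    rw [mem_Icc]
    exact ⟨(le_max_left _ _).trans hun.1, by omega⟩
  have hD₂ : ∑ n ∈ A₂, D n ≤ (m₀ + 1) * Real.exp (-(l * (W * ζ ^ 2 / 2))) *
      ∑ u ∈ U, μ.real {ω | sel u ω = k} :=
    h.model.sum_measureReal_overestimate_le h.mem k (hA₂A.trans hAT) hUT
      (fun n hn => subset_biUnion_of_mem (fun n => Ico (winStart τ n) n) hn) hζ.le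
      (fun n hn => (ht n (hA₂A hn)).le_one_sub) hW.le hl hm₀
      (fun n _ t ht => h.θ_le_upMean ht k)
  have hUsum : ∑ u ∈ U, μ.real {ω | sel u ω = k} ≤ ((T : ℝ) / τ + 1) * (2 * m₁) + 1 +
      ∑ n ∈ clearSlots r θ kstar τ σ Imin T k, μ.real {ω | sel n ω = k} := by
    have hsub : U ⊆ (U.filter (· ∈ G) ∪ Icc 1 K) ∪ clearSlots r θ kstar τ σ Imin T k := by
      intro u hu
      by_cases huG : u ∈ G
      · exact mem_union_left _ (mem_union_left _ (mem_filter.2 ⟨hu, huG⟩))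
      have huT := mem_Icc.1 (hUT hu)
      by_cases huK : u ≤ K
      · exact mem_union_left _ (mem_union_right _ (mem_Icc.2 ⟨huT.1, huK⟩))
      refine mem_union_right _ (mem_clearSlots.2 ⟨huT, by omega, ?_⟩)
      rw [hU, mem_biUnion] at hu
      obtain ⟨n, hn, hun⟩ := hu
      have hn' := mem_clearSlots.1 (hA (hA₂A hn))
      have hku := h.ne_kstar_of_not_confused hn'.1.1 hn'.2.2.2 hun
      refine ⟨hku, fun hc => huG ?_⟩
      exact mem_confSlots.2 ⟨huT, hku, hc⟩
    have hcard := card_biUnion_window_inter_le hτ1 (hA₂A.trans hAT) (G := G) (m := m₁)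
      (by linarith) (fun n hn => (not_le.1 (mem_filter.1 hn).2).le)
    refine (sum_le_sum_of_subset_of_nonneg hsub fun _ _ _ => measureReal_nonneg).trans ?_
    have hun : ∀ s t : Finset ℕ, ∑ u ∈ s ∪ t, μ.real {ω | sel u ω = k} ≤
        ∑ u ∈ s, μ.real {ω | sel u ω = k} + ∑ u ∈ t, μ.real {ω | sel u ω = k} := by
      intro s t
      rw [← sum_union_inter]
      exact le_add_of_nonneg_right (sum_nonneg fun _ _ => measureReal_nonneg)
    refine (hun _ _).trans (add_le_add_left ((hun _ _).trans
      (add_le_add (le_trans ?_ hcard) (h.sum_init_sel_le k))) _)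
    calc _ ≤ ∑ u ∈ U.filter (· ∈ G), (1 : ℝ) := sum_le_sum fun _ _ => measureReal_le_one
      _ = _ := by simp [hU]
  calc _ ≤ _ := sum_le_sum hpt
    _ = rK * (#A * e + ∑ n ∈ A, μ.real {ω | sel n ω = k ∧
          (selCount sel k (winStart τ n) n ω : ℝ) < l} + (∑ n ∈ A₁, D n + ∑ n ∈ A₂, D n)
          + #A * e₂) := by
        rw [← mul_sum, sum_add_distrib, sum_add_distrib, sum_add_distrib,
          sum_filter_add_sum_filter_not]
        simp
    _ ≤ rK * (T * e + ((T : ℝ) / τ + 1) * (l + 1) + ((m₀ + 1) / (m₁ - m₀) *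
          ∑ n ∈ G, (1 - μ.real {ω | sel n ω = k})
        + (m₀ + 1) * Real.exp (-(l * (W * ζ ^ 2 / 2))) *
          (((T : ℝ) / τ + 1) * (2 * m₁) + 1 +
            ∑ n ∈ clearSlots r θ kstar τ σ Imin T k, μ.real {ω | sel n ω = k})) + T * e₂) := by
        have hcardA : (#A : ℝ) ≤ T := by
          have := card_le_card hAT
          rw [Nat.card_Icc, Nat.add_sub_cancel] at this
          exact_mod_cast this
        gcongr
        exact hD₂.trans (mul_le_mul_of_nonneg_left hUsum (by positivity))
    _ = _ := by ring

end Run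


/-! ### Rates whose maximal reward is too small -/

section Run

variable {Ω : Type*} [mΩ : MeasurableSpace Ω] {μ : Measure Ω} {K : ℕ}
  {ℱ : Filtration ℕ mΩ} {θ : ℕ → Fin K → ℝ} {X : ℕ → Ω → Fin K → Bool} {sel : ℕ → Ω → Fin K}
  {rK c σ Imin : ℝ} {τ T : ℕ} {r : Fin K → ℝ} {kstar : ℕ → Fin K}

/-- Bound for the probability that an index is below a threshold with relative margin `m`. -/
def marginProb (c : ℝ) (τ : ℕ) (m : ℝ) : ℝ :=
  Real.exp (2 - explorationLevel c τ) *
    ((explorationLevel c τ + 1) * Real.log (2 / m ^ 3) + 2)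

/-- Since r_k x equals the reward bound of the best rate, a relative margin for x is one for the
mean of the best rate. -/
theorem IsRun.klIndex_prob_le_marginProb [IsProbabilityMeasure μ]
    (h : IsRun μ rK c σ τ r θ kstar ℱ X sel) {n : ℕ} (hn : 1 ≤ n) {k : Fin K} {m y : ℝ}
    (hm : 0 < m) (hx : 0 < needMean r θ kstar τ σ n k) (hy0 : 0 < y)
    (hy : y ≤ (1 - m) * needMean r θ kstar τ σ n k) :
    μ.real {ω | klIndex r c τ X sel n (kstar n) ω ≤ r k * y} ≤ marginProb c τ m := by
  have hrk := h.r_pos k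
  have hrj := h.r_pos (kstar n)
  have hy' := h.mul_needMean (σ := σ) (τ := τ) (kstar := kstar) n k
  set v := θ n (kstar n) - τ * σ with hv
  have hv1 : v < 1 := by linarith [(h.mem n (kstar n) hn).2, h.τσ_pos]
  have hw : r k * y / r (kstar n) ≤ (1 - m) * v := by
    rw [div_le_iff₀ hrj]
    calc r k * y ≤ r k * ((1 - m) * needMean r θ kstar τ σ n k) := by gcongr
      _ = (1 - m) * (r k * needMean r θ kstar τ σ n k) := by ring
      _ = _ := by rw [hy']; ring
  have hw0 : 0 < r k * y / r (kstar n) := by positivity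
  have hx0 : 0 < v := by
    have := mul_pos hrk hx
    rw [hy'] at this
    exact pos_of_mul_pos_right this hrj.le
  have := h.model.measureReal_klIndex_le_of_margin h.mem hrj hx0 hw0 hm hw hv1
    (fun t ht => h.le_θ ht (kstar n)) (one_lt_explorationLevel h.c_pos h.three_le)
  rwa [mul_div_cancel₀ _ hrj.ne'] at this

/-- A rate which was certainly too small some time ago is only rarely selected. -/
theorem IsRun.sel_prob_le_of_late [IsProbabilityMeasure μ]
    (h : IsRun μ rK c σ τ r θ kstar ℱ X sel) {n n' : ℕ} (hnK : K < n) (hn' : 1 ≤ n')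
    {k : Fin K} (hx : 1 ≤ needMean r θ kstar τ σ n' k) {η s : ℝ} (hη : 0 < η) (hη2 : η ≤ 1 / 2)
    (hs : 0 < s) (hsσ : s ≤ τ * σ) (hlate : (n' : ℝ) + η * τ ≤ n)
    (hhalf : (n : ℝ) ≤ n' + τ / 2) :
    μ.real {ω | sel n ω = k} ≤ marginProb c τ (η * s) := by
  have hrk := h.r_pos k
  -- The comparison is with the best rate of the earlier slot n', which need not be the best one in
  -- slot n.
  set i := kstar n'
  have hri := h.r_pos i
  have hy := h.r_le_of_one_le hx
  have hσ := h.σ_pos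
  have hτ3 : (3 : ℝ) ≤ τ := by exact_mod_cast h.three_le
  have hw : r k / r i ≤ θ n' i - τ * σ := by rw [div_le_iff₀ hri]; linarith
  have hw0 : 0 < r k / r i := by positivity
  set w := r k / r i with hwdef
  set v := w + η * (τ * σ) with hv
  have hv1 : v < 1 := by
    have := (h.mem n' i hn').2
    have := h.τσ_pos
    nlinarith
  have hmean : ∀ t ∈ Ico (winStart τ n) n, v ≤ θ t i := by
    intro t ht
    rw [mem_Ico] at ht
    simp only [winStart, max_le_iff] at ht
    have h1 := h.lip i n' t hn' ht.1.1
    have h2 : (t : ℝ) ≤ n := by exact_mod_cast ht.2.le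
    have h3 : (n : ℝ) ≤ t + τ := by exact_mod_cast (by omega)
    -- As n' lies between ητ and τ/2 slots before n, and η ≤ 1/2, every slot of the window of n is
    -- within (1 - η)τ of n'. The drift ητσ saved in this way is the margin.
    have h4 : |(t : ℝ) - n'| ≤ τ - η * τ := by
      rw [abs_le]
      constructor <;> nlinarith
    have h5 := mul_le_mul_of_nonneg_left h4 hσ.le
    have h6 := (abs_le.1 (h1.trans h5)).1
    rw [hv]
    linarith
  have h1 := h.model.measureReal_klIndex_le_of_margin (n := n) (v := v) (w := w) (m := η * s) h.mem
    hri (by have := h.τσ_pos; positivity) hw0 (by positivity) (by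
      have e1 : η * s ≤ η * (τ * σ) := by gcongr
      have e2 : η * s * v ≤ η * s * 1 := by gcongr
      linarith) hv1 hmean (one_lt_explorationLevel h.c_pos h.three_le)
  refine le_trans (measureReal_mono ?_) h1
  intro ω hω
  have hω : sel n ω = k := hω
  have h2 := (h.alg ω n (by omega)).2 hnK i
  rw [hω] at h2
  have h3 : r i * w = r k := mul_div_cancel₀ _ hri.ne'
  have h4 : klIndex r c τ X sel n k ω ≤ r k := klIndex_le hrk
  show klIndex r c τ X sel n i ω ≤ r i * w
  rw [h3]
  exact h2.trans h4

/-- Except for a small part of the slots, a rate which is certainly too small was so already some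
time ago. -/
theorem exists_late_split {τ T : ℕ} (hτ : 3 ≤ τ) {Z : Finset ℕ} (hZ : Z ⊆ Icc 1 T) {η : ℝ}
    (hη : 0 < η) : ∃ E ⊆ Z, (#E : ℝ) ≤ (3 * (T : ℝ) / τ + 1) * (η * τ + 1) ∧
      ∀ n ∈ Z \ E, ∃ n' ∈ Z, (n' : ℝ) + η * τ ≤ n ∧ (n : ℝ) ≤ n' + τ / 2 := by
  classical
  set H := τ / 2 with hH
  have hH1 : 1 ≤ H := by omega
  -- `E` holds the elements of Z less than ητ after the first element of Z in their block of length
  -- ⌊τ/2⌋. The 3 in the bound comes from τ ≤ 3⌊τ/2⌋.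
  set E := Z.filter fun n => ¬ ∃ n' ∈ Z, (n' - 1) / H = (n - 1) / H ∧ (n' : ℝ) + η * τ ≤ n with hE
  refine ⟨E, filter_subset _ _, ?_, ?_⟩
  · have h := sum_Icc_le_of_block_le (f := fun u => if u ∈ E then (1 : ℝ) else 0)
      (fun u => by positivity) hH1 (M := η * τ + 1) (by positivity) (fun i => ?_) T
    · have h1 : (#E : ℝ) ≤ ((T : ℝ) / H + 1) * (η * τ + 1) := by
        refine le_trans (le_of_eq ?_) h
        rw [← sum_filter, sum_const, nsmul_eq_mul, mul_one]
        congr 2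
        ext u
        exact ⟨fun hu => mem_filter.2 ⟨hZ (filter_subset _ _ hu), hu⟩, fun hu => (mem_filter.1 hu).2⟩
      refine h1.trans ?_
      have h2 : (T : ℝ) / H ≤ 3 * T / τ := by
        have e1 : (τ : ℝ) ≤ 3 * H := by exact_mod_cast (by omega)
        have e2 : (0 : ℝ) < τ := by exact_mod_cast (by omega)
        have e3 : (0 : ℝ) < H := by exact_mod_cast hH1
        rw [div_le_div_iff₀ e3 e2]
        have e4 : (0 : ℝ) ≤ T := by positivity
        nlinarith
      gcongr
    · rw [← sum_filter, sum_const, nsmul_eq_mul, mul_one]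
      set B := (Ico (1 + i * H) (1 + i * H + H)).filter (· ∈ E) with hB
      have hblk : ∀ n ∈ B, (n - 1) / H = i := by
        intro n hn
        have h1 := mem_Ico.1 (mem_filter.1 hn).1
        rw [Nat.div_eq_iff (by omega)]
        omega
      rcases B.eq_empty_or_nonempty with h0 | hne
      · rw [h0]; simp; positivity
      obtain ⟨N, hN, hmin⟩ := exists_min_image B id hne
      have hsub : B ⊆ Ico N (N + ⌈η * τ⌉₊) := by
        intro n hn
        rw [mem_Ico]
        refine ⟨hmin n hn, ?_⟩
        by_contra hcon
        push Not at hcon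
        have h1 := (mem_filter.1 (mem_filter.1 hn).2).2
        refine h1 ⟨N, filter_subset _ _ (mem_filter.1 hN).2, by rw [hblk N hN, hblk n hn], ?_⟩
        have h2 : ((N + ⌈η * τ⌉₊ : ℕ) : ℝ) ≤ n := by exact_mod_cast hcon
        push_cast at h2
        linarith [Nat.le_ceil (η * (τ : ℝ))]
      have h1 := card_le_card hsub
      rw [Nat.card_Ico, Nat.add_sub_cancel_left] at h1
      have h2 : (#B : ℝ) ≤ ⌈η * τ⌉₊ := by exact_mod_cast h1
      exact h2.trans (Nat.ceil_lt_add_one (by positivity)).le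
  · intro n hn
    rw [mem_sdiff] at hn
    have h1 : ∃ n' ∈ Z, (n' - 1) / H = (n - 1) / H ∧ (n' : ℝ) + η * τ ≤ n := by
      by_contra hcon
      exact hn.2 (mem_filter.2 ⟨hn.1, hcon⟩)
    obtain ⟨n', hn', hb, hl⟩ := h1
    refine ⟨n', hn', hl, ?_⟩
    have h2 : n ≤ n' + H := by
      have e1 := (mem_Icc.1 (hZ hn')).1
      have e2 := (mem_Icc.1 (hZ hn.1)).1
      have e3 := Nat.div_add_mod (n - 1) H
      have e4 := Nat.div_add_mod (n' - 1) H
      have e5 := Nat.mod_lt (n - 1) (show 0 < H by omega)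
      rw [hb] at e4
      omega
    have h3 : (n : ℝ) ≤ n' + H := by exact_mod_cast h2
    have h4 : (2 : ℝ) * H ≤ τ := by exact_mod_cast (by omega)
    linarith

end Run


/-! ### Regret in clear slots when the mean needed is bounded away from `0` and `1` -/

/-- The failure term equals I + b and the success term is at least -b. When the needed mean is at
least 1, k may be tested against any x < 1, and x this close to 1 restores the divergence. -/
theorem le_klR_tail {b I : ℝ} (hb : 0 < b) (hb1 : b < 1) (hI : 0 ≤ I) :
    I ≤ klR (1 - b) (1 - b * Real.exp (-(I / b + 1))) := by
  have he : Real.exp (-(I / b + 1)) < 1 := by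
    rw [Real.exp_lt_one_iff]
    have : 0 ≤ I / b := by positivity
    linarith
  have he0 := Real.exp_pos (-(I / b + 1))
  have hbe : b * Real.exp (-(I / b + 1)) < b := by nlinarith
  have hbe0 : 0 < b * Real.exp (-(I / b + 1)) := by positivity
  have h1 : b / (b * Real.exp (-(I / b + 1))) = Real.exp (I / b + 1) := by
    rw [Real.exp_neg]; field_simp
  rw [klR, sub_sub_cancel, sub_sub_cancel, h1, Real.log_exp, mul_add, mul_div_cancel₀ _ hb.ne']
  set y := 1 - b * Real.exp (-(I / b + 1))
  have hy : 0 < y := by linarith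
  have hb' : 0 < 1 - b := by linarith
  have h2 := Real.one_sub_inv_le_log_of_pos (show 0 < (1 - b) / y by positivity)
  have h3 := mul_le_mul_of_nonneg_left h2 hb'.le
  rw [inv_div, mul_sub, mul_div_cancel₀ _ hb'.ne'] at h3
  linarith

/-- Shrinking the distance between two means a little keeps most of the divergence. -/
theorem exists_klR_shrink {δ I : ℝ} (hδ : 0 < δ) (hδ2 : δ ≤ 1 / 2) (hI : 0 < I) :
    ∃ ζ : ℝ, 0 < ζ ∧ ζ ≤ 1 / 2 ∧ ∀ p x : ℝ, 0 ≤ p → p < x → δ ≤ x → x ≤ 1 - δ → I ≤ klR p x →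
      p + ζ * (1 - p) < x * (1 - ζ) ∧ 4 / 5 * I ≤ klR (p + ζ * (1 - p)) (x * (1 - ζ)) := by
  have hcomp : IsCompact (Set.Icc (0 : ℝ) 1 ×ˢ Set.Icc (δ / 2) (1 - δ / 2)) :=
    isCompact_Icc.prod isCompact_Icc
  have hcont : ContinuousOn (fun z : ℝ × ℝ => klR z.1 z.2)
      (Set.Icc (0 : ℝ) 1 ×ˢ Set.Icc (δ / 2) (1 - δ / 2)) := by
    refine continuousOn_klR.mono (Set.prod_mono (Set.subset_univ _) ?_)
    intro q hq
    exact ⟨by linarith [hq.1], by linarith [hq.2]⟩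
  have huc := hcomp.uniformContinuousOn_of_continuous hcont
  rw [Metric.uniformContinuousOn_iff] at huc
  obtain ⟨d, hd, huc⟩ := huc (I / 5) (by positivity)
  have hs : 0 < √(I * δ / 2) := Real.sqrt_pos.2 (by positivity)
  set s := √(I * δ / 2)
  -- 1/2 keeps the moved points in the compact set, d/2 limits the loss of divergence to I/5, and
  -- s/3 preserves the order of the two means, since x - p ≥ s by the χ² bound.
  refine ⟨min (1 / 2) (min (d / 2) (s / 3)), by positivity, min_le_left _ _, ?_⟩
  set ζ := min (1 / 2) (min (d / 2) (s / 3))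
  have hζ0 : 0 < ζ := by positivity
  have hζ1 : ζ ≤ 1 / 2 := min_le_left _ _
  have hζ2 : ζ ≤ d / 2 := (min_le_right _ _).trans (min_le_left _ _)
  have hζ3 : ζ ≤ s / 3 := (min_le_right _ _).trans (min_le_right _ _)
  intro p x hp hpx hx hx1 hkl
  have hx0 : 0 < x := hδ.trans_le hx
  have hp1 : p < 1 := by linarith
  have hgap : s ≤ x - p := by
    refine Real.sqrt_le_iff.2 ⟨by linarith, ?_⟩
    have h1 := klR_le_chiSq hp hp1.le hx0 (by linarith)
    have h2 : 0 < x * (1 - x) := mul_pos hx0 (by linarith)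
    rw [le_div_iff₀ h2] at h1
    have h3 : δ / 2 ≤ x * (1 - x) := by nlinarith
    have h4 : I * (δ / 2) ≤ klR p x * (x * (1 - x)) := by
      exact mul_le_mul hkl h3 (by positivity) (hI.le.trans hkl)
    nlinarith
  have h1 : ζ * (1 - p) ≤ ζ := by nlinarith
  have h2 : ζ * x ≤ ζ := by nlinarith
  have h3 : 0 ≤ ζ * (1 - p) := by nlinarith
  have h4 : 0 ≤ ζ * x := by nlinarith
  have h5 := huc (p + ζ * (1 - p), x * (1 - ζ))
    ⟨⟨by linarith, by nlinarith⟩, ⟨by nlinarith, by nlinarith⟩⟩ (p, x)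
    ⟨⟨hp, hp1.le⟩, ⟨by linarith, by linarith⟩⟩ (by
      rw [Prod.dist_eq, max_lt_iff, Real.dist_eq, Real.dist_eq]
      simp only
      constructor
      · rw [abs_lt]; constructor <;> linarith
      · rw [abs_lt]; constructor <;> linarith)
  rw [Real.dist_eq, abs_lt] at h5
  simp only at h5
  exact ⟨by linarith, by linarith⟩

section Run

variable {Ω : Type*} [mΩ : MeasurableSpace Ω] {μ : Measure Ω} {K : ℕ}
  {ℱ : Filtration ℕ mΩ} {θ : ℕ → Fin K → ℝ} {X : ℕ → Ω → Fin K → Bool} {sel : ℕ → Ω → Fin K}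
  {rK c σ Imin : ℝ} {τ T : ℕ} {r : Fin K → ℝ} {kstar : ℕ → Fin K}

/-- `e` bounds the error probabilities of the various kinds of clear slots. -/
structure IsErrorBound (c Imin : ℝ) (τ : ℕ) (ζ W e : ℝ) : Prop where
  shrink : marginProb c τ ζ ≤ e
  above : marginProb c τ (1 / (explorationLevel c τ + 1)) ≤ e
  late : marginProb c τ (1 / explorationLevel c τ * (1 / explorationLevel c τ)) ≤ e
  close : (W + 3 / explorationLevel c τ) * underProb c τ ≤ e
  tail : ∀ w, W ≤ w → w ≤ 1 → (w + 3 / explorationLevel c τ) *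
    marginProb c τ ((1 - ζ) * w * Real.exp (-(Imin / ((1 - ζ) * w) + 1))) ≤ e

/-- Clear slots are sorted by what makes a failure of the best index cheap. If x < 1, testing
against x(1 - ζ) leaves the margin ζ. If x ≥ 1, the best index must fall to r_k. Then x ≥ 1 + 1/L
gives the margin 1/(L + 1). For x < 1 + 1/L and τσ > 1/L the drift gives a margin, except in the few
slots of `E`. For τσ ≤ 1/L the gap is at most rK(1 - p + 3/L): either 1 - p < W, and the small gap
compensates `underProb`, or k is testable against 1 - `tl`, with margin `tl`. -/
theorem IsRun.sum_clear_le [IsProbabilityMeasure μ]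
    (h : IsRun μ rK c σ τ r θ kstar ℱ X sel) {k : Fin K} {δ ζ W l m₀ m₁ e : ℝ} (hI : 0 < Imin)
    (hζ : 0 < ζ) (hζ2 : ζ ≤ 1 / 2) (hW : 0 < W) (hWδ : W ≤ δ) (hl : 0 < l) (hm₀ : l ≤ m₀)
    (hm₁ : m₀ < m₁) (hL2 : 2 ≤ explorationLevel c τ)
    (hlL : explorationLevel c τ ≤ l * (4 / 5 * Imin))
    (hδ : ∀ n ∈ clearSlots r θ kstar τ σ Imin T k, needMean r θ kstar τ σ n k < 1 →
      δ ≤ needMean r θ kstar τ σ n k ∧ needMean r θ kstar τ σ n k ≤ 1 - δ)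
    (hshrink : ∀ p x : ℝ, 0 ≤ p → p < x → δ ≤ x → x ≤ 1 - δ → Imin ≤ klR p x →
      p + ζ * (1 - p) < x * (1 - ζ) ∧ 4 / 5 * Imin ≤ klR (p + ζ * (1 - p)) (x * (1 - ζ)))
    (he : IsErrorBound c Imin τ ζ W e) (he0 : 0 ≤ e) :
    ∑ n ∈ clearSlots r θ kstar τ σ Imin T k, gap r θ kstar n k * μ.real {ω | sel n ω = k} ≤
      rK * (T * e + ((T : ℝ) / τ + 1) * (l + 1) + T * Real.exp (-(m₀ * (W * ζ ^ 2 / 2)))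
        + (m₀ + 1) / (m₁ - m₀) *
          ∑ n ∈ confSlots r θ kstar τ σ Imin T k, (1 - μ.real {ω | sel n ω = k})
        + (m₀ + 1) * Real.exp (-(l * (W * ζ ^ 2 / 2))) *
          (((T : ℝ) / τ + 1) * (2 * m₁) + 1 + (T * underProb c τ + ((T : ℝ) / τ + 1) * (m₀ + 1)
            + T * Real.exp (-(m₀ * (W * ζ ^ 2 / 2))))))
      + rK * (T * e
        + (3 * (T : ℝ) / τ + 1) * (1 / explorationLevel c τ * τ + 1) * underProb c τ) := by
  classical
  set L := explorationLevel c τ with hLdef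
  have hL0 : 0 < L := by linarith
  have hrK := h.rK_nonneg
  have hP0 := underProb_nonneg h.c_pos h.three_le
  set S := clearSlots r θ kstar τ σ Imin T k with hS
  set ρ := 1 - ζ with hρ
  have hρ0 : 0 < ρ := by linarith
  set tl : ℕ → ℝ := fun n => ρ * (1 - upMean θ τ σ n k) *
    Real.exp (-(Imin / (ρ * (1 - upMean θ τ σ n k)) + 1)) with htl
  set x : ℕ → ℝ := fun n => if needMean r θ kstar τ σ n k < 1 then
    needMean r θ kstar τ σ n k * (1 - ζ) else 1 - tl n with hx
  set B : ℕ → Prop := fun n => needMean r θ kstar τ σ n k < 1 + 1 / L ∧ τ * σ ≤ 1 / L ∧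
    W ≤ 1 - upMean θ τ σ n k with hB
  set A := S.filter fun n => needMean r θ kstar τ σ n k < 1 ∨ B n with hA
  have hIle : ∀ {y : ℝ}, 4 / 5 * Imin ≤ y → L ≤ l * y := fun hy =>
    hlL.trans (mul_le_mul_of_nonneg_left hy hl.le)
  have htest₁ : ∀ n ∈ S, needMean r θ kstar τ σ n k < 1 →
      Testable r θ kstar c τ σ ζ W l n k (x n) := by
    intro n hn hn1
    obtain ⟨⟨hn1', hnT⟩, hnK, hkn, hc⟩ := mem_clearSlots.1 hn
    obtain ⟨hpx, hkl⟩ := h.not_confused hn1' hc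
    have hp := h.upMean_pos (σ := σ) (τ := τ) hn1' k
    have hd := hδ n hn hn1
    obtain ⟨h1, h2⟩ := hshrink _ _ hp.le hpx hd.1 hd.2 (hkl hn1)
    have hxe : x n = needMean r θ kstar τ σ n k * (1 - ζ) := if_pos hn1
    rw [hxe]
    exact ⟨by linarith, h1, by nlinarith, by nlinarith, hIle h2⟩
  have htest₂ : ∀ n ∈ S, ¬ needMean r θ kstar τ σ n k < 1 → B n →
      Testable r θ kstar c τ σ ζ W l n k (x n) ∧ 0 < tl n ∧ tl n < 1 := by
    intro n hn hn1 hBn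
    obtain ⟨⟨hn1', hnT⟩, hnK, hkn, hc⟩ := mem_clearSlots.1 hn
    have hp := h.upMean_pos (σ := σ) (τ := τ) hn1' k
    obtain ⟨h1, h2, h3⟩ := hBn
    have hxe : x n = 1 - tl n := if_neg hn1
    rw [hxe]
    set w := 1 - upMean θ τ σ n k with hw
    have hw0 : 0 < w := hW.trans_le h3
    have hb : 0 < ρ * w := by positivity
    have hb1 : ρ * w < 1 := by nlinarith
    have h5 := le_klR_tail hb hb1 hI.le
    have h6 : Real.exp (-(Imin / (ρ * w) + 1)) < 1 := by
      rw [Real.exp_lt_one_iff]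
      have : 0 ≤ Imin / (ρ * w) := by positivity
      linarith
    have h7 : tl n < ρ * w := by
      have := mul_lt_mul_of_pos_left h6 hb
      rwa [mul_one] at this
    have h8 : 0 < tl n := by positivity
    have h9 : upMean θ τ σ n k + ζ * w = 1 - ρ * w := by rw [hρ, hw]; ring
    push Not at hn1
    refine ⟨⟨by linarith, by rw [h9]; linarith, by linarith, by linarith, ?_⟩, h8, by linarith⟩
    rw [h9]
    exact hIle (le_trans (by linarith) h5)
  have hgapB : ∀ n ∈ S, needMean r θ kstar τ σ n k < 1 + 1 / L → τ * σ ≤ 1 / L →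
      ∀ w, 0 ≤ w → 1 - upMean θ τ σ n k ≤ w → gap r θ kstar n k ≤ rK * (w + 3 / L) := by
    intro n hn h1 h2 w hw0 hw
    have hLinv : 0 < 1 / L := by positivity
    have := h.gap_le_of_le n k (d := w + 1 / L) (s := 1 / L) (kstar := kstar) (σ := σ)
      (by linarith) (by linarith) h2
    refine this.trans (le_of_eq ?_)
    ring
  have hsumA := h.sum_testable_le (A := A) (x := x) (m₀ := m₀) (m₁ := m₁) (e := e)
    (filter_subset _ _) hζ hW hl (hl.le.trans hm₀) hm₁ (fun n hn => by
      obtain ⟨hnS, hn'⟩ := mem_filter.1 hn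
      by_cases hn1 : needMean r θ kstar τ σ n k < 1
      · exact htest₁ n hnS hn1
      · exact (htest₂ n hnS hn1 (hn'.resolve_left hn1)).1) (fun n hn => by
      obtain ⟨hnS, hn'⟩ := mem_filter.1 hn
      obtain ⟨⟨hn1', hnT⟩, hnK, hkn, hc⟩ := mem_clearSlots.1 hnS
      have hp := h.upMean_pos (σ := σ) (τ := τ) hn1' k
      have hpx := (h.not_confused hn1' hc).1
      by_cases hn1 : needMean r θ kstar τ σ n k < 1
      · have hxe : x n = needMean r θ kstar τ σ n k * (1 - ζ) := if_pos hn1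
        refine mul_le_mul (h.gap_le hn1' k) (le_trans ?_ he.shrink) measureReal_nonneg hrK
        refine h.klIndex_prob_le_marginProb hn1' hζ (hp.trans hpx) ?_ ?_
        · rw [hxe]; exact mul_pos (hp.trans hpx) (by linarith)
        · rw [hxe, mul_comm]
      · have hBn := hn'.resolve_left hn1
        obtain ⟨-, ht0, ht1⟩ := htest₂ n hnS hn1 hBn
        obtain ⟨h1, h2, h3⟩ := hBn
        have hxe : x n = 1 - tl n := if_neg hn1
        push Not at hn1
        have h4 : μ.real {ω | klIndex r c τ X sel n (kstar n) ω ≤ r k * x n} ≤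
            marginProb c τ (tl n) := by
          refine h.klIndex_prob_le_marginProb hn1' ht0 (hp.trans hpx) (by rw [hxe]; linarith) ?_
          rw [hxe]; nlinarith
        have h5 := hgapB n hnS h1 h2 _ (hW.le.trans h3) le_rfl
        have h6 := he.tail _ h3 (by linarith)
        have hw0 : 0 ≤ 1 - upMean θ τ σ n k := hW.le.trans h3
        calc _ ≤ rK * (1 - upMean θ τ σ n k + 3 / L) * marginProb c τ (tl n) :=
              mul_le_mul h5 h4 measureReal_nonneg (by positivity)
          _ = rK * ((1 - upMean θ τ σ n k + 3 / L) * marginProb c τ (tl n)) := by ring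
          _ ≤ _ := by gcongr) he0
  have hcrude := h.sum_clear_sel_le (k := k) (Imin := Imin) (T := T) (x := x) (m₀ := m₀) hζ hW hl hm₀
    (fun n hn => by
      by_cases hn1 : needMean r θ kstar τ σ n k < 1
      · exact Or.inr (htest₁ n hn hn1)
      · exact Or.inl (not_lt.1 hn1))
  set Z := S.filter fun n => 1 ≤ needMean r θ kstar τ σ n k with hZ
  obtain ⟨E, hEZ, hEcard, hElate⟩ := exists_late_split h.three_le (Z := Z) (T := T)
    ((filter_subset _ _).trans (clearSlots_subset k)) (η := 1 / L) (by positivity)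
  have hsumR : ∑ n ∈ S.filter (fun n => ¬ (needMean r θ kstar τ σ n k < 1 ∨ B n)),
      gap r θ kstar n k * μ.real {ω | sel n ω = k} ≤ rK * (T * e + #E * underProb c τ) := by
    have hpt : ∀ n ∈ S.filter (fun n => ¬ (needMean r θ kstar τ σ n k < 1 ∨ B n)),
        gap r θ kstar n k * μ.real {ω | sel n ω = k} ≤
          rK * (e + if n ∈ E then underProb c τ else 0) := by
      intro n hn
      obtain ⟨hnS, hn'⟩ := mem_filter.1 hn
      push Not at hn'
      obtain ⟨hx1, hnB⟩ := hn'
      obtain ⟨⟨hn1', hnT⟩, hnK, hkn, hc⟩ := mem_clearSlots.1 hnS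
      have hg := h.gap_le hn1' k
      have hq : (0 : ℝ) ≤ if n ∈ E then underProb c τ else 0 := by split_ifs <;> simp [hP0]
      have hpi : μ.real {ω | sel n ω = k} ≤ e + (if n ∈ E then underProb c τ else 0) →
          gap r θ kstar n k * μ.real {ω | sel n ω = k} ≤
            rK * (e + if n ∈ E then underProb c τ else 0) := fun h1 =>
        mul_le_mul hg h1 measureReal_nonneg hrK
      rcases le_or_gt (1 + 1 / L) (needMean r θ kstar τ σ n k) with hab | hab
      · refine hpi (le_trans ?_ (le_add_of_nonneg_right hq))
        refine le_trans ?_ he.above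
        have h1 := h.klIndex_prob_le_marginProb (k := k) (kstar := kstar) (m := 1 / (L + 1)) (y := 1)
          hn1' (by positivity) (by linarith) one_pos (by
            have e1 : (1 - 1 / (L + 1)) * (1 + 1 / L) = 1 := by field_simp; ring
            have e2 : 0 ≤ 1 - 1 / (L + 1) := by
              rw [sub_nonneg, div_le_one (by positivity)]; linarith
            calc (1 : ℝ) = (1 - 1 / (L + 1)) * (1 + 1 / L) := e1.symm
              _ ≤ _ := by gcongr)
        rw [mul_one] at h1
        exact (measureReal_mono (h.sel_subset_of_one_le hnK k)).trans h1
      rcases le_or_gt (τ * σ) (1 / L) with hs | hs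
      · have hnW : 1 - upMean θ τ σ n k < W := by
          by_contra hcon
          exact hnB ⟨hab, hs, not_lt.1 hcon⟩
        have h1 := hgapB n hnS hab hs W hW.le hnW.le
        have h2 := h.sel_prob_le_of_one_le hnK hx1
        calc _ ≤ rK * (W + 3 / L) * underProb c τ := mul_le_mul h1 h2 measureReal_nonneg
              (by positivity)
          _ = rK * ((W + 3 / L) * underProb c τ) := by ring
          _ ≤ _ := by
            gcongr
            exact he.close.trans (le_add_of_nonneg_right hq)
      · by_cases hnE : n ∈ E
        · refine hpi ?_
          rw [if_pos hnE]
          exact (h.sel_prob_le_of_one_le hnK hx1).trans (by linarith)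
        · refine hpi (le_trans ?_ (le_add_of_nonneg_right hq))
          obtain ⟨n', hn'Z, hl1, hl2⟩ := hElate n
            (mem_sdiff.2 ⟨mem_filter.2 ⟨hnS, hx1⟩, hnE⟩)
          obtain ⟨hn'S, hn'x⟩ := mem_filter.1 hn'Z
          refine (h.sel_prob_le_of_late hnK (mem_clearSlots.1 hn'S).1.1 hn'x (by positivity)
            ?_ (by positivity) hs.le hl1 hl2).trans he.late
          rw [div_le_div_iff₀ hL0 two_pos]; linarith
    refine (sum_le_sum hpt).trans ?_
    rw [← mul_sum, sum_add_distrib, sum_const, nsmul_eq_mul]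
    refine mul_le_mul_of_nonneg_left (add_le_add (mul_le_mul_of_nonneg_right ?_ he0) ?_) hrK
    · have := card_le_card ((filter_subset (fun n => ¬ (needMean r θ kstar τ σ n k < 1 ∨ B n)) S).trans
        (clearSlots_subset k))
      rw [Nat.card_Icc, Nat.add_sub_cancel] at this
      exact_mod_cast this
    · rw [← sum_filter, sum_const, nsmul_eq_mul]
      gcongr
      intro n hn
      exact (mem_filter.1 hn).2
  rw [← sum_filter_add_sum_filter_not S (fun n => needMean r θ kstar τ σ n k < 1 ∨ B n)]
  have hm₀0 : 0 ≤ m₀ := hl.le.trans hm₀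
  refine add_le_add (hsumA.trans ?_) (hsumR.trans ?_)
  · gcongr
  · gcongr

end Run


/-! ### Asymptotics for large windows -/

theorem explorationLevel_le {c : ℝ} (hc : 0 < c) {τ : ℕ} (hτ : 3 ≤ τ) :
    explorationLevel c τ ≤ (1 + c) * Real.log τ := by
  have h1 := one_lt_log_of_three_le hτ
  have h2 := Real.log_le_self (show 0 ≤ Real.log τ by linarith)
  unfold explorationLevel
  nlinarith

theorem exp_neg_explorationLevel_le {c : ℝ} (hc : 0 < c) {τ : ℕ} (hτ : 3 ≤ τ) :
    Real.exp (-explorationLevel c τ) ≤ (1 + c) ^ c * explorationLevel c τ ^ (-c) / τ := by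
  have h1 := one_lt_log_of_three_le hτ
  have h3 : (3 : ℝ) ≤ τ := by exact_mod_cast hτ
  have hL := one_lt_explorationLevel hc hτ
  have h4 : explorationLevel c τ ^ c ≤ (1 + c) ^ c * Real.log τ ^ c := by
    rw [← Real.mul_rpow (by linarith) (by linarith)]
    exact Real.rpow_le_rpow (by linarith) (explorationLevel_le hc hτ) hc.le
  have h5 : 0 < Real.log τ ^ c := Real.rpow_pos_of_pos (by linarith) c
  have h6 : 0 < explorationLevel c τ ^ c := Real.rpow_pos_of_pos (by linarith) c
  rw [Real.exp_neg, exp_explorationLevel hτ, Real.rpow_neg (by linarith), le_div_iff₀ (by linarith),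
    mul_inv, ← div_eq_mul_inv, ← div_eq_mul_inv, le_div_iff₀ h6]
  have h7 : (τ : ℝ)⁻¹ / Real.log τ ^ c * τ = 1 / Real.log τ ^ c := by field_simp
  rw [h7, div_mul_eq_mul_div, one_mul, div_le_iff₀ h5]
  exact h4

theorem tendsto_explorationLevel {c : ℝ} (hc : 0 < c) :
    Filter.Tendsto (fun τ : ℕ => explorationLevel c τ) Filter.atTop Filter.atTop := by
  refine Filter.tendsto_atTop_mono' _ ?_
    (Real.tendsto_log_atTop.comp tendsto_natCast_atTop_atTop)
  filter_upwards [Filter.eventually_ge_atTop 3] with τ hτ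
  exact log_le_explorationLevel hc hτ

/-- `L` is so large that the polynomial and exponential factors have reached their asymptotic
order. -/
structure LargeLevel (b c c₁ δ C D ν L : ℝ) : Prop where
  two_le : 2 ≤ L
  le_rpow : C ≤ L ^ b
  log_le : 12 * Real.log L ≤ L ^ b
  rpow_le : L ^ (-(1 - b)) ≤ δ
  mul_rpow_le : C * (L * L ^ b * L ^ (-c)) ≤ ν * L
  mul_exp_le : D * L ^ 4 * Real.exp (-(c₁ * L ^ b)) ≤ ν * L
  three_le : 3 ≤ ν * L

theorem eventually_largeLevel {b c c₁ δ ν : ℝ} (C D : ℝ) (hb : 0 < b) (hb1 : b < 1) (hbc : b < c)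
    (hc₁ : 0 < c₁) (hδ : 0 < δ) (hν : 0 < ν) :
    ∀ᶠ L in Filter.atTop, LargeLevel b c c₁ δ C D ν L := by
  have h1 : ∀ᶠ L : ℝ in Filter.atTop, C ≤ L ^ b := (tendsto_rpow_atTop hb).eventually_ge_atTop C
  have h2 : ∀ᶠ L : ℝ in Filter.atTop, 12 * Real.log L ≤ L ^ b := by
    have := (isLittleO_log_rpow_atTop hb).bound (show (0 : ℝ) < 1 / 12 by norm_num)
    filter_upwards [this, Filter.eventually_ge_atTop 1] with L hL hL1
    rw [Real.norm_of_nonneg (Real.log_nonneg hL1), Real.norm_of_nonneg (by positivity)] at hL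
    linarith
  have h3 : ∀ᶠ L : ℝ in Filter.atTop, L ^ (-(1 - b)) ≤ δ :=
    (tendsto_rpow_neg_atTop (sub_pos.2 hb1)).eventually_le_const hδ
  -- The point of b < c: errors of order L^(1+b-c)/τ fall below νL/τ.
  have h4 : ∀ᶠ L : ℝ in Filter.atTop, C ≤ ν * L ^ (c - b) := by
    have := ((tendsto_rpow_atTop (sub_pos.2 hbc)).const_mul_atTop hν).eventually_ge_atTop C
    exact this
  have h5 : ∀ᶠ L : ℝ in Filter.atTop, D * L ^ 4 * Real.exp (-(c₁ * L ^ b)) ≤ 1 := by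
    have e1 := (tendsto_rpow_mul_exp_neg_mul_atTop_nhds_zero (4 / b) c₁ hc₁).comp
      (tendsto_rpow_atTop hb)
    have e2 := e1.const_mul D
    rw [mul_zero] at e2
    filter_upwards [e2.eventually_le_const one_pos, Filter.eventually_ge_atTop 1] with L hL hL1
    have e3 : (L ^ b) ^ (4 / b) = L ^ 4 := by
      rw [← Real.rpow_mul (by linarith), mul_div_cancel₀ _ hb.ne', ← Real.rpow_natCast]
      norm_num
    simp only [Function.comp, e3] at hL
    rw [neg_mul] at hL
    linarith
  have h6 : ∀ᶠ L : ℝ in Filter.atTop, 3 ≤ ν * L :=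
    (Filter.tendsto_id.const_mul_atTop hν).eventually_ge_atTop 3
  filter_upwards [h1, h2, h3, h4, h5, h6, Filter.eventually_ge_atTop 2]
    with L h1 h2 h3 h4 h5 h6 h7
  refine ⟨h7, h1, h2, h3, ?_, by linarith, h6⟩
  have hL : 0 < L := by linarith
  have e1 : L ^ (c - b) * (L ^ b * L ^ (-c)) = 1 := by
    rw [← Real.rpow_add hL, ← Real.rpow_add hL, show c - b + (b + -c) = 0 by ring, Real.rpow_zero]
  have e2 := mul_le_mul_of_nonneg_right h4 (show 0 ≤ L * L ^ b * L ^ (-c) by positivity)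
  calc _ ≤ _ := e2
    _ = ν * L * (L ^ (c - b) * (L ^ b * L ^ (-c))) := by ring
    _ = _ := by rw [e1, mul_one]

section Bounds

variable {b c c₁ δ C D ν ζ Imin : ℝ} {τ : ℕ}

/-- As e^(-L) is at most a constant times L^(-c)/τ, a margin whose logarithm is of order L^b costs
L^(1+b-c)/τ. The factor s lets a small gap compensate a large logarithm. -/
theorem LargeLevel.marginProb_mul_le (hc : 0 < c) (hτ : 3 ≤ τ)
    (h : LargeLevel b c c₁ δ C D ν (explorationLevel c τ))
    (hC₂ : 8 * (Real.exp 2 * (1 + c) ^ c) ≤ C) {m s : ℝ}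
    (hm : s * ((explorationLevel c τ + 1) * Real.log (2 / m ^ 3) + 2)
      ≤ 8 * (explorationLevel c τ * explorationLevel c τ ^ b)) :
    s * marginProb c τ m ≤ ν * explorationLevel c τ / τ := by
  have hL := one_lt_explorationLevel hc hτ
  have hexp := exp_neg_explorationLevel_le hc hτ
  have hmul := h.mul_rpow_le
  set L := explorationLevel c τ with hLdef
  have hLb : 0 < L ^ b := Real.rpow_pos_of_pos (by linarith) b
  have hLc : 0 < L ^ (-c) := Real.rpow_pos_of_pos (by linarith) _
  have hτ0 : (0 : ℝ) < τ := by exact_mod_cast (by omega)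
  have hX : 0 ≤ 8 * (L * L ^ b) := by positivity
  calc s * marginProb c τ m
      = Real.exp 2 * Real.exp (-L) * (s * ((L + 1) * Real.log (2 / m ^ 3) + 2)) := by
        rw [marginProb, ← Real.exp_add, ← hLdef, ← sub_eq_add_neg]; ring
    _ ≤ Real.exp 2 * Real.exp (-L) * (8 * (L * L ^ b)) := by gcongr
    _ ≤ Real.exp 2 * ((1 + c) ^ c * L ^ (-c) / τ) * (8 * (L * L ^ b)) := by gcongr
    _ = 8 * (Real.exp 2 * (1 + c) ^ c) * (L * L ^ b * L ^ (-c)) / τ := by ring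
    _ ≤ C * (L * L ^ b * L ^ (-c)) / τ := by gcongr
    _ ≤ _ := by gcongr

/-- Without a margin the order is L^(2-c)/τ; a factor s of order L^(b-1), from a small gap or a
small proportion of slots, makes up for it. -/
theorem LargeLevel.underProb_mul_le (hc : 0 < c) (hτ : 3 ≤ τ)
    (h : LargeLevel b c c₁ δ C D ν (explorationLevel c τ))
    {B s : ℝ} (hB : 4 * B * (Real.exp 2 * (1 + c) ^ c) ≤ C) (hs : 0 ≤ s)
    (hsB : s * explorationLevel c τ ≤ B * explorationLevel c τ ^ b) :
    s * underProb c τ ≤ ν * explorationLevel c τ / τ := by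
  have hL := one_lt_explorationLevel hc hτ
  have hexp := exp_neg_explorationLevel_le hc hτ
  have hmul := h.mul_rpow_le
  set L := explorationLevel c τ with hLdef
  have hLb : 0 < L ^ b := Real.rpow_pos_of_pos (by linarith) b
  have hLc : 0 < L ^ (-c) := Real.rpow_pos_of_pos (by linarith) _
  have hτ0 : (0 : ℝ) < τ := by exact_mod_cast (by omega)
  calc s * underProb c τ = Real.exp 2 * Real.exp (-L) * (s * ((L + 1) * L + 2)) := by
        rw [underProb, ← Real.exp_add, ← hLdef, ← sub_eq_add_neg]; ring
    _ ≤ Real.exp 2 * Real.exp (-L) * (s * (4 * (L * L))) := by gcongr; nlinarith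
    _ = Real.exp 2 * Real.exp (-L) * (4 * L * (s * L)) := by ring
    _ ≤ Real.exp 2 * ((1 + c) ^ c * L ^ (-c) / τ) * (4 * L * (B * L ^ b)) := by gcongr
    _ = 4 * B * (Real.exp 2 * (1 + c) ^ c) * (L * L ^ b * L ^ (-c)) / τ := by ring
    _ ≤ C * (L * L ^ b * L ^ (-c)) / τ := by gcongr
    _ ≤ _ := by gcongr

theorem log_two_div_tail_le {w : ℝ} (hw : 0 < w) :
    Real.log (2 / (w * Real.exp (-(Imin / w + 1))) ^ 3) ≤ 4 + 3 * (Imin + 1) / w := by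
  rw [Real.log_div (by norm_num) (by positivity), Real.log_pow, Real.log_mul hw.ne'
    (Real.exp_pos _).ne', Real.log_exp]
  have h1 := Real.one_sub_inv_le_log_of_pos hw
  have h2 := Real.log_two_lt_d9
  have h3 : 4 + 3 * (Imin + 1) / w = 4 + 3 * (Imin / w) + 3 * w⁻¹ := by ring
  rw [h3]
  push_cast
  linarith

theorem LargeLevel.isErrorBound (hc : 0 < c) (hτ : 3 ≤ τ) (hI : 0 < Imin)
    (hζ2 : ζ ≤ 1 / 2)
    (h : LargeLevel b c c₁ δ C D ν (explorationLevel c τ)) (hC₁ : 6 ≤ C)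
    (hC₂ : 16 * (Real.exp 2 * (1 + c) ^ c) ≤ C)
    (hC₃ : Real.log (2 / ζ ^ 3) ≤ C) (hC₄ : 16 + 12 * (Imin + 1) / (1 - ζ) ≤ C) :
    IsErrorBound c Imin τ ζ (explorationLevel c τ ^ (-(1 - b)))
      (ν * explorationLevel c τ / τ) := by
  have hP : 0 < Real.exp 2 * (1 + c) ^ c := by positivity
  have hkey : ∀ {m s : ℝ}, s * ((explorationLevel c τ + 1) * Real.log (2 / m ^ 3) + 2)
      ≤ 8 * (explorationLevel c τ * explorationLevel c τ ^ b) →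
      s * marginProb c τ m ≤ ν * explorationLevel c τ / τ := fun hm =>
    h.marginProb_mul_le hc hτ (by linarith) hm
  have hL2 := h.two_le
  have hCb := h.le_rpow
  have hlog := h.log_le
  have hunder := h.underProb_mul_le (s := explorationLevel c τ ^ (-(1 - b)) +
    3 / explorationLevel c τ) (B := 4) hc hτ (by linarith)
  set L := explorationLevel c τ with hLdef
  have hL0 : 0 < L := by linarith
  have hLb : 0 < L ^ b := Real.rpow_pos_of_pos hL0 b
  have hLLb : 2 * L ^ b ≤ L * L ^ b := by gcongr
  set W := L ^ (-(1 - b)) with hW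
  have hW0 : 0 < W := Real.rpow_pos_of_pos hL0 _
  have hWL : W * L = L ^ b := by
    conv_lhs => rw [hW, ← Real.rpow_one L, ← Real.rpow_mul hL0.le]
    rw [← Real.rpow_add hL0]; ring_nf
  have hLinv : 1 / L ≤ W := by
    rw [div_le_iff₀ hL0, hWL]; linarith
  have hkey₁ : ∀ {m : ℝ}, Real.log (2 / m ^ 3) ≤ L ^ b →
      marginProb c τ m ≤ ν * L / τ := by
    intro m hm
    have := hkey (m := m) (s := 1) (by
      have := mul_le_mul_of_nonneg_left hm (show 0 ≤ L + 1 by linarith)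
      nlinarith)
    rwa [one_mul] at this
  have hlog2 := Real.log_two_lt_d9
  constructor
  · exact hkey₁ (hC₃.trans hCb)
  · refine hkey₁ ?_
    have e1 : 2 / (1 / (L + 1)) ^ 3 ≤ 2 ^ 4 * L ^ 3 := by
      have : 2 / (1 / (L + 1)) ^ 3 = 2 * (L + 1) ^ 3 := by field_simp
      rw [this]
      have : (L + 1) ^ 3 ≤ (2 * L) ^ 3 := by gcongr; linarith
      nlinarith
    have e2 := Real.log_le_log (by positivity) e1
    rw [Real.log_mul (by norm_num) (by positivity), Real.log_pow, Real.log_pow] at e2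
    push_cast at e2
    linarith
  · refine hkey₁ ?_
    have e1 : 2 / (1 / L * (1 / L)) ^ 3 = 2 * L ^ 6 := by field_simp
    rw [e1, Real.log_mul (by norm_num) (by positivity), Real.log_pow]
    push_cast
    linarith
  · refine hunder (by positivity) ?_
    rw [add_mul, hWL, div_mul_cancel₀ _ hL0.ne']
    linarith
  · intro w hw hw1
    have hw0 : 0 < w := hW0.trans_le hw
    have hρ : 0 < 1 - ζ := by linarith
    refine hkey ?_
    -- The logarithm for the tail margin grows like 1/w, and the gap factor w + 3/L ≤ 4w cancels
    -- this.
    have e1 := log_two_div_tail_le (Imin := Imin) (w := (1 - ζ) * w) (by positivity)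
    have e2 : w + 3 / L ≤ 4 * w := by
      have : 3 / L = 3 * (1 / L) := by ring
      linarith
    have e3 : 0 ≤ 4 + 3 * (Imin + 1) / ((1 - ζ) * w) := by positivity
    calc _ ≤ 4 * w * ((L + 1) * (4 + 3 * (Imin + 1) / ((1 - ζ) * w)) + 2) := by
          refine mul_le_mul_of_nonneg_right e2 ?_ |>.trans' ?_
          · positivity
          · gcongr
      _ = (L + 1) * (16 * w + 12 * (Imin + 1) / (1 - ζ)) + 8 * w := by field_simp; ring
      _ ≤ (L + 1) * (16 * 1 + 12 * (Imin + 1) / (1 - ζ)) + 8 * 1 := by gcongr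
      _ ≤ (L + 1) * L ^ b + 8 := by
          rw [mul_one, mul_one]
          gcongr
          exact hC₄.trans hCb
      _ ≤ _ := by nlinarith

end Bounds


/-! ### The regret bound -/

theorem nat_mul_exp_neg_explorationLevel_le {c : ℝ} (hc : 0 < c) {τ : ℕ} (hτ : 3 ≤ τ) :
    τ * Real.exp (-explorationLevel c τ) ≤ 1 := by
  have h3 : (3 : ℝ) ≤ τ := by exact_mod_cast hτ
  have h := log_le_explorationLevel hc hτ
  have h1 : (τ : ℝ) ≤ Real.exp (explorationLevel c τ) := by
    rw [← Real.exp_log (show (0 : ℝ) < τ by linarith)]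
    exact Real.exp_le_exp.2 h
  rw [Real.exp_neg, ← div_eq_mul_inv]
  exact (div_le_one (Real.exp_pos _)).2 h1

theorem nat_mul_underProb_le {c : ℝ} (hc : 0 < c) {τ : ℕ} (hτ : 3 ≤ τ) :
    τ * underProb c τ ≤ 4 * Real.exp 2 * explorationLevel c τ ^ 2 := by
  have h1 := nat_mul_exp_neg_explorationLevel_le hc hτ
  have hL := one_lt_explorationLevel hc hτ
  set L := explorationLevel c τ with hLdef
  calc τ * underProb c τ = Real.exp 2 * (τ * Real.exp (-L)) * ((L + 1) * L + 2) := by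
        rw [underProb, ← hLdef, sub_eq_add_neg, Real.exp_add]; ring
    _ ≤ Real.exp 2 * 1 * (4 * L ^ 2) := by gcongr; nlinarith
    _ = _ := by ring

section Run

variable {Ω : Type*} [mΩ : MeasurableSpace Ω] {μ : Measure Ω} {K : ℕ}
  {ℱ : Filtration ℕ mΩ} {θ : ℕ → Fin K → ℝ} {X : ℕ → Ω → Fin K → Bool} {sel : ℕ → Ω → Fin K}
  {rK c σ Imin : ℝ} {τ T : ℕ} {r : Fin K → ℝ} {kstar : ℕ → Fin K}

/-- Constant in front of the exponentially small term in the regret of a testable rate. -/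
def overestimateConst (ζ Imin : ℝ) : ℝ :=
  (4 / ζ ^ 2 + 1) * (4 * ((4 / ζ ^ 2 + 1) * (1 + 1 / √(Imin / 2))) + 4 * Real.exp 2
    + 2 * (4 / ζ ^ 2 + 1) + 2)

/-- Both polynomial factors have order L², because w ≤ L. In the application w = 1/W and Q = exp(-c₁
L^b), which beats L⁴. -/
theorem overestimate_sum_le {ζ I L w t Q P e : ℝ} (hL : 2 ≤ L) (hwL : w ≤ L) (hw : 0 < w)
    (ht : 1 ≤ t) (hQ : 0 ≤ Q) (hP : P ≤ t * (4 * Real.exp 2 * L ^ 2)) (he : e ≤ t) :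
    (4 / ζ ^ 2 * (L * w) + 1) * Q * ((t + 1) * (2 * (4 / ζ ^ 2 * (L * w) +
      (4 / ζ ^ 2 * (L * w) + 1) / √(I / 2))) + 1 + (P + (t + 1) * (4 / ζ ^ 2 * (L * w) + 1) + e))
      ≤ t * (overestimateConst ζ I * L ^ 4 * Q) := by
  have hL0 : 0 < L := by linarith
  have hLsq : 1 ≤ L ^ 2 := by nlinarith
  have hs0 : 0 ≤ √(I / 2) := Real.sqrt_nonneg _
  have hB : 0 ≤ 4 / ζ ^ 2 := by positivity
  rw [overestimateConst]
  set s := √(I / 2)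
  set B := 4 / ζ ^ 2
  have hB0 : 0 ≤ B * (L * w) := by positivity
  have c1 : B * (L * w) + 1 ≤ (B + 1) * L ^ 2 := by
    have h1 : L * w ≤ L ^ 2 := by rw [pow_two]; gcongr
    have := mul_le_mul_of_nonneg_left h1 hB
    linarith
  set m₀ := B * (L * w)
  set A := B + 1
  have hA0 : 0 < A := by positivity
  have c2 : m₀ + (m₀ + 1) / s ≤ A * (1 + 1 / s) * L ^ 2 := by
    have h1 : (m₀ + 1) / s ≤ A * L ^ 2 / s := by gcongr
    have h2 : A * (1 + 1 / s) * L ^ 2 = A * L ^ 2 + A * L ^ 2 / s := by ring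
    linarith
  have hm₁ : 0 ≤ m₀ + (m₀ + 1) / s := by positivity
  set m₁ := m₀ + (m₀ + 1) / s
  have c4 : (t + 1) * (2 * m₁) + 1 + (P + (t + 1) * (m₀ + 1) + e) ≤
      t * ((4 * (A * (1 + 1 / s)) + 4 * Real.exp 2 + 2 * A + 2) * L ^ 2) := by
    have d1 : (t + 1) * (2 * m₁) ≤ (2 * t) * (2 * (A * (1 + 1 / s) * L ^ 2)) := by
      gcongr; linarith
    have d2 : (t + 1) * (m₀ + 1) ≤ (2 * t) * (A * L ^ 2) := by
      gcongr; linarith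
    have d3 : t * 1 ≤ t * L ^ 2 := by gcongr
    linarith
  calc _ ≤ (m₀ + 1) * Q *
        (t * ((4 * (A * (1 + 1 / s)) + 4 * Real.exp 2 + 2 * A + 2) * L ^ 2)) :=
        mul_le_mul_of_nonneg_left c4 (by positivity)
    _ ≤ A * L ^ 2 * Q * (t * ((4 * (A * (1 + 1 / s)) + 4 * Real.exp 2 + 2 * A + 2) * L ^ 2)) := by
        gcongr
    _ = _ := by ring

set_option maxHeartbeats 1000000 in
/-- Regret in clear slots for large windows. -/
theorem IsRun.sum_clear_le_of_largeLevel [IsProbabilityMeasure μ]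
    (h : IsRun μ rK c σ τ r θ kstar ℱ X sel) (k : Fin K) {b δ ζ C : ℝ} (hI : 0 < Imin)
    (hζ : 0 < ζ) (hζ2 : ζ ≤ 1 / 2) (hb : 0 < b) (hb2 : b ≤ 1 / 2) (hτT : τ ≤ T)
    (hL : LargeLevel b c (5 * ζ ^ 2 / (8 * Imin)) δ C (overestimateConst ζ Imin)
      (1 / (12 * Imin)) (explorationLevel c τ)) (hC₁ : 6 ≤ C)
    (hC₂ : 16 * (Real.exp 2 * (1 + c) ^ c) ≤ C) (hC₃ : Real.log (2 / ζ ^ 3) ≤ C)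
    (hC₄ : 16 + 12 * (Imin + 1) / (1 - ζ) ≤ C) (hC₅ : 2 + c ≤ C) (hC₆ : 1 / Imin ≤ C)
    (hδ : ∀ n ∈ clearSlots r θ kstar τ σ Imin T k, needMean r θ kstar τ σ n k < 1 →
      δ ≤ needMean r θ kstar τ σ n k ∧ needMean r θ kstar τ σ n k ≤ 1 - δ)
    (hshrink : ∀ p x : ℝ, 0 ≤ p → p < x → δ ≤ x → x ≤ 1 - δ → Imin ≤ klR p x →
      p + ζ * (1 - p) < x * (1 - ζ) ∧ 4 / 5 * Imin ≤ klR (p + ζ * (1 - p)) (x * (1 - ζ))) :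
    ∑ n ∈ clearSlots r θ kstar τ σ Imin T k, gap r θ kstar n k * μ.real {ω | sel n ω = k} ≤
      rK * (√(Imin / 2) *
          ∑ n ∈ confSlots r θ kstar τ σ Imin T k, (1 - μ.real {ω | sel n ω = k})
        + 3 * (T * explorationLevel c τ / (τ * Imin)) - 1) := by
  have hrK := h.rK_nonneg
  have hc := h.c_pos
  have hτ := h.three_le
  have hP0 := underProb_nonneg hc hτ
  have herr := hL.isErrorBound (ζ := ζ) hc hτ hI hζ2 hC₁ hC₂ hC₃ hC₄
  have hL2 := hL.two_le
  have hCb := hL.le_rpow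
  have hWδ := hL.rpow_le
  have hexp := hL.mul_exp_le
  have h3 := hL.three_le
  have hτP := nat_mul_underProb_le hc hτ
  have hτe := nat_mul_exp_neg_explorationLevel_le hc hτ
  have hLτ := explorationLevel_le hc hτ
  have hlate := hL.underProb_mul_le (B := 4) (s := 4 * (1 / explorationLevel c τ + 1 / τ))
    hc hτ (by linarith) (by have := one_lt_explorationLevel hc hτ; positivity)
  have hτ0 : (0 : ℝ) < τ := by exact_mod_cast (by omega)
  have ht1 : (1 : ℝ) ≤ T / τ := (one_le_div hτ0).2 (by exact_mod_cast hτT)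
  have hT : (T : ℝ) = T / τ * τ := by field_simp
  set L := explorationLevel c τ with hLdef
  have hL0 : 0 < L := by linarith
  have hLb : 0 < L ^ b := Real.rpow_pos_of_pos hL0 b
  set W := L ^ (-(1 - b)) with hW
  have hW0 : 0 < W := Real.rpow_pos_of_pos hL0 _
  have hWL : W * L = L ^ b := by
    conv_lhs => rw [hW, ← Real.rpow_one L, ← Real.rpow_mul hL0.le]
    rw [← Real.rpow_add hL0]; ring_nf
  have hWinv : 1 / W = L ^ (1 - b) := by rw [hW, Real.rpow_neg hL0.le, one_div, inv_inv]
  have hWinv1 : 1 / W ≤ L := by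
    rw [hWinv]
    calc L ^ (1 - b) ≤ L ^ (1 : ℝ) := Real.rpow_le_rpow_of_exponent_le (by linarith) (by linarith)
      _ = L := Real.rpow_one L
  have hWinv2 : 1 / Imin ≤ 1 / W := by
    rw [hWinv]
    exact (hC₆.trans hCb).trans (Real.rpow_le_rpow_of_exponent_le (by linarith) (by linarith))
  set s := √(Imin / 2) with hs
  have hs0 : 0 < s := Real.sqrt_pos.2 (by positivity)
  -- Exactly the samples needed for the divergence 4/5 Imin that is left after shrinking.
  set l := 5 * L / (4 * Imin) with hl
  -- Makes the overestimation exponent m₀Wζ²/2 equal to 2L, so that its exponential is below 1/τ.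
  set m₀ := 4 / ζ ^ 2 * (L * (1 / W)) with hm₀
  -- Makes (m₀ + 1)/(m₁ - m₀) equal to √(Imin/2), the price at which unselected confused slots are
  -- charged.
  set m₁ := m₀ + (m₀ + 1) / s with hm₁
  have hl0 : 0 < l := by positivity
  have hm₀0 : 0 < m₀ := by positivity
  have hζsq : ζ ^ 2 ≤ 1 / 4 := by nlinarith
  have h16 : 16 ≤ 4 / ζ ^ 2 := by
    rw [le_div_iff₀ (by positivity)]; linarith
  have hlm : l ≤ m₀ := by
    have e1 : l = 5 / 4 * (L * (1 / Imin)) := by rw [hl]; field_simp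
    rw [e1, hm₀]
    have e2 : L * (1 / Imin) ≤ L * (1 / W) := by gcongr
    have e3 : 0 ≤ L * (1 / Imin) := by positivity
    nlinarith
  have hm₀κ : m₀ * (W * ζ ^ 2 / 2) = 2 * L := by rw [hm₀]; field_simp; ring
  have hlκ : l * (W * ζ ^ 2 / 2) = 5 * ζ ^ 2 / (8 * Imin) * L ^ b := by
    rw [← hWL, hl]; field_simp; ring
  have hm₁m₀ : (m₀ + 1) / (m₁ - m₀) = s := by
    rw [hm₁, add_sub_cancel_left]; field_simp
  have hmain := h.sum_clear_le (k := k) (T := T) (m₀ := m₀) (m₁ := m₁) (l := l) hI hζ hζ2 hW0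
    hWδ hl0 hlm
    (lt_add_of_pos_right _ (by positivity)) hL2 (le_of_eq (by rw [← hLdef, hl]; field_simp)) hδ hshrink
    herr (by positivity)
  rw [hm₁m₀, hm₀κ, hlκ] at hmain
  refine hmain.trans ?_
  rw [← mul_add]
  refine mul_le_mul_of_nonneg_left ?_ hrK
  set t := (T : ℝ) / τ with ht
  set ν := 1 / (12 * Imin) with hν
  have hν0 : 0 < ν := by positivity
  have hνI : 6 * ν = 1 / (2 * Imin) := by rw [hν]; field_simp; ring
  set Q := Real.exp (-(5 * ζ ^ 2 / (8 * Imin) * L ^ b)) with hQ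
  have hQ0 : 0 < Q := Real.exp_pos _
  have b1 : (T : ℝ) * (ν * L / τ) = t * (ν * L) := by rw [ht]; ring
  have b2 : (t + 1) * (l + 1) ≤ t * (5 * L / (2 * Imin) + 2) := by
    have : 5 * L / (2 * Imin) = 2 * l := by rw [hl]; field_simp; ring
    rw [this]
    calc (t + 1) * (l + 1) ≤ (2 * t) * (l + 1) := by gcongr; linarith
      _ = _ := by ring
  have b3' : τ * Real.exp (-(2 * L)) ≤ 1 :=
    le_trans (mul_le_mul_of_nonneg_left (Real.exp_le_exp.2 (by linarith)) hτ0.le) hτe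
  have b3 : T * Real.exp (-(2 * L)) ≤ t := by
    rw [hT, mul_assoc]
    exact mul_le_of_le_one_right (by linarith) b3'
  have b4 : (m₀ + 1) * Q * ((t + 1) * (2 * m₁) + 1 + (T * underProb c τ + (t + 1) * (m₀ + 1)
      + T * Real.exp (-(2 * L)))) ≤ t * (ν * L) := by
    have hP : T * underProb c τ ≤ t * (4 * Real.exp 2 * L ^ 2) := by
      rw [hT, mul_assoc]
      exact mul_le_mul_of_nonneg_left hτP (by linarith)
    have hkey := overestimate_sum_le (ζ := ζ) (I := Imin) (L := L) (w := 1 / W) (t := t) (Q := Q)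
      (P := T * underProb c τ) (e := T * Real.exp (-(2 * L))) hL2 hWinv1 (by positivity) ht1
      hQ0.le hP b3
    rw [← hs, ← hm₀, ← hm₁] at hkey
    exact hkey.trans (mul_le_mul_of_nonneg_left hexp (by linarith))
  have b5 : (3 * (T : ℝ) / τ + 1) * (1 / L * τ + 1) * underProb c τ ≤ t * (ν * L) := by
    have hLle : L ≤ (1 + c) * τ := by
      have := Real.log_le_self hτ0.le
      exact hLτ.trans (by gcongr)
    have c1 := hlate (by
      have e1 : 4 * (1 / L + 1 / (τ : ℝ)) * L = 4 * (1 + L / τ) := by field_simp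
      have e2 : L / τ ≤ 1 + c := (div_le_iff₀ hτ0).2 hLle
      rw [e1]
      linarith)
    have c2 : 3 * (T : ℝ) / τ + 1 ≤ 4 * t := by
      rw [mul_div_assoc, ← ht]; linarith
    calc _ ≤ 4 * t * (1 / L * τ + 1) * underProb c τ := by gcongr
      _ = t * τ * (4 * (1 / L + 1 / τ) * underProb c τ) := by field_simp
      _ ≤ t * τ * (ν * L / τ) := by gcongr
      _ = _ := by field_simp
  -- The budget: T/τ + 1 ≤ 2T/τ doubles l to 5L/(2 Imin). The rest L/(2 Imin) = 6νL pays for four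
  -- errors of size νL and, through 3 ≤ νL, for the additive constants.
  have b6 : 3 * (T * L / (τ * Imin)) = t * (5 * L / (2 * Imin) + 6 * ν * L) := by
    rw [hνI, ht]; field_simp; ring
  rw [b6, b1]
  have b7 : t * 3 ≤ t * (ν * L) := by gcongr
  linarith

/-- Regret bound when the second term of the theorem dominates the last one. -/
theorem IsRun.regret_div_le_of_clear [IsProbabilityMeasure μ]
    (h : IsRun μ rK c σ τ r θ kstar ℱ X sel) (hI : 0 < Imin) {ε : ℝ} (hε : 2 ≤ ε) (hτT : τ ≤ T)
    (hclear : ∀ k, ∑ n ∈ clearSlots r θ kstar τ σ Imin T k,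
        gap r θ kstar n k * μ.real {ω | sel n ω = k} ≤
      rK * (√(Imin / 2) *
          ∑ n ∈ confSlots r θ kstar τ σ Imin T k, (1 - μ.real {ω | sel n ω = k})
        + 3 * (T * explorationLevel c τ / (τ * Imin)) - 1)) :
    regret μ r θ kstar sel T / T ≤
      rK * (√(Imin / 2) + 2 * τ * σ) * (confusionCount r θ kstar T Imin τ σ : ℝ) / T
      + K * rK * (1 + ε) * (explorationLevel c τ / (τ * Imin)) := by
  have hrK := h.rK_nonneg
  have hσ := h.σ_pos
  have hL := one_lt_explorationLevel h.c_pos h.three_le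
  have hτ0 : (0 : ℝ) < τ := by have := h.three_le; exact_mod_cast (by omega)
  have hT0 : (0 : ℝ) < T := hτ0.trans_le (by exact_mod_cast hτT)
  have hreg := h.regret_le (Imin := Imin) (T := T)
  have hsum := sum_le_sum fun k (_ : k ∈ (univ : Finset (Fin K))) => hclear k
  set L := explorationLevel c τ
  set s := √(Imin / 2)
  have hs : 0 ≤ s := Real.sqrt_nonneg _
  -- Regret arises only in the selected confused pairs; the share of G belonging to the unselected
  -- ones pays for `Y`. The -1 for each k cancels the initialisation cost K rK.
  have hcount : (confusionCount r θ kstar T Imin τ σ : ℝ) =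
      ∑ k, ∑ n ∈ confSlots r θ kstar τ σ Imin T k, μ.real {ω | sel n ω = k} +
      ∑ k, ∑ n ∈ confSlots r θ kstar τ σ Imin T k, (1 - μ.real {ω | sel n ω = k}) := by
    rw [confusionCount_eq, ← sum_add_distrib]
    push_cast
    refine sum_congr rfl fun k _ => ?_
    rw [← sum_add_distrib]
    simp
  rw [← mul_sum, sum_sub_distrib, sum_add_distrib, ← mul_sum, sum_const, sum_const, card_univ,
    Fintype.card_fin, nsmul_eq_mul, nsmul_eq_mul, mul_one] at hsum
  set Y := ∑ k, ∑ n ∈ confSlots r θ kstar τ σ Imin T k, (1 - μ.real {ω | sel n ω = k})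
  have hY : 0 ≤ Y := sum_nonneg fun k _ => sum_nonneg fun n _ =>
    sub_nonneg.2 measureReal_le_one
  rw [div_le_iff₀ hT0, add_mul, div_mul_cancel₀ _ hT0.ne', hcount, mul_add]
  have e1 : rK * (s * Y) ≤ rK * (s + 2 * τ * σ) * Y := by
    have : 0 ≤ rK * (2 * τ * σ) * Y := by positivity
    linarith
  have e2 : K * rK * (1 + 2) * (L / (τ * Imin)) * T ≤ K * rK * (1 + ε) * (L / (τ * Imin)) * T := by
    gcongr
  have e3 : K * rK * (1 + 2) * (L / (τ * Imin)) * T = rK * (K * (3 * (T * L / (τ * Imin)))) := by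
    ring
  linarith

end Run

theorem bounds_of_le_mul_one_sub {δ x : ℝ} (hx : 0 < x) (hx1 : x < 1) (h : δ ≤ x * (1 - x)) :
    δ ≤ x ∧ x ≤ 1 - δ := by
  constructor <;> nlinarith

/-! ### Bounds for g₀ -/

section GZero

variable {K : ℕ} {r : Fin K → ℝ} {θ : ℕ → Fin K → ℝ} {kstar : ℕ → Fin K} {σ : ℝ} {τ T : ℕ}

theorem needMean_eq (n : ℕ) (k : Fin K) :
    r (kstar n) / r k * (θ n (kstar n) - σ * τ) = needMean r θ kstar τ σ n k := by
  unfold needMean; ring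

/-- Positivity excludes the default value 0 of `sInf` on sets unbounded below, so g₀ is a true lower
bound. -/
theorem two_mul_gZero_le (hr : ∀ k, 0 < r k) (hg : 0 < gZero r θ kstar T τ σ) {n : ℕ} {k : Fin K}
    (hn : 1 ≤ n) (hnT : n ≤ T) (hk : k ≠ kstar n) (hx : needMean r θ kstar τ σ n k < 1) :
    2 * gZero r θ kstar T τ σ ≤
      needMean r θ kstar τ σ n k * (1 - needMean r θ kstar τ σ n k) := by
  unfold gZero at hg ⊢
  simp only [needMean_eq] at hg ⊢
  set S := {y : ℝ | ∃ n k, 1 ≤ n ∧ n ≤ T ∧ k ≠ kstar n ∧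
    r (kstar n) * (θ n (kstar n) - σ * τ) < r k ∧
    y = needMean r θ kstar τ σ n k * (1 - needMean r θ kstar τ σ n k)}
  have hb : BddBelow S := by
    by_contra hb
    rw [Real.sInf_of_not_bddBelow hb] at hg
    simp at hg
  have := csInf_le hb (a := needMean r θ kstar τ σ n k * (1 - needMean r θ kstar τ σ n k))
    ⟨n, k, hn, hnT, hk, by
      unfold needMean at hx
      rw [div_lt_one (hr k)] at hx
      rwa [mul_comm σ], rfl⟩
  linarith

theorem gZero_le : gZero r θ kstar T τ σ ≤ 1 / 8 := by
  by_contra hcon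
  push Not at hcon
  unfold gZero at hcon
  simp only [needMean_eq] at hcon
  set S := {y : ℝ | ∃ n k, 1 ≤ n ∧ n ≤ T ∧ k ≠ kstar n ∧
    r (kstar n) * (θ n (kstar n) - σ * τ) < r k ∧
    y = needMean r θ kstar τ σ n k * (1 - needMean r θ kstar τ σ n k)}
  have hne : S.Nonempty := by
    by_contra hne
    rw [Set.not_nonempty_iff_eq_empty] at hne
    rw [hne, Real.sInf_empty] at hcon
    norm_num at hcon
  have hb : BddBelow S := by
    by_contra hb
    rw [Real.sInf_of_not_bddBelow hb] at hcon
    norm_num at hcon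
  obtain ⟨y, hy⟩ := hne
  have h1 := csInf_le hb hy
  obtain ⟨n, k, -, -, -, -, rfl⟩ := hy
  nlinarith [sq_nonneg (needMean r θ kstar τ σ n k - 1 / 2)]

end GZero

theorem mainTheorem7
    (rK c Imin ε : ℝ) (hrK : 0 < rK) (hc : 0 < c) (hImin : 0 < Imin) (hε : 0 < ε) :
    ∃ C : ℝ, 0 < C ∧
      ∀ (K : ℕ) [NeZero K] (r : Fin K → ℝ), (∀ k, 0 < r k) → StrictMono r → r ⊤ = rK →
      ∀ (θ : ℕ → Fin K → ℝ), (∀ n k, 1 ≤ n → θ n k ∈ Set.Icc (0 : ℝ) 1) →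
      ∀ (σ : ℝ), 0 < σ → LipschitzEvolution θ σ →
      ∀ (kstar : ℕ → Fin K), IsBestRate r θ kstar →
      ∀ (τ T : ℕ), 3 ≤ τ → τ ≤ T →
      ∀ (Ω : Type*) [mΩ : MeasurableSpace Ω] (μ : Measure Ω) [IsProbabilityMeasure μ]
        (ℱ : Filtration ℕ mΩ) (X : ℕ → Ω → Fin K → Bool) (sel : ℕ → Ω → Fin K),
        IsBernoulliModel μ ℱ θ X sel → IsSWKLRUCB r c τ X sel →
        regret μ r θ kstar sel T / T ≤
          rK * (√(Imin / 2) + 2 * τ * σ) * (confusionCount r θ kstar T Imin τ σ : ℝ) / T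
          + K * rK * (1 + ε) * ((Real.log τ + c * Real.log (Real.log τ)) / (τ * Imin))
          + C * K / ((τ : ℝ) * Real.log τ ^ c) ^ (gZero r θ kstar T τ σ * ε ^ 2) := by
  obtain ⟨C₁, hC₁, hpow₁⟩ := exists_rpow_le_mul_exp_half 2
  obtain ⟨C₂, hC₂, hpow₂⟩ := exists_rpow_le_mul_exp_half (1 + c)
  -- If gε² > 1/2, needed means x in (0, 1) satisfy x(1 - x) ≥ 2g > 1/ε², hence δ ≤ x ≤ 1 - δ with δ
  -- depending on ε only.
  set δ := min (1 / ε ^ 2) (1 / 2) with hδ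
  have hδ0 : 0 < δ := by positivity
  obtain ⟨ζ, hζ0, hζ2, hshrink⟩ := exists_klR_shrink hδ0 (min_le_right _ _) hImin
  -- b < c makes L^(1+b-c) small against L, and b ≤ 1/2 gives L^b ≤ L^(1-b).
  set b := min c 1 / 2 with hb
  have hb0 : 0 < b := by positivity
  have hb2 : b ≤ 1 / 2 := by rw [hb]; linarith [min_le_right c 1]
  have hbc : b < c := by rw [hb]; linarith [min_le_left c 1]
  set Q := max (max 6 (16 * (Real.exp 2 * (1 + c) ^ c))) (max (max (Real.log (2 / ζ ^ 3))
    (16 + 12 * (Imin + 1) / (1 - ζ))) (max (2 + c) (1 / Imin))) with hQ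
  have hlarge := (tendsto_explorationLevel hc).eventually
    (eventually_largeLevel (b := b) (c := c) (c₁ := 5 * ζ ^ 2 / (8 * Imin)) (δ := δ)
      (ν := 1 / (12 * Imin)) Q (overestimateConst ζ Imin) hb0 (by linarith) hbc (by positivity)
      hδ0 (by positivity))
  obtain ⟨τ₀, hτ₀⟩ := Filter.eventually_atTop.1 hlarge
  set D₁ := rK * (4 * Real.exp 2 * C₁ + (2 * (8 + ε ^ 2) / Imin + 3) * C₂ + 1) with hD₁
  have hD₁0 : 0 < D₁ := by positivity
  set M := (1 + c) * Real.log τ₀ * ε ^ 2 with hM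
  set D₂ := rK * Real.exp M with hD₂
  have hD₂0 : 0 < D₂ := by positivity
  -- `D₁` serves the case gε² ≤ 1/2, `D₂` the windows τ < τ₀, and rK the case g ≤ 0.
  refine ⟨D₁ + D₂ + rK, by positivity, ?_⟩
  intro K _ r hr hmono htop θ hθ σ hσ hlip kstar hbest τ T hτ hτT Ω mΩ μ _ ℱ X sel hmodel halg
  have h : IsRun μ rK c σ τ r θ kstar ℱ X sel :=
    ⟨hr, fun k => htop ▸ hmono.monotone le_top, hθ, hσ, hlip, hbest, hτ, hc, hmodel, halg⟩
  set g := gZero r θ kstar T τ σ with hg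
  have hg8 : g ≤ 1 / 8 := gZero_le
  have hK : (1 : ℝ) ≤ K := by exact_mod_cast NeZero.one_le
  have hL := one_lt_explorationLevel hc hτ
  have hLτ := explorationLevel_le hc hτ
  have hτ0 : (0 : ℝ) < τ := by exact_mod_cast (by omega)
  have hT0 : (0 : ℝ) < T := hτ0.trans_le (by exact_mod_cast hτT)
  rw [← exp_explorationLevel (c := c) hτ, ← Real.exp_mul]
  change _ ≤ rK * (√(Imin / 2) + 2 * τ * σ) * (confusionCount r θ kstar T Imin τ σ : ℝ) / T
    + K * rK * (1 + ε) * (explorationLevel c τ / (τ * Imin)) + _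
  set L := explorationLevel c τ with hLdef
  set E := Real.exp (L * (g * ε ^ 2)) with hE
  have hE0 : 0 < E := Real.exp_pos _
  have hconf : 0 ≤ rK * (√(Imin / 2) + 2 * τ * σ) *
      (confusionCount r θ kstar T Imin τ σ : ℝ) / T := by positivity
  have hmid : 0 ≤ K * rK * (1 + ε) * (L / (τ * Imin)) := by positivity
  have hlast : 0 ≤ (D₁ + D₂ + rK) * K / E := by positivity
  have htriv : regret μ r θ kstar sel T / T ≤ rK := by
    rw [div_le_iff₀ hT0]; exact h.regret_le_trivial
  have hlast_of : ∀ {y}, rK * E ≤ y → y ≤ D₁ + D₂ + rK → rK ≤ (D₁ + D₂ + rK) * K / E := by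
    intro y h1 h2
    rw [le_div_iff₀ hE0]
    nlinarith
  rcases le_or_gt g 0 with hg0 | hg0
  · have hE1 : E ≤ 1 := Real.exp_le_one_iff.2
      (mul_nonpos_of_nonneg_of_nonpos (by linarith)
        (mul_nonpos_of_nonpos_of_nonneg hg0 (sq_nonneg ε)))
    have := hlast_of (y := rK) (by nlinarith) (by linarith)
    linarith
  have hpairs : ∀ n k, 1 ≤ n → n ≤ T → k ≠ kstar n → needMean r θ kstar τ σ n k < 1 →
      2 * g ≤ needMean r θ kstar τ σ n k * (1 - needMean r θ kstar τ σ n k) :=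
    fun n k h1 h2 h3 h4 => two_mul_gZero_le hr hg0 h1 h2 h3 h4
  rcases le_or_gt (g * ε ^ 2) (1 / 2) with hgε | hgε
  · have h1 := h.regret_div_le_of_small hImin hε hg0 hgε hτT hpairs hC₁.le hC₂.le hpow₁ hpow₂
    rw [← hD₁, ← hLdef, ← hE] at h1
    have h2 : D₁ * K / E ≤ (D₁ + D₂ + rK) * K / E := by gcongr; linarith
    linarith
  rcases lt_or_ge τ τ₀ with hlt | hge
  · have h1 : L * (g * ε ^ 2) ≤ M := by
      have e1 : Real.log τ ≤ Real.log τ₀ :=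
        Real.log_le_log hτ0 (by exact_mod_cast hlt.le)
      have e2 : g * ε ^ 2 ≤ 1 * ε ^ 2 := by gcongr; linarith
      calc L * (g * ε ^ 2) ≤ (1 + c) * Real.log τ₀ * (1 * ε ^ 2) := by
            refine mul_le_mul (hLτ.trans ?_) e2 (by positivity) ?_
            · gcongr
            · have := one_lt_log_of_three_le hτ
              exact mul_nonneg (by linarith) (by linarith)
        _ = M := by rw [hM]; ring
    have h2 : rK * E ≤ D₂ := mul_le_mul_of_nonneg_left (Real.exp_le_exp.2 h1) hrK.le
    have := hlast_of h2 (by linarith)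
    linarith
  -- g ≤ 1/8 and gε² > 1/2 force ε ≥ 2, so the middle term leaves room for 3L/(τ Imin) per rate.
  · have hε2 : 2 ≤ ε := by
      by_contra hlt
      push Not at hlt
      have e1 : ε ^ 2 ≤ 2 ^ 2 := by gcongr
      have e2 : g * ε ^ 2 ≤ 1 / 8 * 2 ^ 2 := by gcongr
      linarith
    have hQ1 : max 6 (16 * (Real.exp 2 * (1 + c) ^ c)) ≤ Q := le_max_left _ _
    have hQ2 : max (max (Real.log (2 / ζ ^ 3)) (16 + 12 * (Imin + 1) / (1 - ζ)))
      (max (2 + c) (1 / Imin)) ≤ Q := le_max_right _ _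
    rw [max_le_iff] at hQ1
    rw [max_le_iff, max_le_iff, max_le_iff] at hQ2
    have hδx : ∀ n k, 1 ≤ n → n ≤ T → k ≠ kstar n → 0 < needMean r θ kstar τ σ n k →
        needMean r θ kstar τ σ n k < 1 →
        δ ≤ needMean r θ kstar τ σ n k ∧ needMean r θ kstar τ σ n k ≤ 1 - δ := by
      intro n k h1 h2 h3 h4 h5
      refine bounds_of_le_mul_one_sub h4 h5 (le_trans ?_ (hpairs n k h1 h2 h3 h5))
      refine (min_le_left _ _).trans ?_
      rw [div_le_iff₀ (by positivity)]
      linarith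
    have h1 := h.regret_div_le_of_clear hImin hε2 hτT fun k =>
      h.sum_clear_le_of_largeLevel k hImin hζ0 hζ2 hb0 hb2 hτT (hτ₀ τ hge) hQ1.1 hQ1.2 hQ2.1.1
        hQ2.1.2 hQ2.2.1 hQ2.2.2 (fun n hn hx => by
          obtain ⟨⟨hn1, hnT⟩, hnK, hkn, hcf⟩ := mem_clearSlots.1 hn
          exact hδx n k hn1 hnT hkn ((h.upMean_pos hn1 k).trans (h.not_confused hn1 hcf).1) hx)
        hshrink
    linarith

end
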